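/- **Conventions.** A *system* $(X,\mathcal B,\mu,T)$ is an invertible measure preserving transformation $T$ of a standard Borel probability space; $T^mf=f\circ T^m$ for $m\in\mathbb Z$, $[\cdot]$ is the floor function, functions are complex valued. All conditions below on sequences indexed by $N\in\mathbb N$ are required for large $N$ only. *Seminorms and nilfactor.* For $f\in L^\infty(\mu)$ let $|||f|||_1=\|\mathbb E(f\mid\mathcal I(T))\|_{2}$, with $\mathcal I(T)$ the $\sigma$-algebra of $T$-invariant sets, and $|||f|||_{k+1}^{2^{k+1}}=\lim_{N\to\infty}\frac1N\sum_{n=1}^N|||\bar f\cdot T^nf|||_k^{2^k}$. The factor $\mathcal Z_k$ is characterized by: for $f\in L^\infty(\mu)$, $\mathbb E(f\mid\mathcal Z_k)=0$ if and only if $|||f|||_{k+1}=0$; the nilfactor is $\mathcal Z=\bigvee_{k\ge1}\mathcal Z_k$. (As a $\sigma$-algebra, $\mathcal Z_k$ is generated by the sets $A\in\mathcal B$ with $\int_A f\,d\mu=0$ for all $f\in L^\infty(\mu)$ with $|||f|||_{k+1}=0$.) *$R_\ell$-property.* A real sequence $(a_N)_N$ has the $R_1$-property if it is bounded, has constant (non-zero)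 sign, and $|a_N|N$ tends increasingly to $+\infty$. For $\ell\ge2$, sequences $(a_{1,N})_N,\dots,(a_{\ell,N})_N$ have the $R_\ell$-property if for every $1\le i\le\ell$ the sequence $(a_{i,N})_N$ has the $R_1$-property and at least one of the following holds for some $j_0\ne i$: (a) the sequences $\frac{a_{j_0,N}-a_{j,N}}{a_{i,N}}$, $j\ne j_0$, have the $R_{\ell-1}$-property; (b) $(a_{i,N}-a_{j_0,N})_N$ has the $R_1$-property and the sequences $\frac{a_{j,N}}{a_{i,N}-a_{j_0,N}}$, $j\neq j_0$, have the $R_{\ell-1}$-property; (c) $(a_{i,N}-a_{j_0,N})_N$ has the $R_1$-property and, for some $k_0\ne j_0,i$, the sequences $-\frac{a_{k_0,N}}{a_{i,N}-a_{j_0,N}}$ and $\frac{a_{j,N}-a_{k_0,N}}{a_{i,N}-a_{j_0,N}}$, $j\ne j_0,k_0$, have the $R_{\ell-1}$-property. *vdC-operations.* For a finite family $(\mathcal P_N)_N$ of sequences of real polynomials, a member $(p_N)_N$ and $h\in\mathbb N$, the vdC-operation gives the family of all $q_N(t+h)-p_N(t)$ and $q_N(t)-p_N(t)$ with $(q_N)_N$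 in the family, where the terms that are constant in $t$ are removed and terms of degree $1$ with the same leading coefficients are grouped (only one of them is kept). We say that $(\mathcal P_N)_N$ *reduces to $R$* if the following procedure always succeeds: as long as the family has a member of degree at least $2$, it is required that all its members and their pairwise differences are non-constant of degrees independent of $N$, and a vdC-operation is performed with any member $p$ of minimum degree and any sufficiently large $h$ (how large may depend on the previous choices and on $p$); for all such choices one arrives, after finitely many steps, at a family of polynomials of degree $1$, say $k$ many, whose leading coefficients have the $R_k$-property. *Super nice.* A sequence of $\ell$-tuples $(p_{1,N},\dots,p_{\ell,N})_N$ of real polynomials is *super nice* if the coefficients are bounded and (i) the polynomials $p_{i,N}$ and $p_{i,N}-p_{j,N}$, $i\neq j$, are non-constant with degrees independent of $N$; (ii) the family reduces to $R$; (ii)$'$ for every $i_0$ for which $p_{i_0,N}$ has maximal degree in the family, the family consisting of $-p_{i_0,N}$ and $p_{j,N}-p_{i_0,N}$, $j\ne i_0$, reduces to $R$. **Proposition.** Let $(p_{1,N},\dots,p_{\ell,N})_N$ be super nice, let $(X,\mathcal B,\mu,T)$ be a system and let $f_1,\dots,f_\ell\in L^\infty(\mu)$. If $\mathbb E(f_i\mid\mathcal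 Z)=0$ for at least one $i$, then $$\lim_{N\to\infty}\Big\|\frac1N\sum_{n=1}^N T^{[p_{1,N}(n)]}f_1\cdots T^{[p_{\ell,N}(n)]}f_\ell\Big\|_{2}=0 .$$ In other words, the nilfactor $\mathcal Z$ is characteristic: it is a $T$-invariant sub-$\sigma$-algebra and, for all $f_1,\dots,f_\ell\in L^\infty(\mu)$, $$\lim_{N\to\infty}\Big\|\frac1N\sum_{n=1}^N \prod_{i=1}^\ell T^{[p_{i,N}(n)]}f_i-\frac1N\sum_{n=1}^N \prod_{i=1}^\ell T^{[p_{i,N}(n)]}\mathbb E(f_i\mid\mathcal Z)\Big\|_{2}=0 .$$ -/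

import Mathlib

open MeasureTheory Filter Polynomial
open scoped ENNReal

noncomputable section

namespace VarPoly

/-! ### Polynomial sequences and van der Corput operations -/

/-- A sequence `N ↦ p N` of real polynomials (a variable polynomial). -/
abbrev PolySeq : Type := ℕ → ℝ[X]

/-- For all large `N` the polynomial `p N` is non-constant, of a degree independent of `N`. -/
def HasFixedPosDegree (p : PolySeq) : Prop :=
  ∃ d : ℕ, 1 ≤ d ∧ ∀ᶠ N in atTop, (p N).natDegree = d

/-- The members of the family and their pairwise differences are non-constant, of degrees
independent of `N` (for all large `N`). -/
def EssentiallyDistinct (P : List PolySeq) : Prop :=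
  (∀ p ∈ P, HasFixedPosDegree p) ∧ P.Pairwise fun p q => HasFixedPosDegree (p - q)

/-- `p` has minimum degree in the family `P` (for all large `N`). -/
def HasMinDegree (P : List PolySeq) (p : PolySeq) : Prop :=
  ∀ q ∈ P, ∀ᶠ N in atTop, (p N).natDegree ≤ (q N).natDegree

/-- `q N` does not depend on its variable, for all large `N`. -/
def IsConstSeq (q : PolySeq) : Prop :=
  ∀ᶠ N in atTop, (q N).natDegree = 0

/-- `q N` has degree one, for all large `N`. -/
def IsLinearSeq (q : PolySeq) : Prop :=
  ∀ᶠ N in atTop, (q N).natDegree = 1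

/-- Two sequences of degree one with the same leading coefficients; the van der Corput operation
groups them together. -/
def Grouped (q r : PolySeq) : Prop :=
  IsLinearSeq q ∧ IsLinearSeq r ∧ IsConstSeq (q - r)

open Classical in
/-- The van der Corput operation: list `q (t + h) - p t` and `q t - p t` for `q ∈ P`, remove the
terms that do not depend on `t`, and keep one representative of every group of terms of degree one
with the same leading coefficient. -/
def vdC (P : List PolySeq) (p : PolySeq) (h : ℕ) : List PolySeq :=
  (((P.map fun q N => (q N).comp (X + C (h : ℝ)) - p N) ++ P.map fun q N => q N - p N).filter
    fun q => ¬ IsConstSeq q).pwFilter fun q r => ¬ Grouped q r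

/-! ### The `R`-properties of real sequences -/

/-- The `R₁`-property: bounded, of constant sign, and `|a N| * N` increases to infinity
(all for large `N`). -/
def ROne (a : ℕ → ℝ) : Prop :=
  (∃ C : ℝ, ∀ᶠ N in atTop, |a N| ≤ C) ∧
  ((∀ᶠ N in atTop, 0 < a N) ∨ (∀ᶠ N in atTop, a N < 0)) ∧
  (∃ N₀ : ℕ, MonotoneOn (fun N : ℕ => |a N| * N) (Set.Ici N₀)) ∧
  Tendsto (fun N : ℕ => |a N| * N) atTop atTop

/-- The `R_ℓ`-property of a finite family of real sequences. The family indexed by `j ≠ j₀` is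
indexed here by `j = j₀.succAbove m`. -/
def RProp : (l : ℕ) → (Fin l → ℕ → ℝ) → Prop
  | 0, _ => True
  | 1, a => ROne (a 0)
  | l + 2, a => ∀ i : Fin (l + 2), ROne (a i) ∧
      ((∃ j₀, j₀ ≠ i ∧
          RProp (l + 1) fun m N => (a j₀ N - a (j₀.succAbove m) N) / a i N) ∨
       (∃ j₀, j₀ ≠ i ∧ ROne (fun N => a i N - a j₀ N) ∧
          RProp (l + 1) fun m N => a (j₀.succAbove m) N / (a i N - a j₀ N)) ∨
       (∃ j₀, j₀ ≠ i ∧ ROne (fun N => a i N - a j₀ N) ∧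
          ∃ k₀, k₀ ≠ j₀ ∧ k₀ ≠ i ∧
            RProp (l + 1) fun m N =>
              (if j₀.succAbove m = k₀ then -a k₀ N else a (j₀.succAbove m) N - a k₀ N) /
                (a i N - a j₀ N)))

/-! ### Super nice tuples -/

/-- The family `P` is turned into families of degree one whose leading coefficients have the
`R_k`-property (`k` being the number of members of the final family) by finitely many van der
Corput operations, performed as in PET induction: as long as some member has degree at least two,
one subtracts a member `p` of minimum degree (such an operation always lowers the type of the
family), with a large parameter `h`. This is required for every run of the procedure, that is,
for every choice of the members of minimum degree and all large parameters; at each step before the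
last the family has to be essentially distinct with degrees independent of `N`. -/
inductive ReducesToR : List PolySeq → Prop
  | linear (P : List PolySeq) (hlin : ∀ p ∈ P, IsLinearSeq p)
      (hR : RProp P.length fun i N => (P.get i N).leadingCoeff) : ReducesToR P
  | step (P : List PolySeq) (hP : EssentiallyDistinct P)
      (hdeg : ∃ q ∈ P, ∀ᶠ N in atTop, 2 ≤ (q N).natDegree)
      (H : PolySeq → ℕ)
      (hstep : ∀ p ∈ P, HasMinDegree P p → ∀ h : ℕ, H p ≤ h → ReducesToR (vdC P p h)) :
      ReducesToR P

/-- The tuple `p_j - p_{i₀}` for `j ≠ i₀`, with `-p_{i₀}` in place `i₀`. -/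
def primed {l : ℕ} (p : Fin l → PolySeq) (i₀ : Fin l) : Fin l → PolySeq :=
  fun j => if j = i₀ then -p i₀ else p j - p i₀

/-- Super nice `ℓ`-tuples of variable polynomials. -/
structure SuperNice {l : ℕ} (p : Fin l → PolySeq) : Prop where
  bounded : ∃ C : ℝ, ∀ᶠ N in atTop, ∀ i j, |(p i N).coeff j| ≤ C
  nonconst : EssentiallyDistinct (List.ofFn p)
  reduces : ReducesToR (List.ofFn p)
  reduces_primed : ∀ i₀, (∀ j, ∀ᶠ N in atTop, (p j N).natDegree ≤ (p i₀ N).natDegree) →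
    ReducesToR (List.ofFn (primed p i₀))

/-! ### Host-Kra seminorms and nilfactors -/

section Ergodic

variable {X : Type*} [MeasurableSpace X]

/-- `hkPow μ T k f` is the `2 ^ (k + 1)`-th power of the seminorm `|||f|||_{k + 1}`:
`|||f|||_1 ^ 2 = ‖E(f | I(T))‖_2 ^ 2`, and `|||f|||_{k + 1} ^ (2 ^ (k + 1))` is the limit of the
averages of `|||conj f * T^n f|||_k ^ (2 ^ k)`. The limit exists for `f` in `L^∞`, hence it is
the upper limit. -/
def hkPow (μ : Measure X) (T : X → X) : ℕ → (X → ℂ) → ℝ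
  | 0, f => ∫ x, ‖(μ[f | MeasurableSpace.invariants T]) x‖ ^ 2 ∂μ
  | k + 1, f => limsup (fun N : ℕ => (N : ℝ)⁻¹ * ∑ n ∈ Finset.Icc 1 N,
      hkPow μ T k (fun x => (starRingEnd ℂ) (f x) * f (T^[n] x))) atTop

/-- `hkSeminorm μ T k f` is the seminorm `|||f|||_{k + 1}`. -/
def hkSeminorm (μ : Measure X) (T : X → X) (k : ℕ) (f : X → ℂ) : ℝ :=
  hkPow μ T k f ^ ((1 : ℝ) / 2 ^ (k + 1))

/-- The factor `Z_k`, as a σ-algebra (containing the null sets). Since `Z_k` is characterized by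
`E(f | Z_k) = 0 ↔ |||f|||_{k + 1} = 0` for `f` in `L^∞`, its members are the measurable sets over
which every `f` in `L^∞` with `|||f|||_{k + 1} = 0` has integral zero. -/
@[reducible]
def stepNilfactor (μ : Measure X) (T : X → X) (k : ℕ) : MeasurableSpace X :=
  MeasurableSpace.generateFrom {A | MeasurableSet A ∧
    ∀ f : X → ℂ, MemLp f ∞ μ → hkSeminorm μ T k f = 0 → ∫ x in A, f x ∂μ = 0}

/-- The nilfactor `Z`, the join of all `Z_k`, `k ≥ 1`. -/
@[reducible]
def nilfactor (μ : Measure X) (T : X → X) : MeasurableSpace X :=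
  ⨆ k : ℕ, stepNilfactor μ T (k + 1)

/-- The nilfactor is a sub-σ-algebra. -/
theorem nilfactor_le (μ : Measure X) (T : X → X) : nilfactor μ T ≤ ‹MeasurableSpace X› :=
  iSup_le fun _ => MeasurableSpace.generateFrom_le fun _ hA => hA.1

/-- The multiple average `N⁻¹ ∑_{n = 1}^N ∏_i T^{a_{i,N}(n)} f_i`, where `T^m f = f ∘ T^m`. -/
def multAvg (T : X ≃ᵐ X) {l : ℕ} (a : Fin l → ℕ → ℕ → ℤ) (f : Fin l → X → ℂ) (N : ℕ) (x : X) : ℂ :=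
  (N : ℂ)⁻¹ * ∑ n ∈ Finset.Icc 1 N, ∏ i, f i ((T.toEquiv ^ a i N n : Equiv.Perm X) x)

end Ergodic

/-- The sub-σ-algebra `𝒴` is a characteristic factor for the variable tuple `a` of integer-valued
sequences: it is `T`-invariant, and replacing every `f_i` by `E(f_i | 𝒴)` does not change the
limiting behaviour in `L^2` of the multiple averages. -/
def IsCharacteristicFactor {X : Type*} (𝒴 : MeasurableSpace X) [m : MeasurableSpace X]
    (μ : Measure X) (T : X ≃ᵐ X) {l : ℕ} (a : Fin l → ℕ → ℕ → ℤ) : Prop :=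
  𝒴 ≤ m ∧
  (∀ A : Set X, MeasurableSet[𝒴] (T ⁻¹' A) ↔ MeasurableSet[𝒴] A) ∧
  ∀ f : Fin l → X → ℂ, (∀ i, MemLp (f i) ∞ μ) →
    Tendsto (fun N => eLpNorm (fun x => multAvg T a f N x -
      multAvg T a (fun i => μ[f i | 𝒴]) N x) 2 μ) atTop (nhds 0)

end VarPoly

end

/-!
Let `f` be one of the functions, say in place `i`, with vanishing conditional expectation on the
nilfactor. The square of the `L²` norm of a multiple average is the average over `n ≤ N` of the
correlations `∫ f ∏ g_j ∘ T ^ ⌊u_j(n)⌋`, where the `u_j` are `-p_i` and the `p_j - p_i`, and where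
the multiple average itself has become one of the `g_j` (`norm_sq_multAvg_le`). So it suffices that
`f` *controls* these polynomials (`Ctl`): such correlations tend to zero in absolute value on
average, uniformly in the bounded functions `g_j`, which may depend on `N`. Keeping `f` in the place
that does not move is what allows one to treat all `i` alike, and makes the `R`-property of the final
families directly usable.

* *Reduction to degree one.* Van der Corput's lemma replaces the polynomials `-p` and `q - p` by
  `p - p(· + h)`, `q(· + h) - p(· + h)` and `q - p(· + h)` (`Ctl.of_vdc`). Up to constants, these are
  the differences of the members of the family `vdC P r h` with its member `p(· + h) - r`, for any
  choice of `r`. With `r` of minimum degree and such that `p(· + h) - r` is of maximal degree, this is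
  an induction along the reduction procedure (`ReducesToR.ctl`), which ends with a family whose slopes
  `a` are bounded and satisfy `|a N| * N → ∞`, by the `R₁`-property. If `p_i` is not of maximal
  degree, the induction starts from the differences with a polynomial of maximal degree
  (`SuperNice.ctl`).

* *Degree one.* For slopes `a_1, …, a_s` the Cauchy–Schwarz inequality, applied `s` times, bounds the
  correlations by the averages of `|∫ Δ_{m_1} ⋯ Δ_{m_s} f|` over the boxes `|m_i| ≤ |a_i| N + 2`,
  where `Δ_m f = f · conj (f ∘ T ^ m)`, with a constant depending only on `s` and the bound for the
  slopes (`avg_corr_pow_le`). The sides of these boxes tend to infinity.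

* *Boxes and the nilfactor.* After one more application of Cauchy–Schwarz the box averages are
  averages of `∫ f · c_h`, where `c_h` is a product of functions `F_ω ∘ T ^ (ω · h)` over the nonzero
  vertices `ω` of a cube (`boxAvg_sq_le`). Let `φ` be a weak limit of averages of the `c_h` over
  boxes. It is measurable with respect to the nilfactor (`measurable_of_isCubeLimit`), hence
  orthogonal to `f`. For the measurability, let `g` have vanishing Host–Kra seminorm. By the
  definition of the seminorms there are finite means such that the averages of `∫ g · c_h` are small
  uniformly in all products `c_h` of this form (`exists_finMean_of_hkSeminorm_eq_zero`). This remains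
  true for `g φ` in place of `g`: expand `φ` and translate its averages by `h`; the product of two
  cubes is again one cube (`CubeDom.mul_limit`). So `g` is orthogonal to all polynomials in `φ` and
  its conjugate, and has integral zero over the level sets of the real and imaginary parts of `φ`,
  which is the condition that defines the σ-algebra of the nilfactor.

The nilfactor is invariant since the seminorms are, and the functions may be replaced by their
conditional expectations one at a time.
-/

noncomputable section

namespace VarPoly

open Topology

/-! ### Powers of the transformation and bounded functions -/

section Basics

variable {X : Type*} [MeasurableSpace X]

/-- The point `T ^ n x`, for an integer `n`. -/
def tp (T : X ≃ᵐ X) (n : ℤ) (x : X) : X := (T.toEquiv ^ n : Equiv.Perm X) x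

lemma tp_add (T : X ≃ᵐ X) (m n : ℤ) (x : X) : tp T (m + n) x = tp T m (tp T n x) := by
  simp [tp, zpow_add, Equiv.Perm.mul_apply]

@[simp] lemma tp_zero (T : X ≃ᵐ X) (x : X) : tp T 0 x = x := by simp [tp]

@[simp] lemma tp_one (T : X ≃ᵐ X) (x : X) : tp T 1 x = T x := by simp [tp]

lemma tp_neg_one (T : X ≃ᵐ X) (x : X) : tp T (-1) x = T.symm x := by
  simp [tp]

lemma tp_natCast (T : X ≃ᵐ X) (n : ℕ) (x : X) : tp T n x = T^[n] x := by
  induction n generalizing x with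
  | zero => simp
  | succ n ih => rw [Nat.cast_succ, tp_add, tp_one, ih, Function.iterate_succ_apply]

lemma measurable_tp (T : X ≃ᵐ X) (n : ℤ) : Measurable (tp T n) := by
  induction n using Int.induction_on with
  | zero =>
    have : tp T 0 = id := by ext x; simp
    rw [this]; exact measurable_id
  | succ n ih =>
    have : tp T (n + 1) = tp T n ∘ T := by ext x; simp [tp_add]
    rw [this]; exact ih.comp T.measurable
  | pred n ih =>
    have : tp T (-n - 1) = tp T (-n) ∘ T.symm := by ext x; simp [sub_eq_add_neg, tp_add, tp_neg_one]
    rw [this]; exact ih.comp T.symm.measurable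

/-- The measurable automorphism `T ^ n`. -/
def tpEquiv (T : X ≃ᵐ X) (n : ℤ) : X ≃ᵐ X where
  toFun := tp T n
  invFun := tp T (-n)
  left_inv x := by simp [← tp_add]
  right_inv x := by simp [← tp_add]
  measurable_toFun := measurable_tp T n
  measurable_invFun := measurable_tp T (-n)

variable {μ : Measure X} {T : X ≃ᵐ X}

lemma measurePreserving_tp (hT : MeasurePreserving T μ μ) (n : ℤ) :
    MeasurePreserving (tp T n) μ μ := by
  induction n using Int.induction_on with
  | zero =>
    have : tp T 0 = id := by ext x; simp
    rw [this]; exact MeasurePreserving.id μ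
  | succ n ih =>
    have : tp T (n + 1) = tp T n ∘ T := by ext x; simp [tp_add]
    rw [this]; exact ih.comp hT
  | pred n ih =>
    have : tp T (-n - 1) = tp T (-n) ∘ T.symm := by ext x; simp [sub_eq_add_neg, tp_add, tp_neg_one]
    rw [this]; exact ih.comp (hT.symm T)

lemma integral_tp {E : Type*} [NormedAddCommGroup E] [NormedSpace ℝ E]
    (hT : MeasurePreserving T μ μ) (n : ℤ) (f : X → E) :
    ∫ x, f (tp T n x) ∂μ = ∫ x, f x ∂μ :=
  (measurePreserving_tp hT n).integral_comp (tpEquiv T n).measurableEmbedding f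

/-- `f` is a (class of a) measurable function bounded by `B` almost everywhere. -/
def Bdd (μ : Measure X) (B : ℝ) (f : X → ℂ) : Prop :=
  AEStronglyMeasurable f μ ∧ ∀ᵐ x ∂μ, ‖f x‖ ≤ B

namespace Bdd

variable {B C : ℝ} {f g : X → ℂ}

lemma mono (hf : Bdd μ B f) (h : B ≤ C) : Bdd μ C f :=
  ⟨hf.1, hf.2.mono fun _ hx => hx.trans h⟩

lemma mul (hf : Bdd μ B f) (hg : Bdd μ C g) : Bdd μ (B * C) fun x => f x * g x := by
  refine ⟨hf.1.mul hg.1, ?_⟩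
  filter_upwards [hf.2, hg.2] with x h1 h2
  rw [norm_mul]
  exact mul_le_mul h1 h2 (norm_nonneg _) ((norm_nonneg _).trans h1)

lemma mul_one (hf : Bdd μ 1 f) (hg : Bdd μ 1 g) : Bdd μ 1 fun x => f x * g x := by
  simpa using hf.mul hg

lemma conj (hf : Bdd μ B f) : Bdd μ B fun x => (starRingEnd ℂ) (f x) :=
  ⟨Complex.continuous_conj.comp_aestronglyMeasurable hf.1, by simpa using hf.2⟩

lemma comp_tp (hT : MeasurePreserving T μ μ) (hf : Bdd μ B f) (n : ℤ) :
    Bdd μ B fun x => f (tp T n x) :=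
  ⟨hf.1.comp_measurePreserving (measurePreserving_tp hT n),
    (measurePreserving_tp hT n).quasiMeasurePreserving.ae hf.2⟩

lemma const {c : ℂ} (hc : ‖c‖ ≤ B) : Bdd μ B fun _ : X => c :=
  ⟨aestronglyMeasurable_const, Eventually.of_forall fun _ => hc⟩

lemma one : Bdd μ 1 fun _ : X => (1 : ℂ) := const (by simp)

lemma prod {ι : Type*} {s : Finset ι} {f : ι → X → ℂ} (hf : ∀ i ∈ s, Bdd μ 1 (f i)) :
    Bdd μ 1 fun x => ∏ i ∈ s, f i x := by
  classical
  induction s using Finset.induction_on with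
  | empty => simpa using one
  | insert a s ha ih =>
    simp only [Finset.prod_insert ha]
    exact (hf a (by simp)).mul_one (ih fun i hi => hf i (by simp [hi]))

lemma sum {ι : Type*} {s : Finset ι} {f : ι → X → ℂ} {b : ι → ℝ}
    (hf : ∀ i ∈ s, Bdd μ (b i) (f i)) : Bdd μ (∑ i ∈ s, b i) fun x => ∑ i ∈ s, f i x := by
  classical
  induction s using Finset.induction_on with
  | empty => simpa using const (μ := μ) (X := X) (c := 0) (B := 0) (by simp)
  | insert a s ha ih =>
    simp only [Finset.sum_insert ha]
    have h1 := hf a (by simp)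
    have h2 := ih fun i hi => hf i (by simp [hi])
    refine ⟨h1.1.add h2.1, ?_⟩
    filter_upwards [h1.2, h2.2] with x hx hy
    exact (norm_add_le _ _).trans (add_le_add hx hy)

lemma const_mul (hf : Bdd μ B f) (c : ℂ) : Bdd μ (‖c‖ * B) fun x => c * f x :=
  (const (μ := μ) (X := X) (c := c) le_rfl).mul hf

lemma memLp [IsFiniteMeasure μ] (hf : Bdd μ B f) (p : ℝ≥0∞) : MemLp f p μ :=
  MemLp.of_bound hf.1 B hf.2

lemma integrable [IsFiniteMeasure μ] (hf : Bdd μ B f) : Integrable f μ :=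
  memLp_one_iff_integrable.1 (hf.memLp 1)

lemma norm_integral_le [IsProbabilityMeasure μ] (hf : Bdd μ B f) : ‖∫ x, f x ∂μ‖ ≤ B := by
  simpa using norm_integral_le_of_norm_le_const hf.2

lemma nonneg [IsProbabilityMeasure μ] (hf : Bdd μ B f) : 0 ≤ B :=
  (norm_nonneg _).trans hf.norm_integral_le

end Bdd

lemma exists_bdd_of_memLp_top {f : X → ℂ} (hf : MemLp f ∞ μ) : ∃ B : ℝ, 1 ≤ B ∧ Bdd μ B f := by
  refine ⟨max 1 (eLpNormEssSup f μ).toReal, le_max_left _ _, hf.1, ?_⟩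
  filter_upwards [ae_le_eLpNormEssSup (f := f) (μ := μ)] with x hx
  refine le_max_of_le_right ?_
  have h := hf.2
  rw [eLpNorm_exponent_top] at h
  have := ENNReal.toReal_mono h.ne hx
  simpa using this

end Basics

/-! ### Correlations with a bounded function and Cauchy–Schwarz -/

section Hilbert

/-- Cauchy–Schwarz after moving the phases of the inner products into the sum. The absolute values
inside the sum on the left cost absolute values on the right. -/
lemma sum_norm_inner_sq_le {E : Type*} [NormedAddCommGroup E] [InnerProductSpace ℂ E]
    {ι : Type*} (s : Finset ι) (g : E) (v : ι → E) :
    (∑ i ∈ s, ‖inner ℂ g (v i)‖) ^ 2 ≤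
      ‖g‖ ^ 2 * ∑ i ∈ s, ∑ j ∈ s, ‖inner ℂ (v i) (v j)‖ := by
  choose c hc1 hc2 using fun i => RCLike.exists_norm_eq_mul_self (inner ℂ g (v i))
  set w := ∑ i ∈ s, c i • v i with hw
  have h1 : ((∑ i ∈ s, ‖inner ℂ g (v i)‖ : ℝ) : ℂ) = inner ℂ g w := by
    rw [hw, inner_sum, Complex.ofReal_sum]
    refine Finset.sum_congr rfl fun i _ => ?_
    rw [inner_smul_right]
    exact hc2 i
  have h2 : ∑ i ∈ s, ‖inner ℂ g (v i)‖ ≤ ‖g‖ * ‖w‖ := by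
    have h0 : 0 ≤ ∑ i ∈ s, ‖inner ℂ g (v i)‖ := Finset.sum_nonneg fun _ _ => norm_nonneg _
    calc _ = ‖((∑ i ∈ s, ‖inner ℂ g (v i)‖ : ℝ) : ℂ)‖ := by
            rw [Complex.norm_real, Real.norm_of_nonneg h0]
      _ ≤ _ := by rw [h1]; exact norm_inner_le_norm g w
  have h3 : ‖w‖ ^ 2 ≤ ∑ i ∈ s, ∑ j ∈ s, ‖inner ℂ (v i) (v j)‖ := by
    have : ‖w‖ ^ 2 = ‖inner ℂ w w‖ := by
      rw [inner_self_eq_norm_sq_to_K]; simp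
    rw [this, hw, sum_inner]
    refine (norm_sum_le _ _).trans (Finset.sum_le_sum fun i _ => ?_)
    rw [inner_sum]
    refine (norm_sum_le _ _).trans (Finset.sum_le_sum fun j _ => ?_)
    rw [inner_smul_left, inner_smul_right, norm_mul, norm_mul, RCLike.norm_conj, hc1, hc1]
    simp
  calc _ ≤ (‖g‖ * ‖w‖) ^ 2 :=
        pow_le_pow_left₀ (Finset.sum_nonneg fun _ _ => norm_nonneg _) h2 2
    _ = ‖g‖ ^ 2 * ‖w‖ ^ 2 := by ring
    _ ≤ _ := by gcongr

variable {X : Type*} [MeasurableSpace X] {μ : Measure X}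

lemma inner_toLp {f g : X → ℂ} (hf : MemLp f 2 μ) (hg : MemLp g 2 μ) :
    inner ℂ (hf.toLp f) (hg.toLp g) = ∫ x, (starRingEnd ℂ) (f x) * g x ∂μ := by
  rw [L2.inner_def]
  refine integral_congr_ae ?_
  filter_upwards [hf.coeFn_toLp, hg.coeFn_toLp] with x h1 h2
  rw [h1, h2, RCLike.inner_apply, mul_comm]

variable [IsProbabilityMeasure μ]

lemma sum_norm_integral_sq_le {ι : Type*} (s : Finset ι) {g : X → ℂ} {V : ι → X → ℂ}
    (hg : Bdd μ 1 g) {B : ι → ℝ} (hV : ∀ i, Bdd μ (B i) (V i)) :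
    (∑ i ∈ s, ‖∫ x, g x * V i x ∂μ‖) ^ 2 ≤
      ∑ i ∈ s, ∑ j ∈ s, ‖∫ x, V i x * (starRingEnd ℂ) (V j x) ∂μ‖ := by
  have hg2 := hg.conj.memLp 2
  have key := sum_norm_inner_sq_le s (hg2.toLp _) (fun i => ((hV i).memLp 2).toLp (V i))
  simp only [inner_toLp, Complex.conj_conj] at key
  refine key.trans ?_
  have h1 : ‖hg2.toLp _‖ ≤ 1 := by
    rw [Lp.norm_toLp]
    refine ENNReal.toReal_le_of_le_ofReal zero_le_one ?_
    refine (eLpNorm_le_of_ae_bound hg.conj.2).trans ?_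
    simp
  have h2 : ∀ i j, ‖∫ x, (starRingEnd ℂ) (V i x) * V j x ∂μ‖ =
      ‖∫ x, V i x * (starRingEnd ℂ) (V j x) ∂μ‖ := by
    intro i j
    rw [← RCLike.norm_conj, ← integral_conj]
    simp
  simp only [h2]
  refine mul_le_of_le_one_left ?_ (pow_le_one₀ (norm_nonneg _) h1)
  exact Finset.sum_nonneg fun _ _ => Finset.sum_nonneg fun _ _ => norm_nonneg _

end Hilbert

/-! ### The van der Corput inequality -/

lemma sum_Icc_add_le {y : ℕ → ℝ} (h0 : ∀ n, 0 ≤ y n) (h1 : ∀ n, y n ≤ 1) (N c : ℕ) :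
    ∑ n ∈ Finset.Icc 1 N, y (n + c) ≤ ∑ n ∈ Finset.Icc 1 N, y n + c := by
  induction c with
  | zero => simp
  | succ c ih =>
    have h : ∑ n ∈ Finset.Icc 1 N, y (n + (c + 1)) + y (1 + c) =
        ∑ n ∈ Finset.Icc 1 N, y (n + c) + y (N + 1 + c) := by
      clear ih
      induction N with
      | zero => simp
      | succ N ih =>
        rw [Finset.sum_Icc_succ_top (by omega), Finset.sum_Icc_succ_top (by omega)]
        have : N + 1 + (c + 1) = N + 1 + 1 + c := by ring
        rw [this]; linarith
    push_cast
    linarith [h0 (1 + c), h1 (N + 1 + c)]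

lemma sum_Icc_le_add {y : ℕ → ℝ} (h0 : ∀ n, 0 ≤ y n) (h1 : ∀ n, y n ≤ 1) (N c : ℕ) :
    ∑ n ∈ Finset.Icc 1 N, y n ≤ ∑ n ∈ Finset.Icc 1 N, y (n + c) + c := by
  induction c with
  | zero => simp
  | succ c ih =>
    have h : ∑ n ∈ Finset.Icc 1 N, y (n + (c + 1)) + y (1 + c) =
        ∑ n ∈ Finset.Icc 1 N, y (n + c) + y (N + 1 + c) := by
      clear ih
      induction N with
      | zero => simp
      | succ N ih =>
        rw [Finset.sum_Icc_succ_top (by omega), Finset.sum_Icc_succ_top (by omega)]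
        have : N + 1 + (c + 1) = N + 1 + 1 + c := by ring
        rw [this]; linarith
    push_cast
    linarith [h0 (N + 1 + c), h1 (1 + c)]

/-- The numerical content of van der Corput's inequality. The shifts `j D`, `j < H`, with a large
common factor `D` are used, so that only large differences occur. -/
lemma tendsto_avg_of_correlations {x : ℕ → ℕ → ℝ} {z : ℕ → ℕ → ℕ → ℝ}
    (hx0 : ∀ N n, 0 ≤ x N n) (hx1 : ∀ N n, x N n ≤ 1)
    (hz0 : ∀ N n m, 0 ≤ z N n m) (hz1 : ∀ N n m, z N n m ≤ 1)
    (hzs : ∀ N n m, z N n m = z N m n)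
    (hxz : ∀ N n D H, (∑ j ∈ Finset.range H, x N (n + j * D)) ^ 2 ≤
      ∑ i ∈ Finset.range H, ∑ j ∈ Finset.range H, z N (n + i * D) (n + j * D))
    (hz : ∀ᶠ h : ℕ in atTop, Tendsto
      (fun N : ℕ => (N : ℝ)⁻¹ * ∑ n ∈ Finset.Icc 1 N, z N (n + h) n) atTop (𝓝 0)) :
    Tendsto (fun N : ℕ => (N : ℝ)⁻¹ * ∑ n ∈ Finset.Icc 1 N, x N n) atTop (𝓝 0) := by
  obtain ⟨h₀, hh₀⟩ := eventually_atTop.1 hz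
  set D := h₀ + 1 with hD
  set A : ℕ → ℝ := fun N => (N : ℝ)⁻¹ * ∑ n ∈ Finset.Icc 1 N, x N n with hA
  have hA0 : ∀ N, 0 ≤ A N := fun N =>
    mul_nonneg (by positivity) (Finset.sum_nonneg fun n _ => hx0 N n)
  set Z : ℕ → ℕ → ℝ := fun h N => (N : ℝ)⁻¹ * ∑ n ∈ Finset.Icc 1 N, z N (n + h) n with hZ
  -- the main estimate for a fixed number `H` of shifts
  have main : ∀ H : ℕ, 1 ≤ H → ∀ N : ℕ, 1 ≤ N → (A N) ^ 2 ≤ 2 * (1 / H) +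
      (2 * ((1 / (H : ℝ) ^ 2) * ∑ i ∈ Finset.range H, ∑ j ∈ Finset.range H,
        (if i = j then 0 else Z ((max i j - min i j) * D) N + H * D * (N : ℝ)⁻¹)) +
        2 * (H * D * (N : ℝ)⁻¹) ^ 2) := by
    intro H hH N hN
    have hH' : (0 : ℝ) < H := by exact_mod_cast hH
    have hN' : (0 : ℝ) < N := by exact_mod_cast hN
    set P : ℝ := (N : ℝ)⁻¹ * ∑ n ∈ Finset.Icc 1 N,
      (H : ℝ)⁻¹ * ∑ j ∈ Finset.range H, x N (n + j * D) with hP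
    have e1 : A N ≤ P + H * D * (N : ℝ)⁻¹ := by
      have : ∀ j ∈ Finset.range H, ∑ n ∈ Finset.Icc 1 N, x N n ≤
          ∑ n ∈ Finset.Icc 1 N, x N (n + j * D) + H * D := by
        intro j hj
        refine (sum_Icc_le_add (hx0 N) (hx1 N) N (j * D)).trans ?_
        have : ((j * D : ℕ) : ℝ) ≤ H * D := by
          exact_mod_cast Nat.mul_le_mul_right D (Finset.mem_range.1 hj).le
        linarith
      have h2 := Finset.sum_le_sum this
      rw [Finset.sum_const, Finset.card_range, nsmul_eq_mul, Finset.sum_add_distrib,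
        Finset.sum_const, Finset.card_range, nsmul_eq_mul, Finset.sum_comm] at h2
      have h3 : P = (N : ℝ)⁻¹ * ((H : ℝ)⁻¹ *
          ∑ n ∈ Finset.Icc 1 N, ∑ j ∈ Finset.range H, x N (n + j * D)) := by
        rw [hP, ← Finset.mul_sum]
      rw [h3, hA]
      have h4 : ∑ n ∈ Finset.Icc 1 N, x N n ≤ (H : ℝ)⁻¹ *
          ∑ n ∈ Finset.Icc 1 N, ∑ j ∈ Finset.range H, x N (n + j * D) + H * D := by
        have := mul_le_mul_of_nonneg_left h2 (inv_nonneg.2 hH'.le)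
        rw [mul_add, ← mul_assoc, ← mul_assoc, inv_mul_cancel₀ hH'.ne', one_mul, one_mul] at this
        exact this
      have := mul_le_mul_of_nonneg_left h4 (inv_nonneg.2 hN'.le)
      linarith
    have hP0 : 0 ≤ P := mul_nonneg (by positivity) (Finset.sum_nonneg fun n _ =>
      mul_nonneg (by positivity) (Finset.sum_nonneg fun j _ => hx0 _ _))
    have e2 : P ^ 2 ≤ (N : ℝ)⁻¹ * ∑ n ∈ Finset.Icc 1 N, (1 / (H : ℝ) ^ 2) *
        ∑ i ∈ Finset.range H, ∑ j ∈ Finset.range H, z N (n + i * D) (n + j * D) := by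
      have h1 := sq_sum_le_card_mul_sum_sq (s := Finset.Icc 1 N)
        (f := fun n => (H : ℝ)⁻¹ * ∑ j ∈ Finset.range H, x N (n + j * D))
      rw [Nat.card_Icc, Nat.add_sub_cancel] at h1
      rw [hP, mul_pow]
      have h2 : ∀ n ∈ Finset.Icc 1 N, ((H : ℝ)⁻¹ * ∑ j ∈ Finset.range H, x N (n + j * D)) ^ 2 ≤
          (1 / (H : ℝ) ^ 2) *
            ∑ i ∈ Finset.range H, ∑ j ∈ Finset.range H, z N (n + i * D) (n + j * D) := by
        intro n _
        rw [mul_pow, inv_pow, one_div]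
        exact mul_le_mul_of_nonneg_left (hxz N n D H) (by positivity)
      calc _ ≤ ((N : ℝ)⁻¹) ^ 2 * (N * ∑ n ∈ Finset.Icc 1 N, (1 / (H : ℝ) ^ 2) *
            ∑ i ∈ Finset.range H, ∑ j ∈ Finset.range H, z N (n + i * D) (n + j * D)) := by
            refine mul_le_mul_of_nonneg_left (h1.trans ?_) (by positivity)
            exact mul_le_mul_of_nonneg_left (Finset.sum_le_sum h2) hN'.le
        _ = _ := by field_simp
    have e3 : (N : ℝ)⁻¹ * ∑ n ∈ Finset.Icc 1 N, (1 / (H : ℝ) ^ 2) *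
        ∑ i ∈ Finset.range H, ∑ j ∈ Finset.range H, z N (n + i * D) (n + j * D) =
        (1 / (H : ℝ) ^ 2) * ∑ i ∈ Finset.range H, ∑ j ∈ Finset.range H,
          (N : ℝ)⁻¹ * ∑ n ∈ Finset.Icc 1 N, z N (n + i * D) (n + j * D) := by
      simp only [Finset.mul_sum]
      rw [Finset.sum_comm]
      refine Finset.sum_congr rfl fun i _ => ?_
      rw [Finset.sum_comm]
      refine Finset.sum_congr rfl fun j _ => Finset.sum_congr rfl fun n _ => ?_
      ring
    have e4 : ∀ i ∈ Finset.range H, ∀ j ∈ Finset.range H,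
        (N : ℝ)⁻¹ * ∑ n ∈ Finset.Icc 1 N, z N (n + i * D) (n + j * D) ≤
        (if i = j then 1 else 0) +
          (if i = j then 0 else Z ((max i j - min i j) * D) N + H * D * (N : ℝ)⁻¹) := by
      intro i hi j hj
      rw [Finset.mem_range] at hi hj
      by_cases hij : i = j
      · simp only [hij, if_true, add_zero]
        have : ∑ n ∈ Finset.Icc 1 N, z N (n + j * D) (n + j * D) ≤ N := by
          refine (Finset.sum_le_sum fun n _ => hz1 _ _ _).trans ?_
          simp
        calc _ ≤ (N : ℝ)⁻¹ * N := mul_le_mul_of_nonneg_left this (by positivity)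
          _ = 1 := inv_mul_cancel₀ hN'.ne'
      · simp only [hij, if_false, zero_add]
        have hsym : ∀ n, z N (n + i * D) (n + j * D) =
            z N ((n + min i j * D) + (max i j - min i j) * D) (n + min i j * D) := by
          intro n
          have h1 : min i j * D + (max i j - min i j) * D = max i j * D := by
            rw [← Nat.add_mul]; congr 1; omega
          rw [add_assoc, h1]
          rcases le_total i j with h | h
          · rw [min_eq_left h, max_eq_right h, hzs]
          · rw [min_eq_right h, max_eq_left h]
        simp only [hsym]
        have := sum_Icc_add_le (y := fun n => z N (n + (max i j - min i j) * D) n)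
          (fun n => hz0 _ _ _) (fun n => hz1 _ _ _) N (min i j * D)
        have h5 : ((min i j * D : ℕ) : ℝ) ≤ H * D := by
          have : min i j * D ≤ H * D := Nat.mul_le_mul_right D (by omega)
          exact_mod_cast this
        have h6 := mul_le_mul_of_nonneg_left (this.trans (add_le_add le_rfl h5))
          (inv_nonneg.2 hN'.le)
        rw [hZ]
        dsimp only at h6 ⊢
        linarith
    have e5 : P ^ 2 ≤ 1 / H + (1 / (H : ℝ) ^ 2) * ∑ i ∈ Finset.range H, ∑ j ∈ Finset.range H,
        (if i = j then 0 else Z ((max i j - min i j) * D) N + H * D * (N : ℝ)⁻¹) := by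
      refine e2.trans ?_
      rw [e3]
      refine (mul_le_mul_of_nonneg_left (Finset.sum_le_sum fun i hi =>
        Finset.sum_le_sum fun j hj => e4 i hi j hj) (by positivity)).trans ?_
      simp only [Finset.sum_add_distrib, mul_add]
      refine add_le_add ?_ le_rfl
      have : ∑ i ∈ Finset.range H, ∑ j ∈ Finset.range H, (if i = j then (1 : ℝ) else 0) = H := by
        rw [Finset.sum_congr rfl (g := fun _ => (1 : ℝ))]
        · simp
        · intro i hi; simp [Finset.mem_range.1 hi]
      rw [this]
      field_simp
      exact le_rfl
    have e6 : A N ^ 2 ≤ (P + H * D * (N : ℝ)⁻¹) ^ 2 := pow_le_pow_left₀ (hA0 N) e1 2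
    nlinarith [sq_nonneg (P - H * D * (N : ℝ)⁻¹)]
  have hinv : Tendsto (fun N : ℕ => (N : ℝ)⁻¹) atTop (𝓝 0) := tendsto_inv_atTop_nhds_zero_nat
  have hsq : Tendsto (fun N => A N ^ 2) atTop (𝓝 0) := by
    rw [Metric.tendsto_atTop']
    intro ε hε
    obtain ⟨H, hH⟩ := exists_nat_gt (4 / ε)
    have hHpos : (0 : ℝ) < H := lt_trans (by positivity) hH
    have hH1 : 1 ≤ H := by exact_mod_cast hHpos
    have hlim : Tendsto (fun N : ℕ => 2 * (1 / (H : ℝ)) +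
      (2 * ((1 / (H : ℝ) ^ 2) * ∑ i ∈ Finset.range H, ∑ j ∈ Finset.range H,
        (if i = j then 0 else Z ((max i j - min i j) * D) N + H * D * (N : ℝ)⁻¹)) +
        2 * (H * D * (N : ℝ)⁻¹) ^ 2)) atTop
        (𝓝 (2 * (1 / (H : ℝ)) + (2 * ((1 / (H : ℝ) ^ 2) * ∑ i ∈ Finset.range H,
          ∑ j ∈ Finset.range H, (0 : ℝ)) + 2 * (H * D * 0) ^ 2))) := by
      refine tendsto_const_nhds.add (((tendsto_finsetSum _ fun i _ =>
        tendsto_finsetSum _ fun j _ => ?_).const_mul _ |>.const_mul _).add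
          (((hinv.const_mul _).pow 2).const_mul _))
      by_cases hij : i = j
      · simp [hij]
      · simp only [hij, if_false]
        have h1 : h₀ ≤ (max i j - min i j) * D := by
          have : 1 ≤ max i j - min i j := by omega
          calc h₀ ≤ 1 * D := by omega
            _ ≤ _ := Nat.mul_le_mul_right D this
        simpa using (hh₀ _ h1).add (hinv.const_mul ((H : ℝ) * D))
    simp only [Finset.sum_const_zero, mul_zero, add_zero, ne_eq, OfNat.ofNat_ne_zero,
      not_false_eq_true, zero_pow] at hlim
    have hlt : 2 * (1 / (H : ℝ)) < ε := by
      rw [div_lt_iff₀ hε] at hH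
      rw [mul_one_div, div_lt_iff₀ hHpos]
      nlinarith
    obtain ⟨N₀, hN₀⟩ := eventually_atTop.1 (hlim.eventually_lt_const hlt)
    refine ⟨N₀ + 1, fun N hN => ?_⟩
    rw [Real.dist_eq, sub_zero, abs_of_nonneg (sq_nonneg _)]
    exact (main H hH1 N (by omega)).trans_lt (hN₀ N (by omega))
  have := (Real.continuous_sqrt.tendsto 0).comp hsq
  simpa [Function.comp_def, Real.sqrt_sq (hA0 _)] using this

/-- Van der Corput's lemma, with absolute values inside the averages: if the correlations
of `V N (n + h)` and `V N n` are small on average for every large `h`, then so are the correlations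
of `V N n` with bounded functions that do not depend on `n`. -/
lemma tendsto_avg_norm_integral {X : Type*} [MeasurableSpace X] {μ : Measure X}
    [IsProbabilityMeasure μ] {V : ℕ → ℕ → X → ℂ} (hV : ∀ N n, Bdd μ 1 (V N n))
    {g : ℕ → X → ℂ} (hg : ∀ N, Bdd μ 1 (g N))
    (h : ∀ᶠ h : ℕ in atTop, Tendsto (fun N : ℕ => (N : ℝ)⁻¹ * ∑ n ∈ Finset.Icc 1 N,
      ‖∫ x, V N (n + h) x * (starRingEnd ℂ) (V N n x) ∂μ‖) atTop (𝓝 0)) :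
    Tendsto (fun N : ℕ => (N : ℝ)⁻¹ * ∑ n ∈ Finset.Icc 1 N, ‖∫ x, g N x * V N n x ∂μ‖)
      atTop (𝓝 0) := by
  refine tendsto_avg_of_correlations
    (z := fun N n m => ‖∫ x, V N n x * (starRingEnd ℂ) (V N m x) ∂μ‖)
    (fun _ _ => norm_nonneg _) (fun N n => ((hg N).mul_one (hV N n)).norm_integral_le)
    (fun _ _ _ => norm_nonneg _) (fun N n m => ((hV N n).mul_one (hV N m).conj).norm_integral_le)
    (fun N n m => ?_) (fun N n D H => ?_) h
  · rw [← RCLike.norm_conj, ← integral_conj]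
    simp [mul_comm]
  · exact sum_norm_integral_sq_le (Finset.range H) (hg N) (V := fun j => V N (n + j * D))
      (fun j => hV N _)

/-! ### Correlation averages and their behaviour under van der Corput operations -/

section Corr

variable {X : Type*} [MeasurableSpace X] (μ : Measure X) (T : X ≃ᵐ X)

/-- The correlation `∫ f ∏ T^{d_i} g_i`. -/
def corr {ι : Type} [Fintype ι] (f : X → ℂ) (g : ι → X → ℂ) (d : ι → ℤ) : ℂ :=
  ∫ x, f x * ∏ i, g i (tp T (d i) x) ∂μ

/-- The averages over `n ≤ N` of the absolute values of the correlations of `f` along `d N n` tend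
to zero, for all bounded functions `g N i` in the other places. -/
def CorrToZero {ι : Type} [Fintype ι] (f : X → ℂ) (d : ℕ → ℕ → ι → ℤ) : Prop :=
  ∀ g : ℕ → ι → X → ℂ, (∀ N i, Bdd μ 1 (g N i)) →
    Tendsto (fun N : ℕ => (N : ℝ)⁻¹ * ∑ n ∈ Finset.Icc 1 N, ‖corr μ T f (g N) (d N n)‖)
      atTop (𝓝 0)

/-- The function `f` controls the set `U` of variable polynomials: the correlations of `f` along
the integer parts of any finite family in `U` tend to zero on average. In the applications the
members of `U` are the differences of the given polynomials with the one that `f` belongs to. -/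
def Ctl (f : X → ℂ) (U : Set PolySeq) : Prop :=
  ∀ (ι : Type) [Fintype ι] (u : ι → PolySeq), (∀ i, u i ∈ U) →
    CorrToZero μ T f fun N n i => ⌊(u i N).eval (n : ℝ)⌋

variable {μ T}

lemma corr_comp_tp {ι : Type} [Fintype ι] (f : X → ℂ) (g : ι → X → ℂ) (a d : ι → ℤ) :
    corr μ T f (fun i x => g i (tp T (a i) x)) d = corr μ T f g fun i => a i + d i := by
  simp only [corr, tp_add]

lemma integral_shift_eq_corr (hT : MeasurePreserving T μ μ) {ι : Type} [Fintype ι] (f : X → ℂ)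
    (g : ι → X → ℂ) (d : ι → ℤ) (k : ℤ) :
    ∫ x, f (tp T k x) * ∏ i, g i (tp T (d i) x) ∂μ = corr μ T f g fun i => d i - k := by
  rw [corr, ← integral_tp hT k fun x => f x * ∏ i, g i (tp T (d i - k) x)]
  simp only [← tp_add, sub_add_cancel]

/-- Errors in a fixed finite range, and shifts independent of `n`, are harmless. -/
lemma CorrToZero.of_close (hT : MeasurePreserving T μ μ) {ι : Type} [Fintype ι] {f : X → ℂ}
    {d d' : ℕ → ℕ → ι → ℤ} (h : CorrToZero μ T f d') (c : ℕ → ι → ℤ) (K : ℤ)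
    (hd : ∀ᶠ N in atTop, ∀ n ∈ Finset.Icc 1 N, ∀ i, |d N n i - d' N n i - c N i| ≤ K) :
    CorrToZero μ T f d := by
  classical
  intro g hg
  obtain ⟨E, hE⟩ : ∃ E : Finset (ι → ℤ), ∀ e : ι → ℤ, (∀ i, |e i| ≤ K) → e ∈ E := by
    refine ⟨Fintype.piFinset fun _ : ι => Finset.Icc (-K) K, fun e he => ?_⟩
    rw [Fintype.mem_piFinset]
    intro i
    rw [Finset.mem_Icc, ← abs_le]
    exact he i
  set F : (ι → ℤ) → ℕ → ℕ → ℝ := fun e N n =>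
    ‖corr μ T f (fun i x => g N i (tp T (c N i + e i) x)) (d' N n)‖ with hF
  have hlim : Tendsto (fun N : ℕ => ∑ e ∈ E, (N : ℝ)⁻¹ * ∑ n ∈ Finset.Icc 1 N, F e N n)
      atTop (𝓝 (∑ _e ∈ E, 0)) :=
    tendsto_finsetSum E fun e _ => h (fun N i x => g N i (tp T (c N i + e i) x))
      fun N i => (hg N i).comp_tp hT _
  rw [Finset.sum_const_zero] at hlim
  refine squeeze_zero' (Eventually.of_forall fun N => mul_nonneg (by positivity)
    (Finset.sum_nonneg fun _ _ => norm_nonneg _)) ?_ hlim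
  filter_upwards [hd] with N hN
  rw [← Finset.mul_sum, Finset.sum_comm]
  refine mul_le_mul_of_nonneg_left (Finset.sum_le_sum fun n hn => ?_) (by positivity)
  have h1 : ‖corr μ T f (g N) (d N n)‖ = F (fun i => d N n i - d' N n i - c N i) N n := by
    simp only [hF]
    rw [corr_comp_tp]
    congr 2
    ext i
    ring
  rw [h1]
  exact Finset.single_le_sum (f := fun e => F e N n) (fun e _ => norm_nonneg _) (hE _ (hN n hn))

/-- The subtraction of zero gives the statement the shape of the hypothesis of
`CorrToZero.of_close`. -/
lemma abs_floor_sub_le (x y : ℝ) : |(⌊x⌋ - ⌊y⌋) - ⌊x - y⌋ - 0| ≤ 1 := by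
  have h1 := Int.floor_le x
  have h2 := Int.lt_floor_add_one x
  have h3 := Int.floor_le y
  have h4 := Int.lt_floor_add_one y
  have h5 := Int.floor_le (x - y)
  have h6 := Int.lt_floor_add_one (x - y)
  rw [abs_le]
  constructor
  · have : (⌊x - y⌋ : ℝ) < ((⌊x⌋ - ⌊y⌋ + 1 : ℤ) : ℝ) := by push_cast; linarith
    have := Int.cast_lt.1 this
    omega
  · have : ((⌊x⌋ - ⌊y⌋ : ℤ) : ℝ) < ((⌊x - y⌋ + 2 : ℤ) : ℝ) := by push_cast; linarith
    have := Int.cast_lt.1 this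
    omega

lemma Ctl.mono {f : X → ℂ} {U V : Set PolySeq} (h : Ctl μ T f V) (hUV : U ⊆ V) :
    Ctl μ T f U := fun ι _ u hu => h ι u fun i => hUV (hu i)

lemma natDegree_zero_eval {p q : ℝ[X]} (h : (p - q).natDegree = 0) (t : ℝ) :
    p.eval t = q.eval t + (p - q).coeff 0 := by
  have h1 := Polynomial.eq_C_of_natDegree_eq_zero h
  have h2 : (p - q).eval t = (p - q).coeff 0 := by
    conv_lhs => rw [h1]
    simp
  rw [← h2]; simp

/-- Polynomials may be replaced by others that differ from them by constants. -/
lemma Ctl.of_const (hT : MeasurePreserving T μ μ) {f : X → ℂ} {U V : Set PolySeq}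
    (h : Ctl μ T f V) (hUV : ∀ u ∈ U, ∃ v ∈ V, IsConstSeq (u - v)) : Ctl μ T f U := by
  intro ι _ u hu
  choose v hv huv using fun i => hUV (u i) (hu i)
  refine (h ι v hv).of_close hT (fun N i => ⌊((u i - v i) N).coeff 0⌋) 1 ?_
  filter_upwards [eventually_all.2 huv] with N hN n _ i
  have h1 := natDegree_zero_eval (hN i) (n : ℝ)
  rw [h1]
  have := abs_floor_sub_le ((v i N).eval (n : ℝ) + ((u i - v i) N).coeff 0)
    (((u i - v i) N).coeff 0)
  rw [add_sub_cancel_right, sub_zero] at this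
  have h2 : ∀ a b c : ℤ, a - b - c = a - c - b := fun a b c => by ring
  rw [h2]
  exact this

/-- The sequence of polynomials `p N (t + h)`. -/
def shift (p : PolySeq) (h : ℕ) : PolySeq := fun N => (p N).comp (Polynomial.X + C (h : ℝ))

lemma shift_eval (p : PolySeq) (h N n : ℕ) :
    (shift p h N).eval (n : ℝ) = (p N).eval ((n + h : ℕ) : ℝ) := by
  simp [shift]

/-- The differences of `p` with zero and with the members of `S`. -/
def diffSet (p : PolySeq) (S : Set PolySeq) : Set PolySeq :=
  {u | u = -p ∨ ∃ q ∈ S, u = q - p}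

/-- The differences of `p (t + h)` with `p` and with `q (t + h)` and `q t`, for `q` in `S`. -/
def vdcSet (p : PolySeq) (S : Set PolySeq) (h : ℕ) : Set PolySeq :=
  {u | u = p - shift p h ∨ ∃ q ∈ S, u = shift q h - shift p h ∨ u = q - shift p h}

/-- The van der Corput operation for correlation averages: the function that does not move with
`n` is eliminated, and the polynomials are replaced by their shifts by `h` and themselves. -/
lemma Ctl.of_vdc [IsProbabilityMeasure μ] (hT : MeasurePreserving T μ μ) {f : X → ℂ}
    (hf : Bdd μ 1 f) {p : PolySeq} {S : Set PolySeq}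
    (h : ∀ᶠ h : ℕ in atTop, Ctl μ T f (vdcSet p S h)) : Ctl μ T f (diffSet p S) := by
  classical
  intro ι _ u hu
  set J : ι → Prop := fun i => ∃ q ∈ S, u i = q - p with hJ
  have hnJ : ∀ i, ¬ J i → u i = -p := fun i hi => (hu i).resolve_right hi
  set q : ι → PolySeq := fun i => if h : J i then h.choose else p with hq
  have hqS : ∀ i, J i → q i ∈ S ∧ u i = q i - p := by
    intro i hi
    simp only [hq, dif_pos hi]
    exact hi.choose_spec
  -- separate the functions that do not depend on `n`
  set a : ℕ → ℕ → ι → ℤ := fun N n i => if J i then ⌊(q i N).eval (n : ℝ)⌋ else 0 with ha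
  refine CorrToZero.of_close hT (d' := fun N n i => a N n i - ⌊(p N).eval (n : ℝ)⌋) ?_
    (fun _ _ => 0) 1 (Eventually.of_forall fun N n _ i => ?_)
  swap
  · by_cases hi : J i
    · simp only [ha, if_pos hi, (hqS i hi).2]
      have := abs_floor_sub_le ((q i N).eval (n : ℝ)) ((p N).eval (n : ℝ))
      rw [sub_zero, abs_sub_comm] at this
      simpa using this
    · simp only [ha, if_neg hi, hnJ i hi]
      have := abs_floor_sub_le 0 ((p N).eval (n : ℝ))
      rw [sub_zero, abs_sub_comm] at this
      simpa using this
  intro g hg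
  set V : ℕ → ℕ → X → ℂ := fun N n x => f (tp T ⌊(p N).eval (n : ℝ)⌋ x) *
    ∏ i, if J i then g N i (tp T ⌊(q i N).eval (n : ℝ)⌋ x) else 1 with hV
  have hVb : ∀ N n, Bdd μ 1 (V N n) := by
    intro N n
    refine (hf.comp_tp hT _).mul_one (Bdd.prod fun i _ => ?_)
    by_cases hi : J i
    · simpa only [if_pos hi] using (hg N i).comp_tp hT _
    · simpa only [if_neg hi] using Bdd.one
  have hsplit : ∀ N n, corr μ T f (g N) (fun i => a N n i - ⌊(p N).eval (n : ℝ)⌋) =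
      ∫ x, (∏ i, if J i then 1 else g N i x) * V N n x ∂μ := by
    intro N n
    rw [← integral_shift_eq_corr hT]
    refine integral_congr_ae (Eventually.of_forall fun x => ?_)
    simp only [hV]
    rw [mul_left_comm, ← Finset.prod_mul_distrib]
    congr 1
    refine Finset.prod_congr rfl fun i _ => ?_
    by_cases hi : J i
    · simp only [ha, if_pos hi, one_mul]
    · simp only [ha, if_neg hi, mul_one, tp_zero]
  simp only [hsplit]
  refine tendsto_avg_norm_integral hVb (g := fun N x => ∏ i, if J i then 1 else g N i x)
    (fun N => Bdd.prod fun i _ => ?_) ?_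
  · by_cases hi : J i
    · simpa only [if_pos hi] using Bdd.one
    · simpa only [if_neg hi] using hg N i
  filter_upwards [h] with k hk
  set Q : Option (ι ⊕ ι) → PolySeq := fun o => match o with
    | none => p
    | some (Sum.inl i) => if J i then shift (q i) k else p
    | some (Sum.inr i) => if J i then q i else p with hQ
  set G : ℕ → Option (ι ⊕ ι) → X → ℂ := fun N o => match o with
    | none => fun x => (starRingEnd ℂ) (f x)
    | some (Sum.inl i) => if J i then g N i else fun _ => 1
    | some (Sum.inr i) => if J i then fun x => (starRingEnd ℂ) (g N i x) else fun _ => 1 with hG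
  have hQU : ∀ o, Q o - shift p k ∈ vdcSet p S k := by
    rintro (_ | i | i)
    · exact Or.inl rfl
    · by_cases hi : J i
      · exact Or.inr ⟨q i, (hqS i hi).1, Or.inl (by simp only [hQ, if_pos hi])⟩
      · exact Or.inl (by simp only [hQ, if_neg hi])
    · by_cases hi : J i
      · exact Or.inr ⟨q i, (hqS i hi).1, Or.inr (by simp only [hQ, if_pos hi])⟩
      · exact Or.inl (by simp only [hQ, if_neg hi])
  have hGb : ∀ N o, Bdd μ 1 (G N o) := by
    rintro N (_ | i | i)
    · exact hf.conj
    · by_cases hi : J i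
      · simpa only [hG, if_pos hi] using hg N i
      · simpa only [hG, if_neg hi] using Bdd.one
    · by_cases hi : J i
      · simpa only [hG, if_pos hi] using (hg N i).conj
      · simpa only [hG, if_neg hi] using Bdd.one
  have key := (hk _ _ hQU).of_close hT
    (d := fun N n o => ⌊(Q o N).eval (n : ℝ)⌋ - ⌊(shift p k N).eval (n : ℝ)⌋)
    (fun _ _ => 0) 1 (Eventually.of_forall fun N n _ o => by
      simpa using abs_floor_sub_le ((Q o N).eval (n : ℝ)) ((shift p k N).eval (n : ℝ))) G hGb
  refine key.congr fun N => ?_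
  congr 1
  refine Finset.sum_congr rfl fun n _ => ?_
  rw [← integral_shift_eq_corr hT]
  congr 2
  ext x
  rw [Fintype.prod_option, Fintype.prod_sum_type, shift_eval]
  simp only [hV, map_mul, map_prod]
  have e1 : ∀ i, G N (some (Sum.inl i)) (tp T ⌊(Q (some (Sum.inl i)) N).eval (n : ℝ)⌋ x) =
      if J i then g N i (tp T ⌊(q i N).eval ((n + k : ℕ) : ℝ)⌋ x) else 1 := by
    intro i
    by_cases hi : J i
    · simp only [hG, hQ, if_pos hi, shift_eval]
    · simp only [hG, if_neg hi]
  have e2 : ∀ i, G N (some (Sum.inr i)) (tp T ⌊(Q (some (Sum.inr i)) N).eval (n : ℝ)⌋ x) =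
      (starRingEnd ℂ) (if J i then g N i (tp T ⌊(q i N).eval (n : ℝ)⌋ x) else 1) := by
    intro i
    by_cases hi : J i
    · simp only [hG, hQ, if_pos hi]
    · simp only [hG, if_neg hi, map_one]
  simp only [e1, e2]
  simp only [hG, hQ]
  ring

end Corr

/-! ### Finite means on groups of integer vectors -/

/-- A finitely supported probability measure on `G`, as the uniform distribution on a finite
labelled family of points (labels allow multiplicities). -/
structure FinMean (G : Type) where
  /-- the labels -/
  ι : Type
  [fintype : Fintype ι]
  [nonempty : Nonempty ι]
  /-- the labelled points -/
  pt : ι → G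

namespace FinMean

attribute [instance] FinMean.fintype FinMean.nonempty

variable {G V : Type*} [AddCommGroup V] [Module ℝ V]

/-- The average of `u` with respect to the finite mean `ν`. -/
def E {G : Type} (ν : FinMean G) (u : G → V) : V :=
  (Fintype.card ν.ι : ℝ)⁻¹ • ∑ i, u (ν.pt i)

variable {G : Type} (ν : FinMean G)

lemma card_pos : (0 : ℝ) < Fintype.card ν.ι := by exact_mod_cast Fintype.card_pos

lemma E_add (u v : G → V) : ν.E (fun h => u h + v h) = ν.E u + ν.E v := by
  simp [E, Finset.sum_add_distrib]

lemma E_sub (u v : G → V) : ν.E (fun h => u h - v h) = ν.E u - ν.E v := by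
  simp [E, Finset.sum_sub_distrib, smul_sub]

lemma E_const (c : V) : ν.E (fun _ => c) = c := by
  simp only [E, Finset.sum_const, Finset.card_univ]
  rw [← Nat.cast_smul_eq_nsmul ℝ, smul_smul, inv_mul_cancel₀ ν.card_pos.ne', one_smul]

lemma E_mono {u v : G → ℝ} (h : ∀ x, u x ≤ v x) : ν.E u ≤ ν.E v := by
  simp only [E, smul_eq_mul]
  exact mul_le_mul_of_nonneg_left (Finset.sum_le_sum fun i _ => h _) (by positivity)

lemma E_nonneg {u : G → ℝ} (h : ∀ x, 0 ≤ u x) : 0 ≤ ν.E u := by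
  simpa [E_const] using ν.E_mono (u := fun _ => 0) h

lemma E_mul_left (c : ℂ) (u : G → ℂ) : ν.E (fun h => c * u h) = c * ν.E u := by
  simp only [E, ← Finset.mul_sum, mul_smul_comm]

lemma norm_E_le_E_norm (u : G → ℂ) : ‖ν.E u‖ ≤ ν.E fun h => ‖u h‖ := by
  simp only [E, norm_smul, smul_eq_mul]
  rw [Real.norm_of_nonneg (by positivity)]
  exact mul_le_mul_of_nonneg_left (norm_sum_le _ _) (by positivity)

lemma norm_E_le {u : G → ℂ} {B : ℝ} (h : ∀ x, ‖u x‖ ≤ B) : ‖ν.E u‖ ≤ B :=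
  (ν.norm_E_le_E_norm u).trans ((ν.E_mono h).trans (ν.E_const B).le)

lemma E_re (u : G → ℂ) : (ν.E u).re = ν.E fun h => (u h).re := by
  simp [E]

lemma E_pow_le {u : G → ℝ} (h : ∀ x, 0 ≤ u x) (n : ℕ) : ν.E u ^ n ≤ ν.E fun x => u x ^ n := by
  have := Real.pow_arith_mean_le_arith_mean_pow (Finset.univ : Finset ν.ι)
    (fun _ => (Fintype.card ν.ι : ℝ)⁻¹) (fun i => u (ν.pt i)) (fun _ _ => by positivity)
    (by simp [ν.card_pos.ne']) (fun i _ => h _) n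
  simpa only [E, smul_eq_mul, Finset.mul_sum] using this

lemma E_comm {H : Type} (ν' : FinMean H) (u : G → H → V) :
    ν.E (fun g => ν'.E fun h => u g h) = ν'.E fun h => ν.E fun g => u g h := by
  simp only [E, Finset.smul_sum]
  rw [Finset.sum_comm]
  refine Finset.sum_congr rfl fun i _ => Finset.sum_congr rfl fun j _ => ?_
  rw [smul_comm]

/-- The product of a mean on `ℤ` and a mean on `ℤ ^ k`. -/
def cons {k : ℕ} (ν₁ : FinMean ℤ) (ν : FinMean (Fin k → ℤ)) : FinMean (Fin (k + 1) → ℤ) where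
  ι := ν₁.ι × ν.ι
  pt i := Fin.cons (ν₁.pt i.1) (ν.pt i.2)

lemma E_cons {k : ℕ} (ν₁ : FinMean ℤ) (ν : FinMean (Fin k → ℤ)) (u : (Fin (k + 1) → ℤ) → V) :
    (cons ν₁ ν).E u = ν₁.E fun m => ν.E fun h => u (Fin.cons m h) := by
  have : Fintype.card (cons ν₁ ν).ι = Fintype.card ν₁.ι * Fintype.card ν.ι :=
    Fintype.card_prod ν₁.ι ν.ι
  simp only [E, this]
  have h2 : ∑ i : (cons ν₁ ν).ι, u ((cons ν₁ ν).pt i) =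
      ∑ i : ν₁.ι × ν.ι, u (Fin.cons (ν₁.pt i.1) (ν.pt i.2)) := rfl
  rw [h2, Fintype.sum_prod_type, Nat.cast_mul, mul_inv, ← Finset.smul_sum, smul_smul]

/-- The point mass at `c`. -/
def dirac (c : G) : FinMean G where
  ι := Unit
  pt _ := c

/-- The uniform mean on `{0, …, K}`. -/
def initial (K : ℕ) : FinMean ℤ where
  ι := Fin (K + 1)
  pt i := i

lemma E_initial (K : ℕ) (u : ℤ → V) :
    (initial K).E u = ((K : ℝ) + 1)⁻¹ • ∑ i ∈ Finset.range (K + 1), u i := by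
  have : Fintype.card (initial K).ι = K + 1 := Fintype.card_fin _
  simp only [E, this]
  rw [Finset.sum_range]
  push_cast
  rfl

/-- The uniform mean on `{-M, …, M}`. -/
def interval (M : ℕ) : FinMean ℤ where
  ι := Fin (2 * M + 1)
  pt i := i - M

lemma E_interval' (M : ℕ) (u : ℤ → V) :
    (interval M).E u = (initial (2 * M)).E fun m => u (m - M) := rfl

lemma E_interval (M : ℕ) (u : ℤ → V) :
    (interval M).E u = (2 * (M : ℝ) + 1)⁻¹ • ∑ m ∈ Finset.Icc (-(M : ℤ)) M, u m := by
  rw [E_interval', E_initial]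
  congr 1
  · push_cast; rfl
  · refine Finset.sum_nbij' (fun i => (i : ℤ) - M) (fun m => (m + M).toNat) ?_ ?_ ?_ ?_ ?_
    · intro i hi; simp at hi ⊢; omega
    · intro i hi; simp at hi ⊢; omega
    · intro i hi; simp
    · intro i hi; simp at hi ⊢; omega
    · intro i hi; rfl

/-- The distribution of the difference of two independent uniform elements of `{0, …, N}`. -/
def fejer (N : ℕ) : FinMean ℤ where
  ι := Fin (N + 1) × Fin (N + 1)
  pt i := (i.1 : ℤ) - i.2

lemma E_fejer (N : ℕ) (u : ℤ → V) :
    (fejer N).E u = (initial N).E fun j => (initial N).E fun i => u (i - j) := by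
  have : Fintype.card (fejer N).ι = (N + 1) * (N + 1) := by
    change Fintype.card (Fin (N + 1) × Fin (N + 1)) = _
    simp
  have h1 : Fintype.card (initial N).ι = N + 1 := Fintype.card_fin _
  simp only [E, this, h1]
  have h2 : ∑ i : (fejer N).ι, u ((fejer N).pt i) =
      ∑ i : Fin (N + 1) × Fin (N + 1), u ((i.1 : ℤ) - i.2) := rfl
  rw [h2, Fintype.sum_prod_type_right, Nat.cast_mul, mul_inv, ← Finset.smul_sum, smul_smul]
  rfl

end FinMean

/-- The means `ν n` are asymptotically invariant under translations. -/
def AsympInv {G : Type} [AddCommGroup G] (ν : ℕ → FinMean G) : Prop :=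
  ∀ e : G, ∃ δ : ℕ → ℝ, Tendsto δ atTop (𝓝 0) ∧ ∀ n, ∀ u : G → ℂ, (∀ h, ‖u h‖ ≤ 1) →
    ‖(ν n).E (fun h => u (h + e)) - (ν n).E u‖ ≤ δ n

namespace AsympInv

open FinMean

lemma of_one {ν : ℕ → FinMean ℤ} {δ : ℕ → ℝ} (hδ : Tendsto δ atTop (𝓝 0))
    (h : ∀ n, ∀ u : ℤ → ℂ, (∀ h, ‖u h‖ ≤ 1) →
      ‖(ν n).E (fun h => u (h + 1)) - (ν n).E u‖ ≤ δ n) : AsympInv ν := by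
  intro e
  induction e using Int.induction_on with
  | zero => exact ⟨fun _ => 0, tendsto_const_nhds, fun n u _ => by simp⟩
  | succ k ih =>
    obtain ⟨δ', h1, h2⟩ := ih
    refine ⟨fun n => δ' n + δ n, by simpa using h1.add hδ, fun n u hu => ?_⟩
    have e1 := h2 n (fun m => u (m + 1)) fun m => hu _
    have e2 := h n u hu
    have : ∀ m : ℤ, m + (k + 1) = m + k + 1 := fun m => by ring
    simp only [this]
    exact (norm_sub_le_norm_sub_add_norm_sub _ _ _).trans (add_le_add e1 e2)
  | pred k ih =>
    obtain ⟨δ', h1, h2⟩ := ih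
    refine ⟨fun n => δ n + δ' n, by simpa using hδ.add h1, fun n u hu => ?_⟩
    have e1 := h n (fun m => u (m + (-k - 1))) fun m => hu _
    have e2 := h2 n u hu
    have : ∀ m : ℤ, m + 1 + (-k - 1) = m + -k := fun m => by ring
    simp only [this] at e1
    rw [norm_sub_rev] at e1
    exact (norm_sub_le_norm_sub_add_norm_sub _ _ _).trans (add_le_add e1 e2)

lemma norm_E_initial_sub_le (K : ℕ) (u : ℤ → ℂ) (hu : ∀ h, ‖u h‖ ≤ 1) :
    ‖(initial K).E (fun h => u (h + 1)) - (initial K).E u‖ ≤ 2 * ((K : ℝ) + 1)⁻¹ := by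
  rw [E_initial, E_initial, ← smul_sub, ← Finset.sum_sub_distrib]
  have := Finset.sum_range_sub (fun i : ℕ => u i) (K + 1)
  push_cast at this
  rw [this, norm_smul, Real.norm_of_nonneg (by positivity), mul_comm]
  refine mul_le_mul_of_nonneg_right ?_ (by positivity)
  exact (norm_sub_le _ _).trans (by linarith [hu (K + 1), hu 0])

lemma tendsto_two_mul_inv {K : ℕ → ℕ} (hK : Tendsto K atTop atTop) :
    Tendsto (fun n => 2 * ((K n : ℝ) + 1)⁻¹) atTop (𝓝 0) := by
  have : Tendsto (fun n => (K n : ℝ) + 1) atTop atTop :=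
    tendsto_atTop_add_const_right _ _ (tendsto_natCast_atTop_atTop.comp hK)
  simpa using (tendsto_inv_atTop_zero.comp this).const_mul 2

lemma interval {M : ℕ → ℕ} (hM : Tendsto M atTop atTop) :
    AsympInv fun n => FinMean.interval (M n) := by
  have h2 : Tendsto (fun n => 2 * M n) atTop atTop :=
    tendsto_atTop_mono (fun n => by omega) hM
  refine of_one (tendsto_two_mul_inv h2) fun n u hu => ?_
  rw [E_interval', E_interval']
  have := norm_E_initial_sub_le (2 * M n) (fun m => u (m - M n)) fun m => hu _
  convert this using 6
  ring

lemma fejer {M : ℕ → ℕ} (hM : Tendsto M atTop atTop) :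
    AsympInv fun n => FinMean.fejer (M n) := by
  refine of_one (tendsto_two_mul_inv hM) fun n u hu => ?_
  rw [E_fejer, E_fejer, ← E_sub]
  refine norm_E_le _ fun j => ?_
  have := norm_E_initial_sub_le (M n) (fun m => u (m - j)) fun m => hu _
  convert this using 6
  ring

lemma cons {k : ℕ} {ν₁ : ℕ → FinMean ℤ} {ν : ℕ → FinMean (Fin k → ℤ)} (h₁ : AsympInv ν₁)
    (h : AsympInv ν) : AsympInv fun n => FinMean.cons (ν₁ n) (ν n) := by
  intro e
  obtain ⟨δ₁, t₁, b₁⟩ := h₁ (e 0)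
  obtain ⟨δ, t, b⟩ := h fun i => e i.succ
  refine ⟨fun n => δ₁ n + δ n, by simpa using t₁.add t, fun n u hu => ?_⟩
  rw [E_cons, E_cons]
  have hadd : ∀ (m : ℤ) (h : Fin k → ℤ), (Fin.cons m h : Fin (k + 1) → ℤ) + e =
      Fin.cons (m + e 0) (h + fun i => e i.succ) := by
    intro m h
    ext i
    refine Fin.cases ?_ (fun i => ?_) i <;> simp
  simp only [hadd]
  have e1 := b₁ n (fun m => (ν n).E fun h => u (Fin.cons m (h + fun i => e i.succ)))
    fun m => norm_E_le _ fun h => hu _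
  have e2 : ‖(ν₁ n).E (fun m => (ν n).E fun h => u (Fin.cons m (h + fun i => e i.succ))) -
      (ν₁ n).E (fun m => (ν n).E fun h => u (Fin.cons m h))‖ ≤ δ n := by
    rw [← E_sub]
    exact norm_E_le _ fun m => b n (fun h => u (Fin.cons m h)) fun h => hu _
  exact (norm_sub_le_norm_sub_add_norm_sub _ _ _).trans (add_le_add e1 e2)

lemma dirac_zero : AsympInv fun _ => FinMean.dirac (0 : Fin 0 → ℤ) := by
  intro e
  refine ⟨fun _ => 0, tendsto_const_nhds, fun n u _ => ?_⟩
  have : ∀ h : Fin 0 → ℤ, h + e = h := fun h => Subsingleton.elim _ _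
  simp [this]

end AsympInv

/-! ### Multiplicative derivatives and their averages over boxes -/

section Box

variable {X : Type*} [MeasurableSpace X] (μ : Measure X) (T : X ≃ᵐ X)

/-- The multiplicative derivative `F · conj (T ^ m F)`. -/
def mulDiff (m : ℤ) (F : X → ℂ) (x : X) : ℂ := F x * (starRingEnd ℂ) (F (tp T m x))

/-- The iterated multiplicative derivative in the directions `h 0, …, h (k - 1)`. -/
def mulDiffs : (k : ℕ) → (Fin k → ℤ) → (X → ℂ) → X → ℂ
  | 0, _, F => F
  | k + 1, h, F => mulDiffs k (fun i => h i.succ) (mulDiff T (h 0) F)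

/-- The average over the box `∏ [-M i, M i]` of the absolute values of the integrals of the
iterated multiplicative derivatives of `F`. -/
def boxAvg : (s : ℕ) → (Fin s → ℕ) → (X → ℂ) → ℝ
  | 0, _, F => ‖∫ x, F x ∂μ‖
  | s + 1, M, F => (FinMean.interval (M 0)).E fun m =>
      boxAvg s (fun i => M i.succ) (mulDiff T m F)

variable {μ T}

lemma boxAvg_nonneg {s : ℕ} (M : Fin s → ℕ) (F : X → ℂ) : 0 ≤ boxAvg μ T s M F := by
  induction s generalizing F with
  | zero => exact norm_nonneg _
  | succ s ih => exact FinMean.E_nonneg _ fun m => ih _ _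

lemma Bdd.mulDiff (hT : MeasurePreserving T μ μ) {F : X → ℂ} (hF : Bdd μ 1 F) (m : ℤ) :
    Bdd μ 1 (mulDiff T m F) := hF.mul_one (hF.comp_tp hT m).conj

end Box

/-! ### Change of variables for the integer parts of multiples -/

lemma card_le_of_abs_sub_lt (S : Finset ℤ) {L : ℝ} (hL : 0 ≤ L)
    (h : ∀ x ∈ S, ∀ y ∈ S, ((x : ℝ) - y) ≤ L) : (S.card : ℝ) ≤ L + 1 := by
  rcases S.eq_empty_or_nonempty with rfl | hS
  · simp; linarith
  · have h1 : S ⊆ Finset.Icc (S.min' hS) (S.max' hS) := fun x hx =>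
      Finset.mem_Icc.2 ⟨S.min'_le x hx, S.le_max' x hx⟩
    have h2 := Finset.card_le_card h1
    rw [Int.card_Icc] at h2
    have h3 := h _ (S.max'_mem hS) _ (S.min'_mem hS)
    have h4 : (S.min' hS) ≤ S.max' hS := S.min'_le_max' hS
    have h5 : (S.card : ℤ) ≤ S.max' hS + 1 - S.min' hS := by omega
    have h6 : (S.card : ℝ) ≤ S.max' hS + 1 - S.min' hS := by exact_mod_cast h5
    linarith

/-- The values `-⌊a h⌋ - e`, for `|h| ≤ N`, are integers of size at most `|a| N + 2`, and each
is taken at most `1 / |a| + 1` times. -/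
lemma sum_floor_le {φ : ℤ → ℝ} (hφ : ∀ m, 0 ≤ φ m) {a : ℝ} (ha : a ≠ 0) (N M : ℕ)
    (hM : |a| * N + 2 ≤ M) {e : ℤ} (he0 : -1 ≤ e) (he1 : e ≤ 1) :
    ∑ h ∈ Finset.Icc (-(N : ℤ)) N, φ (-⌊a * h⌋ - e) ≤
      (1 / |a| + 1) * ∑ m ∈ Finset.Icc (-(M : ℤ)) M, φ m := by
  have hmaps : ∀ h ∈ Finset.Icc (-(N : ℤ)) N, -⌊a * h⌋ - e ∈ Finset.Icc (-(M : ℤ)) M := by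
    intro h hh
    rw [Finset.mem_Icc] at hh ⊢
    have h1 : |(h : ℝ)| ≤ N := by
      rw [abs_le]; exact ⟨by exact_mod_cast hh.1, by exact_mod_cast hh.2⟩
    have h2 : |a * h| ≤ |a| * N := by
      rw [abs_mul]; exact mul_le_mul_of_nonneg_left h1 (abs_nonneg _)
    rw [abs_le] at h2
    have h3 := Int.floor_le (a * h)
    have h4 := Int.lt_floor_add_one (a * h)
    have he0' : (-1 : ℝ) ≤ e := by exact_mod_cast he0
    have he1' : (e : ℝ) ≤ 1 := by exact_mod_cast he1
    constructor
    · have : ((-(M : ℤ) : ℤ) : ℝ) ≤ ((-⌊a * h⌋ - e : ℤ) : ℝ) := by push_cast; linarith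
      exact_mod_cast this
    · have : ((-⌊a * h⌋ - e : ℤ) : ℝ) ≤ ((M : ℤ) : ℝ) := by push_cast; linarith
      exact_mod_cast this
  rw [← Finset.sum_fiberwise_of_maps_to hmaps, Finset.mul_sum]
  refine Finset.sum_le_sum fun m _ => ?_
  have h1 : ∀ h ∈ (Finset.Icc (-(N : ℤ)) N).filter (fun h : ℤ => -⌊a * h⌋ - e = m),
      φ (-⌊a * h⌋ - e) = φ m := fun h hh => by rw [(Finset.mem_filter.1 hh).2]
  rw [Finset.sum_congr rfl h1, Finset.sum_const, nsmul_eq_mul]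
  refine mul_le_mul_of_nonneg_right (card_le_of_abs_sub_lt _ (by positivity) ?_) (hφ m)
  intro x hx y hy
  have hx' := (Finset.mem_filter.1 hx).2
  have hy' := (Finset.mem_filter.1 hy).2
  have hxy : ⌊a * x⌋ = ⌊a * y⌋ := by omega
  have h2 := Int.abs_sub_lt_one_of_floor_eq_floor hxy
  rw [← mul_sub, abs_mul] at h2
  have h3 : |(x : ℝ) - y| ≤ 1 / |a| := by
    rw [le_div_iff₀ (abs_pos.2 ha), mul_comm]; exact h2.le
  exact (le_abs_self _).trans h3

/-! ### Correlations along sequences of degree one -/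

section Linear

variable {X : Type*} [MeasurableSpace X] {μ : Measure X} {T : X ≃ᵐ X} [IsProbabilityMeasure μ]

lemma sum_Icc_sub_le {φ : ℤ → ℝ} (hφ : ∀ m, 0 ≤ φ m) (N : ℕ) {n' : ℕ}
    (hn' : n' ∈ Finset.Icc 1 N) :
    ∑ n ∈ Finset.Icc 1 N, φ ((n : ℤ) - n') ≤ ∑ h ∈ Finset.Icc (-(N : ℤ)) N, φ h := by
  have hinj : Set.InjOn (fun n : ℕ => (n : ℤ) - n') (Finset.Icc 1 N : Finset ℕ) := by
    intro x _ y _ h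
    simpa using h
  rw [← Finset.sum_image (f := φ) hinj]
  refine Finset.sum_le_sum_of_subset_of_nonneg ?_ fun _ _ _ => hφ _
  intro h hh
  obtain ⟨n, hn, rfl⟩ := Finset.mem_image.1 hh
  rw [Finset.mem_Icc] at hn hn' ⊢
  omega

/-- The errors of size at most one in the coordinates of an integer vector. -/
def errorVectors (s : ℕ) : Finset (Fin s → ℤ) := Fintype.piFinset fun _ => Finset.Icc (-1) 1

/-- One Cauchy–Schwarz step for sequences of degree one: the function `g 0` is eliminated and `F`
is replaced by its multiplicative derivatives in directions close to multiples of `a 0`. -/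
lemma sum_corr_sq_le (hT : MeasurePreserving T μ μ) {s : ℕ} (a c : Fin (s + 1) → ℝ) (N : ℕ)
    {F : X → ℂ} (hF : Bdd μ 1 F) {g : Fin (s + 1) → X → ℂ} (hg : ∀ i, Bdd μ 1 (g i)) :
    ∃ G : ℤ → (Fin (s + 1) → ℤ) → Fin s → X → ℂ, (∀ h e i, Bdd μ 1 (G h e i)) ∧
      (∑ n ∈ Finset.Icc 1 N, ‖corr μ T F g fun i => ⌊a i * n + c i⌋‖) ^ 2 ≤
        ∑ h ∈ Finset.Icc (-(N : ℤ)) N, ∑ e ∈ errorVectors (s + 1), ∑ n ∈ Finset.Icc 1 N,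
          ‖corr μ T (mulDiff T (-⌊a 0 * h⌋ - e 0) F) (G h e)
            fun i => ⌊a i.succ * n + c i.succ⌋‖ := by
  set d : ℕ → Fin (s + 1) → ℤ := fun n i => ⌊a i * n + c i⌋ with hd
  set V : ℕ → X → ℂ := fun n x => F (tp T (-d n 0) x) *
    ∏ i : Fin s, g i.succ (tp T (d n i.succ - d n 0) x) with hV
  have hVb : ∀ n, Bdd μ 1 (V n) := fun n =>
    (hF.comp_tp hT _).mul_one (Bdd.prod fun i _ => (hg _).comp_tp hT _)
  have h1 : ∀ n, corr μ T F g (d n) = ∫ x, g 0 x * V n x ∂μ := by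
    intro n
    rw [corr, ← integral_tp hT (-d n 0)]
    refine integral_congr_ae (Eventually.of_forall fun x => ?_)
    simp only [hV, Fin.prod_univ_succ, ← tp_add, ← sub_eq_add_neg, sub_self, tp_zero]
    ring
  have h2 := sum_norm_integral_sq_le (Finset.Icc 1 N) (hg 0) hVb
  simp only [← h1] at h2
  set G : ℤ → (Fin (s + 1) → ℤ) → Fin s → X → ℂ := fun h e i z => g i.succ z *
    (starRingEnd ℂ) (g i.succ (tp T (⌊a i.succ * h⌋ + e i.succ + (-⌊a 0 * h⌋ - e 0)) z)) with hG
  refine ⟨G, fun h e i => (hg _).mul_one ((hg _).comp_tp hT _).conj, h2.trans ?_⟩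
  obtain ⟨Φ, hΦ⟩ : ∃ Φ : ℤ → (Fin (s + 1) → ℤ) → ℕ → ℝ, ∀ h e n, Φ h e n =
      ‖corr μ T (mulDiff T (-⌊a 0 * h⌋ - e 0) F) (G h e)
        fun i => ⌊a i.succ * n + c i.succ⌋‖ :=
    ⟨_, fun _ _ _ => rfl⟩
  have hΦ0 : ∀ h e n, 0 ≤ Φ h e n := fun h e n => by rw [hΦ]; exact norm_nonneg _
  have h3 : ∀ n n' : ℕ, ‖∫ x, V n x * (starRingEnd ℂ) (V n' x) ∂μ‖ ≤
      ∑ e ∈ errorVectors (s + 1), Φ ((n : ℤ) - n') e n' := by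
    intro n n'
    obtain ⟨e, he⟩ : ∃ e : Fin (s + 1) → ℤ,
        ∀ i, e i = d n i - d n' i - ⌊a i * ((n : ℤ) - n' : ℤ)⌋ := ⟨_, fun _ => rfl⟩
    have hmem : e ∈ errorVectors (s + 1) := by
      rw [errorVectors, Fintype.mem_piFinset]
      intro i
      rw [Finset.mem_Icc, ← abs_le, he]
      have := abs_floor_sub_le (a i * n + c i) (a i * n' + c i)
      rw [sub_zero] at this
      have h4 : a i * n + c i - (a i * n' + c i) = a i * ((n : ℤ) - n' : ℤ) := by
        push_cast; ring
      rw [h4] at this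
      exact this
    refine le_trans (le_of_eq ?_) (Finset.single_le_sum (fun e _ => hΦ0 _ e n') hmem)
    have hΦd : Φ ((n : ℤ) - n') e n' = ‖corr μ T (mulDiff T (-⌊a 0 * ((n : ℤ) - n' : ℤ)⌋ - e 0) F)
      (G ((n : ℤ) - n') e) fun i => d n' i.succ‖ := hΦ _ _ _
    rw [hΦd, ← RCLike.norm_conj, ← integral_conj, ← integral_tp hT (d n' 0)]
    congr 1
    rw [corr]
    refine integral_congr_ae (Eventually.of_forall fun x => ?_)
    have e1 : -d n 0 + d n' 0 = -⌊a 0 * ((n : ℤ) - n' : ℤ)⌋ - e 0 := by rw [he]; ring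
    have e2 : ∀ i : Fin s, d n i.succ - d n 0 + d n' 0 =
        ⌊a i.succ * ((n : ℤ) - n' : ℤ)⌋ + e i.succ + (-⌊a 0 * ((n : ℤ) - n' : ℤ)⌋ - e 0) +
          d n' i.succ := by
      intro i; rw [he, he]; ring
    have e3 : ∀ i : Fin s, d n' i.succ - d n' 0 + d n' 0 = d n' i.succ := fun i => by ring
    simp only [hV, hG, mulDiff, map_mul, map_prod, Complex.conj_conj, ← tp_add]
    simp only [e1, e2, e3, neg_add_cancel, tp_zero, Finset.prod_mul_distrib]
    ring
  simp only [← hΦ]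
  calc _ ≤ ∑ n ∈ Finset.Icc 1 N, ∑ n' ∈ Finset.Icc 1 N,
        ∑ e ∈ errorVectors (s + 1), Φ ((n : ℤ) - n') e n' :=
        Finset.sum_le_sum fun n _ => Finset.sum_le_sum fun n' _ => h3 n n'
    _ = ∑ n' ∈ Finset.Icc 1 N, ∑ n ∈ Finset.Icc 1 N,
        ∑ e ∈ errorVectors (s + 1), Φ ((n : ℤ) - n') e n' := Finset.sum_comm
    _ ≤ ∑ n' ∈ Finset.Icc 1 N, ∑ h ∈ Finset.Icc (-(N : ℤ)) N,
        ∑ e ∈ errorVectors (s + 1), Φ h e n' :=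
        Finset.sum_le_sum fun n' hn' => sum_Icc_sub_le
          (φ := fun h => ∑ e ∈ errorVectors (s + 1), Φ h e n')
          (fun _ => Finset.sum_nonneg fun _ _ => hΦ0 _ _ _) N hn'
    _ = _ := by
        rw [Finset.sum_comm]
        exact Finset.sum_congr rfl fun h _ => Finset.sum_comm

lemma card_errorVectors_pos (s : ℕ) : 0 < (errorVectors s).card := by
  refine Finset.card_pos.2 ⟨fun _ => 0, ?_⟩
  simp [errorVectors, Fintype.mem_piFinset]

/-- Correlation averages along sequences of degree one are bounded by averages of iterated
multiplicative derivatives over boxes, the sides of the box being the lengths of the ranges of the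
sequences. -/
lemma avg_corr_pow_le (hT : MeasurePreserving T μ μ) (s : ℕ) (A : ℝ) (hA : 0 ≤ A) :
    ∃ K : ℝ, 0 ≤ K ∧ ∀ N : ℕ, 1 ≤ N → ∀ a c : Fin s → ℝ, (∀ i, 1 ≤ |a i| * N) →
      (∀ i, |a i| ≤ A) → ∀ F : X → ℂ, Bdd μ 1 F → ∀ g : Fin s → X → ℂ, (∀ i, Bdd μ 1 (g i)) →
      ((N : ℝ)⁻¹ * ∑ n ∈ Finset.Icc 1 N, ‖corr μ T F g fun i => ⌊a i * n + c i⌋‖) ^ (2 ^ s) ≤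
        K * boxAvg μ T s (fun i => ⌈|a i| * N⌉₊ + 2) F := by
  induction s with
  | zero =>
    refine ⟨1, zero_le_one, fun N hN a c _ _ F hF g hg => ?_⟩
    have hN' : (N : ℝ) ≠ 0 := by positivity
    simp [corr, boxAvg, hN']
  | succ s ih =>
    obtain ⟨K, hK, ih⟩ := ih
    set R : ℝ := ((errorVectors (s + 1)).card : ℝ) with hR
    have hR0 : 0 < R := by rw [hR]; exact_mod_cast card_errorVectors_pos _
    obtain ⟨p, hp⟩ : ∃ p, 2 ^ s = p + 1 := ⟨2 ^ s - 1, by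
      have := Nat.one_le_two_pow (n := s); omega⟩
    refine ⟨(3 * R) ^ p * K * R * ((1 + A) * 9), by positivity,
      fun N hN a c ha1 ha2 F hF g hg => ?_⟩
    have hN' : (0 : ℝ) < N := by exact_mod_cast hN
    obtain ⟨G, hGb, hG⟩ := sum_corr_sq_le hT a c N hF hg
    set y : ℤ × (Fin (s + 1) → ℤ) → ℝ := fun t => (N : ℝ)⁻¹ * ∑ n ∈ Finset.Icc 1 N,
      ‖corr μ T (mulDiff T (-⌊a 0 * t.1⌋ - t.2 0) F) (G t.1 t.2)
        fun i => ⌊a i.succ * n + c i.succ⌋‖ with hy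
    have hy0 : ∀ t, 0 ≤ y t := fun t =>
      mul_nonneg (by positivity) (Finset.sum_nonneg fun _ _ => norm_nonneg _)
    set S := Finset.Icc (-(N : ℤ)) N ×ˢ errorVectors (s + 1) with hS
    have hScard : (S.card : ℝ) ≤ 3 * R * N := by
      have h1 : (Finset.Icc (-(N : ℤ)) N).card = 2 * N + 1 := by
        rw [Int.card_Icc]; omega
      rw [hS, Finset.card_product, h1, Nat.cast_mul, ← hR]
      have : (1 : ℝ) ≤ N := by exact_mod_cast hN
      push_cast
      nlinarith
    have hS0 : (0 : ℝ) < S.card := by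
      have : 0 < S.card := by
        rw [hS, Finset.card_product]
        refine Nat.mul_pos ?_ (card_errorVectors_pos _)
        rw [Int.card_Icc]; omega
      exact_mod_cast this
    -- the square of the average is at most `N⁻¹ ∑ y`
    have h1 : ((N : ℝ)⁻¹ * ∑ n ∈ Finset.Icc 1 N, ‖corr μ T F g fun i => ⌊a i * n + c i⌋‖) ^ 2 ≤
        (N : ℝ)⁻¹ * ∑ t ∈ S, y t := by
      rw [mul_pow]
      refine (mul_le_mul_of_nonneg_left hG (by positivity)).trans (le_of_eq ?_)
      rw [hS, Finset.sum_product]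
      simp only [hy, ← Finset.mul_sum]
      ring
    -- the change of variables in the direction of the derivative
    set M : ℕ := ⌈|a 0| * N⌉₊ + 2 with hM
    set b : ℤ → ℝ := fun m =>
      boxAvg μ T s (fun i => ⌈|a i.succ| * N⌉₊ + 2) (mulDiff T m F) with hb
    have hb0 : ∀ m, 0 ≤ b m := fun m => boxAvg_nonneg _ _
    have hyb : ∀ t, y t ^ (p + 1) ≤ K * b (-⌊a 0 * t.1⌋ - t.2 0) := by
      intro t
      rw [← hp]
      exact ih N hN (fun i => a i.succ) (fun i => c i.succ) (fun i => ha1 _) (fun i => ha2 _) _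
        (hF.mulDiff hT _) _ (hGb _ _)
    have ha0 : a 0 ≠ 0 := by
      intro h
      have := ha1 0
      rw [h] at this
      norm_num at this
    have hMr : |a 0| * N + 2 ≤ M := by
      rw [hM]; push_cast; linarith [Nat.le_ceil (|a 0| * N)]
    have hMr' : (M : ℝ) ≤ |a 0| * N + 3 := by
      rw [hM]; push_cast
      linarith [Nat.ceil_lt_add_one (a := |a 0| * N) (by positivity)]
    have h2 : ∑ t ∈ S, b (-⌊a 0 * t.1⌋ - t.2 0) ≤
        R * ((1 / |a 0| + 1) * ((2 * M + 1) * boxAvg μ T (s + 1) (fun i => ⌈|a i| * N⌉₊ + 2) F)) := by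
      rw [hS, Finset.sum_product_right]
      have h3 : (2 * (M : ℝ) + 1) * boxAvg μ T (s + 1) (fun i => ⌈|a i| * N⌉₊ + 2) F =
          ∑ m ∈ Finset.Icc (-(M : ℤ)) M, b m := by
        rw [boxAvg, FinMean.E_interval, smul_eq_mul, ← mul_assoc, mul_inv_cancel₀, one_mul]
        positivity
      rw [h3, hR, ← nsmul_eq_mul]
      refine Finset.sum_le_card_nsmul _ _ _ fun e he => ?_
      rw [errorVectors, Fintype.mem_piFinset] at he
      have := Finset.mem_Icc.1 (he 0)
      exact sum_floor_le hb0 ha0 N M hMr this.1 this.2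
    have h4 : (∑ t ∈ S, y t) ^ (p + 1) ≤ (3 * R * N) ^ p * ∑ t ∈ S, y t ^ (p + 1) := by
      have := pow_sum_div_card_le_sum_pow (s := S) (fun t _ => hy0 t) p
      rw [div_le_iff₀ (pow_pos hS0 p), mul_comm] at this
      refine this.trans (mul_le_mul_of_nonneg_right (pow_le_pow_left₀ hS0.le hScard p) ?_)
      exact Finset.sum_nonneg fun t _ => pow_nonneg (hy0 t) _
    have hbox := boxAvg_nonneg (μ := μ) (T := T) (fun i => ⌈|a i| * (N : ℝ)⌉₊ + 2) F
    set β := boxAvg μ T (s + 1) (fun i => ⌈|a i| * (N : ℝ)⌉₊ + 2) F with hβ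
    have h5 : (1 / |a 0| + 1) * (2 * M + 1) ≤ (1 + A) * 9 * N := by
      have h6 := ha1 0
      have h7 := ha2 0
      have h8 : 0 < |a 0| := abs_pos.2 ha0
      have h9 : 2 * (M : ℝ) + 1 ≤ 9 * (|a 0| * N) := by linarith
      calc (1 / |a 0| + 1) * (2 * M + 1) ≤ (1 / |a 0| + 1) * (9 * (|a 0| * N)) := by gcongr
        _ = (1 + |a 0|) * 9 * N := by field_simp
        _ ≤ _ := by gcongr
    have hx0 : 0 ≤ (N : ℝ)⁻¹ * ∑ n ∈ Finset.Icc 1 N, ‖corr μ T F g fun i => ⌊a i * n + c i⌋‖ :=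
      mul_nonneg (by positivity) (Finset.sum_nonneg fun _ _ => norm_nonneg _)
    calc _ = (((N : ℝ)⁻¹ * ∑ n ∈ Finset.Icc 1 N,
          ‖corr μ T F g fun i => ⌊a i * n + c i⌋‖) ^ 2) ^ (p + 1) := by
          rw [← pow_mul, ← hp, pow_succ']
      _ ≤ ((N : ℝ)⁻¹ * ∑ t ∈ S, y t) ^ (p + 1) := pow_le_pow_left₀ (sq_nonneg _) h1 _
      _ = ((N : ℝ)⁻¹) ^ (p + 1) * (∑ t ∈ S, y t) ^ (p + 1) := mul_pow _ _ _
      _ ≤ ((N : ℝ)⁻¹) ^ (p + 1) * ((3 * R * N) ^ p * ∑ t ∈ S, K * b (-⌊a 0 * t.1⌋ - t.2 0)) := by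
          refine mul_le_mul_of_nonneg_left (h4.trans ?_) (by positivity)
          exact mul_le_mul_of_nonneg_left (Finset.sum_le_sum fun t _ => hyb t) (by positivity)
      _ ≤ ((N : ℝ)⁻¹) ^ (p + 1) * ((3 * R * N) ^ p *
          (K * (R * (((1 + A) * 9 * N) * β)))) := by
          rw [← Finset.mul_sum]
          gcongr
          refine h2.trans ?_
          rw [← mul_assoc (1 / |a 0| + 1)]
          gcongr
      _ = _ := by
          rw [mul_pow _ (N : ℝ), inv_pow]
          field_simp
          ring

end Linear

/-! ### Products over discrete cubes -/

section Cube

variable {X : Type*} [MeasurableSpace X] (μ : Measure X) (T : X ≃ᵐ X)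

/-- The sum of the entries of `h` over the coordinates selected by `ω`. -/
def dot {k : ℕ} (ω : Fin k → Bool) (h : Fin k → ℤ) : ℤ := ∑ i, if ω i then h i else 0

lemma dot_false {k : ℕ} (h : Fin k → ℤ) : dot (fun _ => false) h = 0 := by simp [dot]

lemma dot_add {k : ℕ} (ω : Fin k → Bool) (h h' : Fin k → ℤ) :
    dot ω (h + h') = dot ω h' + dot ω h := by
  simp only [dot, ← Finset.sum_add_distrib, Pi.add_apply]
  refine Finset.sum_congr rfl fun i _ => ?_
  split_ifs <;> ring

lemma dot_cons {k : ℕ} (b : Bool) (ω : Fin k → Bool) (m : ℤ) (h : Fin k → ℤ) :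
    dot (Fin.cons b ω : Fin (k + 1) → Bool) (Fin.cons m h : Fin (k + 1) → ℤ) =
      dot ω h + if b then m else 0 := by
  simp only [dot, Fin.sum_univ_succ, Fin.cons_zero, Fin.cons_succ]
  ring

/-- The product `∏ T ^ (ω · h) G_ω` over the vertices `ω` of the `k`-dimensional cube. -/
def cube {k : ℕ} (G : (Fin k → Bool) → X → ℂ) (h : Fin k → ℤ) (x : X) : ℂ :=
  ∏ ω, G ω (tp T (dot ω h) x)

/-- A family of functions bounded by one on the vertices of the cube, with the constant function
one at the vertex zero. -/
def CubeFamily {k : ℕ} (G : (Fin k → Bool) → X → ℂ) : Prop :=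
  (∀ ω, Bdd μ 1 (G ω)) ∧ ∀ x, G (fun _ => false) x = 1

variable {T}

lemma cube_cons {k : ℕ} (G : (Fin (k + 1) → Bool) → X → ℂ) (m : ℤ) (h : Fin k → ℤ) (x : X) :
    cube T G (Fin.cons m h) x = cube T (fun ω => G (Fin.cons false ω)) h x *
      cube T (fun ω => G (Fin.cons true ω)) h (tp T m x) := by
  simp only [cube]
  rw [← Equiv.prod_comp (Fin.consEquiv fun _ : Fin (k + 1) => Bool), Fintype.prod_prod_type,
    Fintype.prod_bool, mul_comm]
  simp only [Fin.consEquiv, Equiv.coe_fn_mk, ← tp_add]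
  have e1 : ∀ ω : Fin k → Bool, dot (Fin.cons false ω : Fin (k + 1) → Bool)
      (Fin.cons m h : Fin (k + 1) → ℤ) = dot ω h := fun ω => by rw [dot_cons]; simp
  have e2 : ∀ ω : Fin k → Bool, dot (Fin.cons true ω : Fin (k + 1) → Bool)
      (Fin.cons m h : Fin (k + 1) → ℤ) = dot ω h + m := fun ω => by rw [dot_cons]; simp
  simp only [e1, e2]

lemma cube_mul {k : ℕ} (G G' : (Fin k → Bool) → X → ℂ) (h : Fin k → ℤ) (x : X) :
    cube T (fun ω z => G ω z * G' ω z) h x = cube T G h x * cube T G' h x :=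
  Finset.prod_mul_distrib

lemma cube_conj {k : ℕ} (G : (Fin k → Bool) → X → ℂ) (h : Fin k → ℤ) (x : X) :
    cube T (fun ω z => (starRingEnd ℂ) (G ω z)) h x = (starRingEnd ℂ) (cube T G h x) := by
  simp [cube]

lemma cube_tp {k : ℕ} (G : (Fin k → Bool) → X → ℂ) (h : Fin k → ℤ) (n : ℤ) (x : X) :
    cube T (fun ω z => G ω (tp T n z)) h x = cube T G h (tp T n x) := by
  simp only [cube, ← tp_add, add_comm n]

lemma cube_shift {k : ℕ} (G : (Fin k → Bool) → X → ℂ) (h h' : Fin k → ℤ) (x : X) :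
    cube T G (h + h') x = cube T (fun ω z => G ω (tp T (dot ω h') z)) h x := by
  simp only [cube, dot_add, tp_add]

variable {μ}

lemma Bdd.cube (hT : MeasurePreserving T μ μ) {k : ℕ} {G : (Fin k → Bool) → X → ℂ}
    (hG : ∀ ω, Bdd μ 1 (G ω)) (h : Fin k → ℤ) : Bdd μ 1 (cube T G h) :=
  Bdd.prod fun ω _ => (hG ω).comp_tp hT _

namespace CubeFamily

variable {k : ℕ} {G G' : (Fin k → Bool) → X → ℂ}

lemma one : CubeFamily μ fun (_ : Fin k → Bool) (_ : X) => (1 : ℂ) :=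
  ⟨fun _ => Bdd.one, fun _ => rfl⟩

lemma mul (hG : CubeFamily μ G) (hG' : CubeFamily μ G') :
    CubeFamily μ fun ω z => G ω z * G' ω z :=
  ⟨fun ω => (hG.1 ω).mul_one (hG'.1 ω), fun x => by simp only [hG.2, hG'.2, mul_one]⟩

lemma conj (hG : CubeFamily μ G) : CubeFamily μ fun ω z => (starRingEnd ℂ) (G ω z) :=
  ⟨fun ω => (hG.1 ω).conj, fun x => by simp only [hG.2, map_one]⟩

lemma comp_tp (hT : MeasurePreserving T μ μ) (hG : CubeFamily μ G) (n : (Fin k → Bool) → ℤ) :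
    CubeFamily μ fun ω z => G ω (tp T (n ω) z) :=
  ⟨fun ω => (hG.1 ω).comp_tp hT _, fun x => by simp only [hG.2]⟩

end CubeFamily

lemma mulDiffs_mul {k : ℕ} (h : Fin k → ℤ) (F F' : X → ℂ) (x : X) :
    mulDiffs T k h (fun x => F x * F' x) x = mulDiffs T k h F x * mulDiffs T k h F' x := by
  induction k generalizing F F' with
  | zero => rfl
  | succ k ih =>
    simp only [mulDiffs]
    rw [← ih]
    congr 1
    ext z
    simp only [mulDiff, map_mul]
    ring

lemma mulDiffs_conj {k : ℕ} (h : Fin k → ℤ) (F : X → ℂ) (x : X) :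
    mulDiffs T k h (fun x => (starRingEnd ℂ) (F x)) x = (starRingEnd ℂ) (mulDiffs T k h F x) := by
  induction k generalizing F with
  | zero => rfl
  | succ k ih =>
    simp only [mulDiffs]
    rw [← ih]
    congr 1
    ext z
    simp only [mulDiff, map_mul]

lemma mulDiffs_tp {k : ℕ} (h : Fin k → ℤ) (F : X → ℂ) (n : ℤ) (x : X) :
    mulDiffs T k h (fun x => F (tp T n x)) x = mulDiffs T k h F (tp T n x) := by
  induction k generalizing F with
  | zero => rfl
  | succ k ih =>
    simp only [mulDiffs]
    rw [← ih]
    congr 1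
    ext z
    simp only [mulDiff, ← tp_add, add_comm n]

/-- An iterated multiplicative derivative of `F` is `F` times a product over the nonzero vertices
of the cube. -/
lemma exists_cubeFamily_mulDiffs (k : ℕ) {F : X → ℂ} (hF : Bdd μ 1 F) :
    ∃ G : (Fin k → Bool) → X → ℂ, CubeFamily μ G ∧
      ∀ h x, mulDiffs T k h F x = F x * cube T G h x := by
  classical
  induction k with
  | zero => exact ⟨fun _ _ => 1, CubeFamily.one, fun h x => by simp [mulDiffs, cube]⟩
  | succ k ih =>
    obtain ⟨G, hG, hGF⟩ := ih
    refine ⟨fun ω z => if ω 0 then (if (fun i : Fin k => ω i.succ) = fun _ => false then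
      (starRingEnd ℂ) (F z) else 1) * (starRingEnd ℂ) (G (fun i => ω i.succ) z)
      else G (fun i => ω i.succ) z, ⟨fun ω => ?_, fun x => ?_⟩, fun h x => ?_⟩
    · by_cases h0 : ω 0
      · simp only [h0, if_true]
        refine Bdd.mul_one ?_ (hG.1 _).conj
        by_cases h1 : (fun i : Fin k => ω i.succ) = fun _ => false
        · simpa only [h1, if_true] using hF.conj
        · simpa only [h1, if_false] using Bdd.one
      · simpa only [h0, Bool.false_eq_true, if_false] using hG.1 fun i => ω i.succ
    · simpa using hG.2 x
    · have hsplit : mulDiffs T (k + 1) h F x = mulDiffs T k (fun i => h i.succ) F x *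
          (starRingEnd ℂ) (mulDiffs T k (fun i => h i.succ) F (tp T (h 0) x)) := by
        rw [mulDiffs, ← mulDiffs_tp, ← mulDiffs_conj, ← mulDiffs_mul]
        rfl
      have hcons : h = Fin.cons (h 0) fun i => h i.succ := (Fin.cons_self_tail h).symm
      rw [hsplit, hGF, hGF, map_mul]
      conv_rhs => rw [hcons, cube_cons]
      simp only [Fin.cons_zero, Fin.cons_succ, if_true, Bool.false_eq_true, if_false]
      rw [cube_mul, cube_conj]
      have hone : cube T (fun (ω : Fin k → Bool) z => if ω = fun _ => false then
          (starRingEnd ℂ) (F z) else 1) (fun i => h i.succ) (tp T (h 0) x) =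
          (starRingEnd ℂ) (F (tp T (h 0) x)) := by
        rw [cube, Finset.prod_eq_single (fun _ => false)]
        · simp [dot_false]
        · intro ω _ hω; simp [hω]
        · simp
      rw [hone]
      ring

end Cube

/-! ### Box averages as averages over cubes -/

section BoxMean

variable {X : Type*} [MeasurableSpace X] {μ : Measure X} {T : X ≃ᵐ X}

lemma FinMean.E_integral {G : Type} (ν : FinMean G) {f : G → X → ℂ}
    (hf : ∀ h, Integrable (f h) μ) :
    ν.E (fun h => ∫ x, f h x ∂μ) = ∫ x, ν.E (fun h => f h x) ∂μ := by
  simp only [FinMean.E]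
  rw [integral_smul, integral_finsetSum _ fun i _ => hf _]

lemma Bdd.E {G : Type} (ν : FinMean G) {B : ℝ} {f : G → X → ℂ} (hf : ∀ h, Bdd μ B (f h)) :
    Bdd μ B fun x => ν.E fun h => f h x := by
  have h1 := (Bdd.sum (s := Finset.univ) fun i _ => hf (ν.pt i)).const_mul
    (((Fintype.card ν.ι : ℝ)⁻¹ : ℝ) : ℂ)
  have h2 : ‖(((Fintype.card ν.ι : ℝ)⁻¹ : ℝ) : ℂ)‖ * ∑ _i : ν.ι, B = B := by
    have h3 := ν.card_pos.ne'
    rw [Complex.norm_real, Real.norm_of_nonneg (by positivity), Finset.sum_const,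
      Finset.card_univ, nsmul_eq_mul, ← mul_assoc, inv_mul_cancel₀ h3, one_mul]
  rw [h2] at h1
  have h4 : (fun x => ν.E fun h => f h x) =
      fun x => (((Fintype.card ν.ι : ℝ)⁻¹ : ℝ) : ℂ) * ∑ i, f (ν.pt i) x := by
    ext x
    rw [FinMean.E, Complex.real_smul]
  rw [h4]
  exact h1

variable [IsProbabilityMeasure μ]

lemma norm_integral_mul_sq_le {B : ℝ} {A Q : X → ℂ} (hA : Bdd μ B A) (hQ : Bdd μ 1 Q) :
    ‖∫ x, Q x * A x ∂μ‖ ^ 2 ≤ (∫ x, A x * (starRingEnd ℂ) (A x) ∂μ).re := by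
  have := sum_norm_integral_sq_le (μ := μ) ({()} : Finset Unit) hQ
    (V := fun _ => A) (fun _ => hA)
  simp only [Finset.sum_singleton] at this
  refine this.trans (le_of_eq ?_)
  simp only [Complex.mul_conj]
  rw [integral_complex_ofReal, Complex.norm_real, Complex.ofReal_re, Real.norm_of_nonneg]
  exact integral_nonneg fun x => Complex.normSq_nonneg _

/-- Expanding the square of an average. -/
lemma integral_E_mul_conj {G : Type} (ν : FinMean G) {B : ℝ} {f : G → X → ℂ}
    (hf : ∀ n, Bdd μ B (f n)) :
    ∫ x, ν.E (fun n => f n x) * (starRingEnd ℂ) (ν.E fun n => f n x) ∂μ =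
      ν.E fun n => ν.E fun n' => ∫ x, f n x * (starRingEnd ℂ) (f n' x) ∂μ := by
  have e2 : ∀ j i, Bdd μ (B * B) fun x => f j x * (starRingEnd ℂ) (f i x) :=
    fun j i => (hf j).mul (hf i).conj
  have e3 : ∀ j, ν.E (fun i => ∫ x, f j x * (starRingEnd ℂ) (f i x) ∂μ) =
      ∫ x, ν.E fun i => f j x * (starRingEnd ℂ) (f i x) ∂μ :=
    fun j => FinMean.E_integral _ fun i => (e2 j i).integrable
  simp only [e3]
  rw [FinMean.E_integral _ fun j => (Bdd.E _ fun i => e2 j i).integrable]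
  refine integral_congr_ae (Eventually.of_forall fun x => ?_)
  simp only [FinMean.E_mul_left]
  have e4 : (starRingEnd ℂ) (ν.E fun i => f i x) = ν.E fun i => (starRingEnd ℂ) (f i x) := by
    simp [FinMean.E]
  rw [e4]
  have e5 := FinMean.E_mul_left ν (ν.E fun i => (starRingEnd ℂ) (f i x)) fun j => f j x
  rw [mul_comm, ← e5]
  simp only [mul_comm]

/-- The mean on `ℤ ^ (s + 1)` uniform on intervals in the first coordinates and with the
distribution of a difference in the last one. -/
def boxMean : (s : ℕ) → (Fin s → ℕ) → ℕ → FinMean (Fin (s + 1) → ℤ)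
  | 0, _, N => FinMean.cons (FinMean.fejer N) (FinMean.dirac 0)
  | s + 1, M, N => FinMean.cons (FinMean.interval (M 0)) (boxMean s (fun i => M i.succ) N)

lemma asympInv_boxMean {s : ℕ} {M : ℕ → Fin s → ℕ} (hM : ∀ i, Tendsto (fun n => M n i) atTop atTop)
    {N : ℕ → ℕ} (hN : Tendsto N atTop atTop) : AsympInv fun n => boxMean s (M n) (N n) := by
  induction s with
  | zero => exact (AsympInv.fejer hN).cons AsympInv.dirac_zero
  | succ s ih =>
    exact (AsympInv.interval (hM 0)).cons (ih (M := fun n i => M n i.succ) fun i => hM i.succ)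

/-- Cauchy–Schwarz removes the absolute values from the box average, at the cost of one more
multiplicative derivative. The side `N` of the box in the new direction is arbitrary. -/
lemma boxAvg_sq_le (hT : MeasurePreserving T μ μ) {s : ℕ} (M : Fin s → ℕ) (N : ℕ) {F : X → ℂ}
    (hF : Bdd μ 1 F) : boxAvg μ T s M F ^ 2 ≤
      ((boxMean s M N).E fun h => ∫ x, mulDiffs T (s + 1) h F x ∂μ).re := by
  induction s generalizing F with
  | zero =>
    simp only [boxAvg, boxMean]
    have hb : ∀ j : ℤ, Bdd μ 1 fun x => F (tp T j x) := fun j => hF.comp_tp hT j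
    set A : X → ℂ := fun x => (FinMean.initial N).E fun j => F (tp T j x) with hA
    have h1 : ∫ x, A x ∂μ = ∫ x, F x ∂μ := by
      rw [hA, ← FinMean.E_integral _ fun j => (hb j).integrable]
      simp only [integral_tp hT]
      rw [FinMean.E_const]
    have h2 := norm_integral_mul_sq_le (Bdd.E (FinMean.initial N) hb) Bdd.one
    simp only [one_mul] at h2
    rw [h1, integral_E_mul_conj _ hb] at h2
    refine h2.trans (le_of_eq ?_)
    rw [FinMean.E_cons, FinMean.E_fejer]
    congr 1
    have e1 : ∀ j i : ℤ, (FinMean.dirac (0 : Fin 0 → ℤ)).E (fun h =>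
        ∫ x, mulDiffs T 1 (Fin.cons (i - j) h) F x ∂μ) =
        ∫ x, F (tp T j x) * (starRingEnd ℂ) (F (tp T i x)) ∂μ := by
      intro j i
      simp only [mulDiffs, mulDiff, Fin.cons_zero]
      rw [FinMean.E_const, ← integral_tp hT j fun x => F x * (starRingEnd ℂ) (F (tp T (i - j) x))]
      simp only [← tp_add, sub_add_cancel]
    simp only [e1]
  | succ s ih =>
    simp only [boxAvg, boxMean]
    refine (FinMean.E_pow_le _ (fun m => boxAvg_nonneg _ _) 2).trans ?_
    rw [FinMean.E_cons, FinMean.E_re]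
    exact FinMean.E_mono _ fun m => ih _ (hF.mulDiff hT m)

end BoxMean

/-! ### Weak limits of bounded functions -/

section WeakLimit

variable {X : Type*} [MeasurableSpace X] {μ : Measure X} [IsProbabilityMeasure μ]

/-- Weak compactness of the unit ball of `L²`, for a sequence bounded by one; the limit is again
bounded by one. -/
lemma exists_weak_limit (𝒰 : Ultrafilter ℕ) {D : ℕ → X → ℂ} (hD : ∀ n, Bdd μ 1 (D n)) :
    ∃ φ : X → ℂ, Measurable φ ∧ Bdd μ 1 φ ∧ ∀ (B : ℝ) (g : X → ℂ), Bdd μ B g →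
      Tendsto (fun n => ∫ x, g x * D n x ∂μ) 𝒰 (𝓝 (∫ x, g x * φ x ∂μ)) := by
  set x : ℕ → Lp ℂ 2 μ := fun n => ((hD n).conj.memLp 2).toLp _ with hx
  have hx1 : ∀ n, ‖x n‖ ≤ 1 := by
    intro n
    rw [hx, Lp.norm_toLp]
    refine ENNReal.toReal_le_of_le_ofReal zero_le_one ?_
    refine (eLpNorm_le_of_ae_bound (hD n).conj.2).trans ?_
    simp
  set Λ : ℕ → WeakDual ℂ (Lp ℂ 2 μ) := fun n =>
    StrongDual.toWeakDual (InnerProductSpace.toDual ℂ _ (x n)) with hΛ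
  have hcomp := WeakDual.isCompact_closedBall (𝕜 := ℂ) (E := Lp ℂ 2 μ) 0 1
  obtain ⟨L, -, hL⟩ := hcomp.ultrafilter_le_nhds (𝒰.map Λ) (by
    rw [le_principal_iff, Ultrafilter.coe_map, mem_map]
    refine Eventually.of_forall fun n => ?_
    simp only [Set.mem_preimage, Metric.mem_closedBall, dist_zero_right]
    change ‖InnerProductSpace.toDual ℂ _ (x n)‖ ≤ 1
    rw [LinearIsometryEquiv.norm_map]
    exact hx1 n)
  rw [Ultrafilter.coe_map] at hL
  set ψ : Lp ℂ 2 μ := (InnerProductSpace.toDual ℂ _).symm (WeakDual.toStrongDual L) with hψ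
  have hlim : ∀ y : Lp ℂ 2 μ, Tendsto (fun n => inner ℂ (x n) y) 𝒰 (𝓝 (inner ℂ ψ y)) := by
    intro y
    have h1 := ((WeakDual.eval_continuous y).tendsto L).comp (show Tendsto Λ 𝒰 (𝓝 L) from hL)
    have h2 : inner ℂ ψ y = L y := by
      rw [hψ, InnerProductSpace.toDual_symm_apply]; rfl
    rw [h2]
    exact h1
  obtain ⟨φ₀, hφ₀m, hφ₀⟩ := Lp.aestronglyMeasurable ψ
  have hmeas : Measurable φ₀ := hφ₀m.measurable
  have key : ∀ (B : ℝ) (g : X → ℂ), Bdd μ B g → Tendsto (fun n => ∫ x, g x * D n x ∂μ) 𝒰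
      (𝓝 (∫ x, g x * (starRingEnd ℂ) (φ₀ x) ∂μ)) := by
    intro B g hg
    have h1 := hlim ((hg.memLp 2).toLp g)
    have h2 : inner ℂ ψ ((hg.memLp 2).toLp g) = ∫ x, g x * (starRingEnd ℂ) (φ₀ x) ∂μ := by
      rw [L2.inner_def]
      refine integral_congr_ae ?_
      filter_upwards [hφ₀, (hg.memLp 2).coeFn_toLp] with x h3 h4
      rw [h3, h4, RCLike.inner_apply]
    rw [h2] at h1
    refine h1.congr fun n => ?_
    rw [hx, inner_toLp]
    simp [mul_comm]
  refine ⟨fun x => (starRingEnd ℂ) (φ₀ x), Complex.continuous_conj.measurable.comp hmeas,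
    ⟨(Complex.continuous_conj.measurable.comp hmeas).aestronglyMeasurable, ?_⟩, key⟩
  -- the limit is bounded by one: test it against its phase on the set where it is larger
  set S : Set X := {x | 1 < ‖φ₀ x‖} with hS
  have hSm : MeasurableSet S := measurableSet_lt measurable_const hmeas.norm
  set g : X → ℂ := S.indicator fun x => φ₀ x / ‖φ₀ x‖ with hg
  have hgb : Bdd μ 1 g := by
    refine ⟨((hmeas.div (Complex.measurable_ofReal.comp hmeas.norm)).indicator
      hSm).aestronglyMeasurable, Eventually.of_forall fun x => ?_⟩
    by_cases hxS : x ∈ S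
    · rw [hg, Set.indicator_of_mem hxS, norm_div, Complex.norm_real, norm_norm]
      exact div_self_le_one _
    · rw [hg, Set.indicator_of_notMem hxS]; simp
  have hψ2 : MemLp φ₀ 2 μ := (memLp_congr_ae hφ₀).1 (Lp.memLp ψ)
  have hint : Integrable (fun x => ‖φ₀ x‖) μ :=
    (memLp_one_iff_integrable.1 (hψ2.mono_exponent (by norm_num))).norm
  have hval : ∫ x, g x * (starRingEnd ℂ) (φ₀ x) ∂μ = ((∫ x in S, ‖φ₀ x‖ ∂μ : ℝ) : ℂ) := by
    rw [← integral_complex_ofReal, ← integral_indicator hSm]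
    refine integral_congr_ae (Eventually.of_forall fun x => ?_)
    by_cases hxS : x ∈ S
    · have h1 : (‖φ₀ x‖ : ℂ) ≠ 0 := by
        have : (0 : ℝ) < ‖φ₀ x‖ := lt_trans zero_lt_one hxS
        exact_mod_cast this.ne'
      simp only [hg, Set.indicator_of_mem hxS]
      rw [div_mul_eq_mul_div, Complex.mul_conj, Complex.normSq_eq_norm_sq]
      push_cast
      field_simp
    · simp only [hg, Set.indicator_of_notMem hxS, zero_mul]
  have hle : ∫ x in S, ‖φ₀ x‖ ∂μ ≤ μ.real S := by
    have h1 : ∀ n, ‖∫ x, g x * D n x ∂μ‖ ≤ μ.real S := by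
      intro n
      have h2 : ∫ x, g x * D n x ∂μ = ∫ x in S, g x * D n x ∂μ := by
        rw [← integral_indicator hSm]
        refine integral_congr_ae (Eventually.of_forall fun x => ?_)
        by_cases hxS : x ∈ S
        · simp only [Set.indicator_of_mem hxS]
        · simp only [hg, Set.indicator_of_notMem hxS, zero_mul]
      rw [h2]
      have h3 := norm_setIntegral_le_of_norm_le_const_ae (C := 1) (f := fun x => g x * D n x)
        (measure_lt_top μ S) (ae_restrict_of_ae (hgb.mul_one (hD n)).2 |>.mono fun x hx => hx)
      simpa using h3
    have h2 := (key 1 g hgb).norm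
    rw [hval, Complex.norm_real] at h2
    exact (le_abs_self _).trans (le_of_tendsto h2 (Eventually.of_forall h1))
  have h0 : ∫ x in S, (‖φ₀ x‖ - 1) ∂μ = 0 := by
    refine le_antisymm ?_ (setIntegral_nonneg hSm fun x hx => by
      have : (1 : ℝ) < ‖φ₀ x‖ := hx
      linarith)
    rw [integral_sub hint.integrableOn (integrable_const _).integrableOn]
    simpa using hle
  have h1 := (setIntegral_eq_zero_iff_of_nonneg_ae
    (ae_restrict_of_forall_mem hSm fun x hx => by
      have : (1 : ℝ) < ‖φ₀ x‖ := hx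
      simp only [Pi.zero_apply, Pi.sub_apply]
      linarith) (hint.sub (integrable_const _)).integrableOn).1 h0
  have h2 := (ae_restrict_iff' hSm).1 h1
  filter_upwards [h2] with x hx
  by_contra h3
  rw [RCLike.norm_conj, not_le] at h3
  have := hx h3
  simp only [Pi.zero_apply, Pi.sub_apply] at this
  linarith

end WeakLimit

/-! ### The mean ergodic theorem and the conditional expectation on invariant sets -/

section MeanErgodic

variable {X : Type*} [MeasurableSpace X] {μ : Measure X} {T : X ≃ᵐ X}

/-- A function that is invariant almost everywhere agrees almost everywhere with one that is
measurable with respect to the strictly invariant sets. -/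
lemma aestronglyMeasurable_invariants (hT : MeasurePreserving T μ μ) {ψ : X → ℂ}
    (hψ : AEStronglyMeasurable ψ μ) (hinv : ψ ∘ T =ᵐ[μ] ψ) :
    AEStronglyMeasurable[MeasurableSpace.invariants T] ψ μ := by
  obtain ⟨ψ₀, hψ₀m, hψ₀⟩ := hψ
  have hψ₀m := hψ₀m.measurable
  have hinv₀ : ∀ᵐ x ∂μ, ψ₀ (T x) = ψ₀ x := by
    filter_upwards [hψ₀, hT.quasiMeasurePreserving.ae hψ₀, hinv] with x h1 h2 h3
    rw [← h1, ← h2]; exact h3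
  have hall : ∀ n : ℤ, ∀ᵐ x ∂μ, ψ₀ (tp T n x) = ψ₀ x := by
    intro n
    have hstep : ∀ n : ℤ, ∀ᵐ x ∂μ, ψ₀ (tp T (n + 1) x) = ψ₀ (tp T n x) := by
      intro n
      filter_upwards [(measurePreserving_tp hT n).quasiMeasurePreserving.ae hinv₀] with x hx
      rw [add_comm, tp_add, tp_one]; exact hx
    induction n using Int.induction_on with
    | zero => simp
    | succ n ih =>
      filter_upwards [ih, hstep n] with x h1 h2
      rw [h2, h1]
    | pred n ih =>
      filter_upwards [ih, hstep (-n - 1)] with x h1 h2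
      rw [← h2, sub_add_cancel, h1]
  set S : Set X := {x | ∀ n : ℤ, ψ₀ (tp T n x) = ψ₀ x} with hS
  have hSm : MeasurableSet S := by
    have : S = ⋂ n : ℤ, {x | ψ₀ (tp T n x) = ψ₀ x} := by ext x; simp [hS]
    rw [this]
    exact MeasurableSet.iInter fun n =>
      measurableSet_eq_fun (hψ₀m.comp (measurable_tp T n)) hψ₀m
  have hSae : ∀ᵐ x ∂μ, x ∈ S := ae_all_iff.2 hall
  have hTS : ∀ x, T x ∈ S ↔ x ∈ S := by
    intro x
    have h1 : ∀ n : ℤ, tp T n (T x) = tp T (n + 1) x := fun n => by rw [tp_add, tp_one]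
    constructor
    · intro h n
      have h2 := h (n - 1)
      have h3 := h (-1)
      rw [h1] at h2 h3
      simp only [sub_add_cancel, neg_add_cancel, tp_zero] at h2 h3
      rw [h2, h3]
    · intro h n
      have h2 := h (n + 1)
      have h3 := h 1
      rw [tp_one] at h3
      rw [h1, h2, h3]
  refine ⟨S.indicator ψ₀, ?_, ?_⟩
  · refine Measurable.stronglyMeasurable ?_
    refine MeasurableSpace.measurable_invariants_dom.2 ⟨hψ₀m.indicator hSm, fun s _ => ?_⟩
    have : S.indicator ψ₀ ∘ T = S.indicator ψ₀ := by
      ext x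
      by_cases hx : x ∈ S
      · have h1 := (hTS x).2 hx
        have h2 := hx 1
        rw [tp_one] at h2
        simp only [Function.comp_apply, Set.indicator_of_mem hx, Set.indicator_of_mem h1, h2]
      · have h1 : T x ∉ S := fun h => hx ((hTS x).1 h)
        simp only [Function.comp_apply, Set.indicator_of_notMem hx, Set.indicator_of_notMem h1]
    rw [this]
  · filter_upwards [hψ₀, hSae] with x h1 h2
    rw [Set.indicator_of_mem h2, h1]

lemma norm_sq_Lp (y : Lp ℂ 2 μ) : ‖y‖ ^ 2 = ∫ x, ‖y x‖ ^ 2 ∂μ := by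
  have h1 := inner_self_eq_norm_sq (𝕜 := ℂ) y
  rw [← h1, L2.inner_def]
  have h2 : ∀ x, inner ℂ (y x) (y x) = ((‖y x‖ ^ 2 : ℝ) : ℂ) := fun x => by
    rw [inner_self_eq_norm_sq_to_K]; simp
  simp only [h2]
  rw [integral_complex_ofReal]
  simp

lemma norm_sq_toLp {A : X → ℂ} (hA : MemLp A 2 μ) :
    ‖hA.toLp A‖ ^ 2 = (∫ x, A x * (starRingEnd ℂ) (A x) ∂μ).re := by
  have h1 := inner_self_eq_norm_sq (𝕜 := ℂ) (hA.toLp A)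
  rw [← h1, inner_toLp]
  simp only [mul_comm]
  rfl

lemma toLp_sum {f : ℕ → X → ℂ} (hf : ∀ i, MemLp (f i) 2 μ) (n : ℕ) :
    (memLp_finsetSum (Finset.range n) fun i _ => hf i).toLp _ =
      ∑ i ∈ Finset.range n, (hf i).toLp (f i) := by
  induction n with
  | zero =>
    simp only [Finset.range_zero, Finset.sum_empty]
    exact MemLp.toLp_zero _
  | succ n ih =>
    rw [Finset.sum_range_succ, ← ih, ← MemLp.toLp_add]
    congr 1
    ext x
    simp [Finset.sum_range_succ]

variable [IsProbabilityMeasure μ]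

/-- The mean ergodic theorem, as an upper bound for the norms of ergodic averages by the norm of
the conditional expectation on the invariant sets. -/
lemma eventually_norm_ergodic_avg_le (hT : MeasurePreserving T μ μ) {B : ℝ} {g : X → ℂ}
    (hg : Bdd μ B g) {ε : ℝ} (hε : 0 < ε) : ∀ᶠ K : ℕ in atTop,
      (∫ x, (FinMean.initial K).E (fun i => g (tp T i x)) *
        (starRingEnd ℂ) ((FinMean.initial K).E fun i => g (tp T i x)) ∂μ).re ≤
          hkPow μ T 0 g + ε := by
  set U : Lp ℂ 2 μ →L[ℂ] Lp ℂ 2 μ :=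
    (Lp.compMeasurePreservingₗᵢ ℂ T hT).toContinuousLinearMap with hU
  have hUapp : ∀ y, U y = Lp.compMeasurePreserving T hT y := fun _ => rfl
  set x := (hg.memLp 2).toLp g with hx
  set W := ((U : Lp ℂ 2 μ →ₗ[ℂ] Lp ℂ 2 μ).eqLocus ((1 : Lp ℂ 2 μ →L[ℂ] Lp ℂ 2 μ) : Lp ℂ 2 μ →ₗ[ℂ] Lp ℂ 2 μ)) with hW
  have hlim := ContinuousLinearMap.tendsto_birkhoffAverage_orthogonalProjection U
    (LinearIsometry.norm_toContinuousLinearMap_le _) x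
  set P := W.orthogonalProjectionOnto x with hP
  set Q := condExpL2 ℂ ℂ (μ := μ) (MeasurableSpace.invariants_le T) x with hQ
  -- the projection to the invariant functions is dominated by the conditional expectation
  have hPmem : (P : Lp ℂ 2 μ) ∈ lpMeas ℂ ℂ (MeasurableSpace.invariants T) 2 μ := by
    rw [mem_lpMeas_iff_aestronglyMeasurable]
    refine aestronglyMeasurable_invariants hT (Lp.aestronglyMeasurable _) ?_
    have h1 : U P = P := LinearMap.mem_eqLocus.1 P.2
    have h2 := Lp.coeFn_compMeasurePreserving (P : Lp ℂ 2 μ) hT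
    rw [← hUapp, h1] at h2
    exact h2.symm
  have hPQ : ‖(P : Lp ℂ 2 μ)‖ ≤ ‖(Q : Lp ℂ 2 μ)‖ := by
    have : Fact (MeasurableSpace.invariants T ≤ ‹MeasurableSpace X›) :=
      ⟨MeasurableSpace.invariants_le T⟩
    have h1 : inner ℂ (P : Lp ℂ 2 μ) (P : Lp ℂ 2 μ) = inner ℂ x (P : Lp ℂ 2 μ) :=
      Submodule.inner_orthogonalProjectionOnto_eq_of_mem_right P x
    have h2 : inner ℂ (Q : Lp ℂ 2 μ) (P : Lp ℂ 2 μ) = inner ℂ x (P : Lp ℂ 2 μ) :=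
      Submodule.inner_orthogonalProjectionOnto_eq_of_mem_right
        (K := lpMeas ℂ ℂ (MeasurableSpace.invariants T) 2 μ) ⟨P, hPmem⟩ x
    have h3 : ‖(P : Lp ℂ 2 μ)‖ ^ 2 ≤ ‖(Q : Lp ℂ 2 μ)‖ * ‖(P : Lp ℂ 2 μ)‖ := by
      rw [← inner_self_eq_norm_sq (𝕜 := ℂ), h1, ← h2]
      exact (RCLike.re_le_norm _).trans (norm_inner_le_norm _ _)
    rcases (norm_nonneg (P : Lp ℂ 2 μ)).eq_or_lt with h | h
    · rw [← h]; exact norm_nonneg _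
    · nlinarith
  have hQhk : ‖(Q : Lp ℂ 2 μ)‖ ^ 2 = hkPow μ T 0 g := by
    rw [norm_sq_Lp, hkPow]
    refine integral_congr_ae ?_
    filter_upwards [(hg.memLp 2).condExpL2_ae_eq_condExp (𝕜 := ℂ)
      (MeasurableSpace.invariants_le T)] with y hy
    rw [hQ, hx, hy]
  have hnorm : Tendsto (fun N => ‖birkhoffAverage ℂ U id (N + 1) x‖ ^ 2) atTop
      (𝓝 (‖(P : Lp ℂ 2 μ)‖ ^ 2)) := ((hlim.comp (tendsto_add_atTop_nat 1)).norm).pow 2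
  have hlt : ‖(P : Lp ℂ 2 μ)‖ ^ 2 < hkPow μ T 0 g + ε := by
    rw [← hQhk]
    have := pow_le_pow_left₀ (norm_nonneg _) hPQ 2
    linarith
  filter_upwards [hnorm.eventually_le_const hlt] with K hK
  have hb : ∀ i : ℤ, Bdd μ B fun x => g (tp T i x) := fun i => hg.comp_tp hT i
  have hiter : ∀ i : ℕ, U^[i] x = ((hb i).memLp 2).toLp _ := by
    intro i
    induction i with
    | zero =>
      simp only [Function.iterate_zero, id_eq, hx]
      congr 1
    | succ i ih =>
      rw [Function.iterate_succ_apply', ih, hUapp, Lp.toLp_compMeasurePreserving]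
      congr 1
  have hA := Bdd.E (FinMean.initial K) hb
  refine le_trans (le_of_eq ?_) hK
  rw [← norm_sq_toLp (hA.memLp 2)]
  congr 2
  rw [birkhoffAverage, birkhoffSum]
  simp only [hiter, id_eq]
  rw [← toLp_sum (fun i => (hb (i : ℤ)).memLp 2) (K + 1), ← MemLp.toLp_const_smul]
  congr 1
  ext z
  rw [FinMean.E_initial]
  simp only [Pi.smul_apply, smul_eq_mul, Complex.real_smul]
  push_cast
  rfl

end MeanErgodic

/-! ### Host–Kra seminorms control averages over cubes -/

section HostKra

lemma Bdd.condExp {X : Type*} {m : MeasurableSpace X} [m₀ : MeasurableSpace X] {μ : Measure X}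
    [IsProbabilityMeasure μ] (hm : m ≤ m₀) {B : ℝ} {f : X → ℂ}
    (hf : Bdd μ B f) : Bdd μ B (μ[f | m]) := by
  refine ⟨(stronglyMeasurable_condExp.mono hm).aestronglyMeasurable, ?_⟩
  have h1 : eLpNorm (μ[f | m]) ∞ μ ≤ ENNReal.ofReal B := by
    refine (eLpNorm_condExp_le_eLpNorm f le_top).trans ?_
    simpa using eLpNorm_le_of_ae_bound (p := ∞) hf.2
  rw [eLpNorm_exponent_top] at h1
  filter_upwards [ae_le_eLpNormEssSup (f := μ[f | m]) (μ := μ)] with x hx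
  have h2 := hx.trans h1
  rw [← ofReal_norm] at h2
  exact (ENNReal.ofReal_le_ofReal_iff hf.nonneg).1 h2

variable {X : Type*} [MeasurableSpace X] {μ : Measure X} {T : X ≃ᵐ X}

lemma Bdd.deriv (hT : MeasurePreserving T μ μ) {B : ℝ} {f : X → ℂ} (hf : Bdd μ B f) (n : ℕ) :
    Bdd μ (B ^ 2) fun x => (starRingEnd ℂ) (f x) * f (T^[n] x) := by
  have := hf.conj.mul (hf.comp_tp hT n)
  simp only [tp_natCast] at this
  rwa [← sq] at this

variable [IsProbabilityMeasure μ]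

lemma avg_mem_Icc {u : ℕ → ℝ} {b : ℝ} (hb : 0 ≤ b) (hu : ∀ n, u n ∈ Set.Icc 0 b) (N : ℕ) :
    (N : ℝ)⁻¹ * ∑ n ∈ Finset.Icc 1 N, u n ∈ Set.Icc 0 b := by
  refine ⟨mul_nonneg (by positivity) (Finset.sum_nonneg fun n _ => (hu n).1), ?_⟩
  rcases Nat.eq_zero_or_pos N with rfl | hN
  · simpa using hb
  · have hN' : (0 : ℝ) < N := by exact_mod_cast hN
    have h1 : ∑ n ∈ Finset.Icc 1 N, u n ≤ N * b := by
      simpa using Finset.sum_le_card_nsmul (Finset.Icc 1 N) u b fun n _ => (hu n).2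
    calc _ ≤ (N : ℝ)⁻¹ * (N * b) := mul_le_mul_of_nonneg_left h1 (by positivity)
      _ = b := by rw [← mul_assoc, inv_mul_cancel₀ hN'.ne', one_mul]

/-- The averages defining the seminorms are bounded, so their upper limit is not a junk value. -/
lemma hkPow_mem_Icc (hT : MeasurePreserving T μ μ) (k : ℕ) {B : ℝ} {f : X → ℂ}
    (hf : Bdd μ B f) : hkPow μ T k f ∈ Set.Icc 0 (B ^ 2 ^ (k + 1)) := by
  induction k generalizing B f with
  | zero =>
    refine ⟨integral_nonneg fun x => by positivity, ?_⟩
    have h1 := (hf.condExp (MeasurableSpace.invariants_le T)).2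
    have h2 : ∀ᵐ x ∂μ, ‖‖(μ[f | MeasurableSpace.invariants T]) x‖ ^ 2‖ ≤ B ^ 2 := by
      filter_upwards [h1] with x hx
      rw [Real.norm_of_nonneg (by positivity)]
      exact pow_le_pow_left₀ (norm_nonneg _) hx 2
    have h3 := norm_integral_le_of_norm_le_const h2
    rw [probReal_univ, mul_one] at h3
    simpa [hkPow] using (le_abs_self _).trans h3
  | succ k ih =>
    have h1 : ∀ n : ℕ, hkPow μ T k (fun x => (starRingEnd ℂ) (f x) * f (T^[n] x)) ∈
        Set.Icc 0 (B ^ 2 ^ (k + 1 + 1)) := by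
      intro n
      have := ih (hf.deriv hT n)
      rwa [← pow_mul, ← pow_succ'] at this
    have h2 := avg_mem_Icc (pow_nonneg hf.nonneg _) h1
    have hbdd : IsBoundedUnder (· ≤ ·) atTop fun N : ℕ => (N : ℝ)⁻¹ * ∑ n ∈ Finset.Icc 1 N,
        hkPow μ T k (fun x => (starRingEnd ℂ) (f x) * f (T^[n] x)) :=
      isBoundedUnder_of ⟨_, fun N => (h2 N).2⟩
    have hbdd' : IsBoundedUnder (· ≥ ·) atTop fun N : ℕ => (N : ℝ)⁻¹ * ∑ n ∈ Finset.Icc 1 N,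
        hkPow μ T k (fun x => (starRingEnd ℂ) (f x) * f (T^[n] x)) :=
      isBoundedUnder_of ⟨_, fun N => (h2 N).1⟩
    exact ⟨le_limsup_of_frequently_le (Frequently.of_forall fun N => (h2 N).1) hbdd,
      limsup_le_of_le hbdd'.isCoboundedUnder_le (Eventually.of_forall fun N => (h2 N).2)⟩

lemma eventually_avg_hkPow_le (hT : MeasurePreserving T μ μ) (k : ℕ) {B : ℝ} {f : X → ℂ}
    (hf : Bdd μ B f) {ε : ℝ} (hε : 0 < ε) : ∀ᶠ N : ℕ in atTop,
      (N : ℝ)⁻¹ * ∑ n ∈ Finset.Icc 1 N,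
        hkPow μ T k (fun x => (starRingEnd ℂ) (f x) * f (T^[n] x)) ≤ hkPow μ T (k + 1) f + ε := by
  have h1 := avg_mem_Icc (pow_nonneg (sq_nonneg B) (2 ^ (k + 1)))
    fun n => hkPow_mem_Icc hT k (hf.deriv hT n)
  have h2 : limsup (fun N : ℕ => (N : ℝ)⁻¹ * ∑ n ∈ Finset.Icc 1 N,
      hkPow μ T k (fun x => (starRingEnd ℂ) (f x) * f (T^[n] x))) atTop <
        hkPow μ T (k + 1) f + ε := by
    change hkPow μ T (k + 1) f < _
    linarith
  filter_upwards [eventually_lt_of_limsup_lt h2 (isBoundedUnder_of ⟨_, fun N => (h1 N).2⟩)]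
    with N hN
  exact hN.le

/-- The image of a finite mean under a map. -/
def FinMean.map {G H : Type} (ν : FinMean G) (f : G → H) : FinMean H where
  ι := ν.ι
  pt i := f (ν.pt i)

lemma FinMean.E_map {G H : Type} {V : Type*} [AddCommGroup V] [Module ℝ V] (ν : FinMean G)
    (f : G → H) (u : H → V) : (ν.map f).E u = ν.E fun h => u (f h) := rfl

lemma cube_zero (G : (Fin 0 → Bool) → X → ℂ) (h : Fin 0 → ℤ) (x : X) :
    cube T G h x = G (fun _ => false) x := by
  rw [cube, Fintype.prod_subsingleton _ fun _ => false, dot_false, tp_zero]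

lemma sum_dist_le {Y : ℕ → ℝ} (hY : ∀ d, 0 ≤ Y d) (K n : ℕ) (hn : n ∈ Finset.range (K + 1)) :
    ∑ n' ∈ Finset.range (K + 1), Y ((n : ℤ) - n').natAbs ≤
      2 * ∑ d ∈ Finset.range (K + 1), Y d := by
  have hmaps : ∀ n' ∈ Finset.range (K + 1), ((n : ℤ) - n').natAbs ∈ Finset.range (K + 1) := by
    intro n' hn'
    rw [Finset.mem_range] at hn hn' ⊢
    omega
  rw [← Finset.sum_fiberwise_of_maps_to hmaps, Finset.mul_sum]
  refine Finset.sum_le_sum fun d _ => ?_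
  have h1 : ∀ n' ∈ (Finset.range (K + 1)).filter (fun n' : ℕ => ((n : ℤ) - n').natAbs = d),
      Y ((n : ℤ) - n').natAbs = Y d := fun n' hn' => by rw [(Finset.mem_filter.1 hn').2]
  rw [Finset.sum_congr rfl h1, Finset.sum_const, nsmul_eq_mul]
  refine mul_le_mul_of_nonneg_right ?_ (hY d)
  have h2 : (Finset.range (K + 1)).filter (fun n' : ℕ => ((n : ℤ) - n').natAbs = d) ⊆
      {n - d, n + d} := by
    intro n' hn'
    have := (Finset.mem_filter.1 hn').2
    simp only [Finset.mem_insert, Finset.mem_singleton]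
    omega
  exact_mod_cast (Finset.card_le_card h2).trans Finset.card_le_two

/-- The Cauchy–Schwarz step in the last direction of the cube: a cube average of `g` is controlled
by averages over lower-dimensional cubes of the multiplicative derivatives of `g`. -/
lemma norm_E_cube_sq_le (hT : MeasurePreserving T μ μ) {k : ℕ} (ν : FinMean (Fin k → ℤ)) (K : ℕ)
    {B : ℝ} {g : X → ℂ} (hg : Bdd μ B g) {G : (Fin (k + 1) → Bool) → X → ℂ}
    (hG : CubeFamily μ G) :
    ∃ G' : ℕ → (Fin k → Bool) → X → ℂ, (∀ d, CubeFamily μ (G' d)) ∧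
      ‖(FinMean.cons ((FinMean.initial K).map Neg.neg) ν).E
          (fun h => ∫ x, g x * cube T G h x ∂μ)‖ ^ 2 ≤
        (FinMean.initial K).E fun n => (FinMean.initial K).E fun n' =>
          ‖ν.E fun h => ∫ x, ((starRingEnd ℂ) (g x) * g (T^[(n - n').natAbs] x)) *
            cube T (G' (n - n').natAbs) h x ∂μ‖ := by
  set G₀ : (Fin k → Bool) → X → ℂ := fun ω => G (Fin.cons false ω) with hG₀
  set G₁ : (Fin k → Bool) → X → ℂ := fun ω => G (Fin.cons true ω) with hG₁
  have hG₀f : CubeFamily μ G₀ := by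
    refine ⟨fun ω => hG.1 _, fun x => ?_⟩
    have : (Fin.cons false (fun _ => false) : Fin (k + 1) → Bool) = fun _ => false := by
      ext i; refine Fin.cases ?_ (fun i => ?_) i <;> simp
    simp only [hG₀, this, hG.2]
  set P : (Fin k → ℤ) → X → ℂ := fun h x => g x * cube T G₀ h x with hP
  have hPb : ∀ h, Bdd μ B (P h) := fun h => by
    simpa using hg.mul (Bdd.cube hT hG₀f.1 h)
  have hQb : ∀ h, Bdd μ 1 (cube T G₁ h) := fun h => Bdd.cube hT (fun ω => hG.1 _) h
  set G' : ℕ → (Fin k → Bool) → X → ℂ := fun d ω z =>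
    (starRingEnd ℂ) (G₀ ω z) * G₀ ω (tp T d z) with hG'
  refine ⟨G', fun d => hG₀f.conj.mul (hG₀f.comp_tp hT fun _ => d), ?_⟩
  set I := FinMean.initial K
  have hPn : ∀ h (n : ℤ), Bdd μ B fun x => P h (tp T n x) := fun h n => (hPb h).comp_tp hT n
  -- move the average in the last direction to the factor `P`
  have h1 : (FinMean.cons (I.map Neg.neg) ν).E (fun h => ∫ x, g x * cube T G h x ∂μ) =
      ν.E fun h => ∫ x, cube T G₁ h x * I.E (fun n => P h (tp T n x)) ∂μ := by
    rw [FinMean.E_cons, FinMean.E_comm]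
    congr 1
    ext h
    rw [FinMean.E_map]
    have h2 : ∀ x, cube T G₁ h x * I.E (fun n => P h (tp T n x)) =
        I.E fun n => cube T G₁ h x * P h (tp T n x) := fun x => (I.E_mul_left _ _).symm
    simp only [h2]
    rw [← FinMean.E_integral _ fun n => ((hQb h).mul (hPn h n)).integrable]
    congr 1
    ext n
    rw [← integral_tp hT n]
    refine integral_congr_ae (Eventually.of_forall fun x => ?_)
    simp only [cube_cons, ← tp_add, neg_add_cancel, tp_zero, hP]
    ring
  have h3 : ∀ h, ‖∫ x, cube T G₁ h x * I.E (fun n => P h (tp T n x)) ∂μ‖ ^ 2 ≤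
      (I.E fun n => I.E fun n' =>
        ∫ x, P h (tp T n x) * (starRingEnd ℂ) (P h (tp T n' x)) ∂μ).re := by
    intro h
    rw [← integral_E_mul_conj I (hPn h)]
    exact norm_integral_mul_sq_le (Bdd.E I (hPn h)) (hQb h)
  -- the correlations only depend on the distance of `n` and `n'`
  have h4 : ∀ n n' : ℤ, ‖ν.E fun h => ∫ x, P h (tp T n x) * (starRingEnd ℂ) (P h (tp T n' x)) ∂μ‖ =
      ‖ν.E fun h => ∫ x, ((starRingEnd ℂ) (g x) * g (T^[(n - n').natAbs] x)) *
            cube T (G' (n - n').natAbs) h x ∂μ‖ := by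
    have h5 : ∀ (d : ℕ) (m : ℤ) (h : Fin k → ℤ),
        ∫ x, P h (tp T (m + d) x) * (starRingEnd ℂ) (P h (tp T m x)) ∂μ =
        ∫ x, ((starRingEnd ℂ) (g x) * g (T^[d] x)) * cube T (G' d) h x ∂μ := by
      intro d m h
      rw [← integral_tp hT m fun x => ((starRingEnd ℂ) (g x) * g (T^[d] x)) * cube T (G' d) h x]
      refine integral_congr_ae (Eventually.of_forall fun x => ?_)
      simp only [hG', cube_mul, cube_conj, cube_tp, hP, ← tp_natCast, ← tp_add, map_mul,
        add_comm (d : ℤ)]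
      ring
    intro n n'
    rcases le_total n' n with hle | hle
    · have h6 : n = n' + ((n - n').natAbs : ℤ) := by omega
      have h7 := h5 (n - n').natAbs n'
      rw [← h6] at h7
      simp only [h7]
    · have h6 : n' = n + ((n - n').natAbs : ℤ) := by omega
      have h7 := h5 (n - n').natAbs n
      rw [← h6] at h7
      simp only [← h7]
      rw [← RCLike.norm_conj]
      congr 1
      simp only [FinMean.E, Complex.real_smul, map_mul, map_sum, ← integral_conj,
        Complex.conj_conj, Complex.conj_ofReal, mul_comm (starRingEnd ℂ _)]
  calc _ ≤ (ν.E fun h => ‖∫ x, cube T G₁ h x * I.E (fun n => P h (tp T n x)) ∂μ‖) ^ 2 := by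
        rw [h1]
        exact pow_le_pow_left₀ (norm_nonneg _) (ν.norm_E_le_E_norm _) 2
    _ ≤ ν.E fun h => ‖∫ x, cube T G₁ h x * I.E (fun n => P h (tp T n x)) ∂μ‖ ^ 2 :=
        ν.E_pow_le (fun _ => norm_nonneg _) 2
    _ ≤ ν.E fun h => (I.E fun n => I.E fun n' =>
        ∫ x, P h (tp T n x) * (starRingEnd ℂ) (P h (tp T n' x)) ∂μ).re := ν.E_mono h3
    _ = (I.E fun n => I.E fun n' => ν.E fun h =>
        ∫ x, P h (tp T n x) * (starRingEnd ℂ) (P h (tp T n' x)) ∂μ).re := by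
        rw [← FinMean.E_re, FinMean.E_comm]
        congr 2
        ext n
        rw [FinMean.E_comm]
    _ ≤ I.E fun n => I.E fun n' => ‖ν.E fun h =>
        ∫ x, P h (tp T n x) * (starRingEnd ℂ) (P h (tp T n' x)) ∂μ‖ := by
        refine (Complex.re_le_norm _).trans ((I.norm_E_le_E_norm _).trans (I.E_mono fun n => ?_))
        exact I.norm_E_le_E_norm _
    _ = _ := by simp only [h4]

/-- The averages over `(k + 1)`-dimensional cubes of a function with vanishing Host–Kra seminorm can
be made small uniformly in the functions on the other vertices. The statement is about finite
families of functions, with one mean for all members, for the sake of the induction on `k`. -/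
lemma exists_finMean_cube (hT : MeasurePreserving T μ μ) (k : ℕ) :
    ∃ C : ℝ, 0 ≤ C ∧ ∀ (κ : Type) [Fintype κ] (B : ℝ) (g : κ → X → ℂ), (∀ j, Bdd μ B (g j)) →
      ∀ ε > 0, ∃ ν : FinMean (Fin (k + 1) → ℤ), ∀ j, ∀ G : (Fin (k + 1) → Bool) → X → ℂ,
        CubeFamily μ G → ‖ν.E fun h => ∫ x, g j x * cube T G h x ∂μ‖ ^ 2 ^ (k + 1) ≤
          C * hkPow μ T k (g j) + ε := by
  induction k with
  | zero =>
    refine ⟨1, zero_le_one, fun κ _ B g hg ε hε => ?_⟩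
    obtain ⟨K, hK⟩ := (eventually_all.2 fun j =>
      eventually_norm_ergodic_avg_le hT (hg j) hε).exists
    refine ⟨FinMean.cons ((FinMean.initial K).map Neg.neg) (FinMean.dirac 0), fun j G hG => ?_⟩
    rw [one_mul]
    refine le_trans ?_ (hK j)
    have h1 : ∀ n : ℤ, (FinMean.dirac (0 : Fin 0 → ℤ)).E (fun h =>
        ∫ x, g j x * cube T G (Fin.cons (-n) h) x ∂μ) =
        ∫ x, G (Fin.cons true fun _ => false) x * g j (tp T n x) ∂μ := by
      intro n
      have h2 : (Fin.cons false (fun _ => false) : Fin 1 → Bool) = fun _ => false := by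
        ext i; refine Fin.cases ?_ (fun i => ?_) i <;> simp
      simp only [cube_cons, cube_zero, h2, hG.2, one_mul]
      rw [FinMean.E_const, ← integral_tp hT n]
      simp only [← tp_add, neg_add_cancel, tp_zero, mul_comm]
    rw [FinMean.E_cons, FinMean.E_map]
    simp only [h1]
    have hb : ∀ n : ℤ, Bdd μ B fun x => g j (tp T n x) := fun n => (hg j).comp_tp hT n
    have h3 : (FinMean.initial K).E (fun n =>
        ∫ x, G (Fin.cons true fun _ => false) x * g j (tp T n x) ∂μ) =
        ∫ x, G (Fin.cons true fun _ => false) x *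
          (FinMean.initial K).E (fun n => g j (tp T n x)) ∂μ := by
      rw [FinMean.E_integral _ fun n => ((hG.1 _).mul (hb n)).integrable]
      simp only [FinMean.E_mul_left]
    rw [h3]
    exact norm_integral_mul_sq_le (Bdd.E _ hb) (hG.1 _)
  | succ k ih =>
    obtain ⟨C, hC, ih⟩ := ih
    refine ⟨2 * C, by positivity, fun κ _ B g hg ε hε => ?_⟩
    rcases isEmpty_or_nonempty κ with hκ | ⟨⟨j₀⟩⟩
    · exact ⟨FinMean.dirac 0, fun j => hκ.elim j⟩
    have hB := (hg j₀).nonneg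
    set q := 2 ^ (k + 1) with hq
    set δ := ε / (2 * (2 * C + 2)) with hδ
    have hδ0 : 0 < δ := by positivity
    -- the number of differences, large enough for the averages of the seminorms to be close to
    -- their upper limit and for the diagonal to be negligible
    have hdiag : ∀ᶠ K : ℕ in atTop, 2 * (B ^ 2) ^ q * ((K : ℝ) + 1)⁻¹ ≤ ε / 2 := by
      have h1 : Tendsto (fun K : ℕ => 2 * (B ^ 2) ^ q * ((K : ℝ) + 1)⁻¹) atTop
          (𝓝 (2 * (B ^ 2) ^ q * 0)) :=
        (tendsto_inv_atTop_zero.comp (tendsto_atTop_add_const_right _ _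
          tendsto_natCast_atTop_atTop)).const_mul _
      rw [mul_zero] at h1
      exact h1.eventually_le_const (by positivity)
    obtain ⟨K, ⟨hK1, hK2⟩, hK3⟩ := (((eventually_all.2 fun j =>
      eventually_avg_hkPow_le hT k (hg j) hδ0).and hdiag).and (eventually_ge_atTop 1)).exists
    have hK0 : (0 : ℝ) < K := by exact_mod_cast hK3
    set D : κ → ℕ → X → ℂ := fun j d x => (starRingEnd ℂ) (g j x) * g j (T^[d] x) with hD
    have hDb : ∀ j d, Bdd μ (B ^ 2) (D j d) := fun j d => (hg j).deriv hT d
    obtain ⟨ν, hν⟩ := ih (κ × Fin (K + 1)) (B ^ 2) (fun t => D t.1 t.2) (fun t => hDb _ _) δ hδ0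
    refine ⟨FinMean.cons ((FinMean.initial K).map Neg.neg) ν, fun j G hG => ?_⟩
    obtain ⟨G', hG', hle⟩ := norm_E_cube_sq_le hT ν K (hg j) hG
    set z : ℕ → ℝ := fun d => ‖ν.E fun h => ∫ x, D j d x * cube T (G' d) h x ∂μ‖ with hz
    have hz0 : ∀ d, 0 ≤ z d := fun d => norm_nonneg _
    have hzd : ∀ d ∈ Finset.Icc 1 K, z d ^ q ≤ C * hkPow μ T k (D j d) + δ := by
      intro d hd
      exact hν (j, ⟨d, by rw [Finset.mem_Icc] at hd; omega⟩) (G' d) (hG' d)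
    have hz00 : z 0 ^ q ≤ (B ^ 2) ^ q := by
      refine pow_le_pow_left₀ (hz0 0) (ν.norm_E_le fun h => ?_) q
      have := ((hDb j 0).mul (Bdd.cube hT (hG' 0).1 h)).norm_integral_le
      rwa [mul_one] at this
    have hsum : ∑ d ∈ Finset.range (K + 1), z d ^ q ≤
        (B ^ 2) ^ q + (C * (K * (hkPow μ T (k + 1) (g j) + δ)) + K * δ) := by
      have h1 : Finset.range (K + 1) = insert 0 (Finset.Icc 1 K) := by
        ext d; simp only [Finset.mem_range, Finset.mem_insert, Finset.mem_Icc]; omega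
      rw [h1, Finset.sum_insert (by simp)]
      refine add_le_add hz00 ((Finset.sum_le_sum hzd).trans ?_)
      rw [Finset.sum_add_distrib, ← Finset.mul_sum, Finset.sum_const, Nat.card_Icc,
        Nat.add_sub_cancel, nsmul_eq_mul]
      refine add_le_add (mul_le_mul_of_nonneg_left ?_ hC) le_rfl
      have h2 := hK1 j
      rwa [inv_mul_le_iff₀ hK0] at h2
    have havg : (FinMean.initial K).E (fun n => (FinMean.initial K).E fun n' =>
        z (n - n').natAbs ^ q) ≤ ((K : ℝ) + 1)⁻¹ * (2 * ∑ d ∈ Finset.range (K + 1), z d ^ q) := by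
      rw [FinMean.E_initial, smul_eq_mul]
      refine mul_le_mul_of_nonneg_left ?_ (by positivity)
      have h1 : ∀ n ∈ Finset.range (K + 1), (FinMean.initial K).E (fun n' =>
          z ((n : ℤ) - n').natAbs ^ q) ≤
          ((K : ℝ) + 1)⁻¹ * (2 * ∑ d ∈ Finset.range (K + 1), z d ^ q) := by
        intro n hn
        rw [FinMean.E_initial, smul_eq_mul]
        exact mul_le_mul_of_nonneg_left
          (sum_dist_le (Y := fun d => z d ^ q) (fun d => pow_nonneg (hz0 d) q) K n hn)
          (by positivity)
      refine (Finset.sum_le_card_nsmul _ _ _ h1).trans (le_of_eq ?_)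
      rw [Finset.card_range, nsmul_eq_mul, ← mul_assoc]
      push_cast
      rw [mul_inv_cancel₀ (by positivity), one_mul]
    have hk0 := (hkPow_mem_Icc hT (k + 1) (hg j)).1
    calc _ = (‖(FinMean.cons ((FinMean.initial K).map Neg.neg) ν).E
          (fun h => ∫ x, g j x * cube T G h x ∂μ)‖ ^ 2) ^ q := by rw [← pow_mul, hq, ← pow_succ']
      _ ≤ ((FinMean.initial K).E fun n => (FinMean.initial K).E fun n' =>
          z (n - n').natAbs) ^ q := pow_le_pow_left₀ (sq_nonneg _) hle q
      _ ≤ (FinMean.initial K).E fun n => ((FinMean.initial K).E fun n' =>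
          z (n - n').natAbs) ^ q :=
          FinMean.E_pow_le _ (fun n => FinMean.E_nonneg _ fun n' => hz0 _) q
      _ ≤ (FinMean.initial K).E fun n => (FinMean.initial K).E fun n' =>
          z (n - n').natAbs ^ q :=
          FinMean.E_mono _ fun n => FinMean.E_pow_le _ (fun n' => hz0 _) q
      _ ≤ ((K : ℝ) + 1)⁻¹ * (2 * ((B ^ 2) ^ q +
          (C * (K * (hkPow μ T (k + 1) (g j) + δ)) + K * δ))) := by
          refine havg.trans (mul_le_mul_of_nonneg_left ?_ (by positivity))
          linarith
      _ = 2 * (B ^ 2) ^ q * ((K : ℝ) + 1)⁻¹ + (((K : ℝ) + 1)⁻¹ * K) *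
          (2 * C * hkPow μ T (k + 1) (g j) + (2 * C + 2) * δ) := by ring
      _ ≤ ε / 2 + 1 * (2 * C * hkPow μ T (k + 1) (g j) + (2 * C + 2) * δ) := by
          refine add_le_add hK2 (mul_le_mul_of_nonneg_right ?_ (by positivity))
          rw [inv_mul_le_iff₀ (by positivity)]
          linarith
      _ = _ := by
          rw [hδ]
          field_simp
          ring

/-- If the Host–Kra seminorm of `g` vanishes, then the averages of `g` over `(k + 1)`-dimensional
cubes can be made small uniformly in the functions on the other vertices. -/
lemma exists_finMean_of_hkSeminorm_eq_zero (hT : MeasurePreserving T μ μ) {k : ℕ} {B : ℝ}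
    {g : X → ℂ} (hg : Bdd μ B g) (h0 : hkSeminorm μ T k g = 0) {ε : ℝ} (hε : 0 < ε) :
    ∃ ν : FinMean (Fin (k + 1) → ℤ), ∀ G : (Fin (k + 1) → Bool) → X → ℂ, CubeFamily μ G →
      ‖ν.E fun h => ∫ x, g x * cube T G h x ∂μ‖ ≤ ε := by
  have h1 : hkPow μ T k g = 0 :=
    ((Real.rpow_eq_zero_iff_of_nonneg (hkPow_mem_Icc hT k hg).1).1 h0).1
  obtain ⟨C, -, hC⟩ := exists_finMean_cube (μ := μ) hT k
  obtain ⟨ν, hν⟩ := hC Unit B (fun _ => g) (fun _ => hg) (ε ^ 2 ^ (k + 1)) (by positivity)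
  refine ⟨ν, fun G hG => ?_⟩
  have h2 := hν () G hG
  rw [h1, mul_zero, zero_add] at h2
  exact (pow_le_pow_iff_left₀ (norm_nonneg _) hε.le (by positivity)).1 h2

end HostKra

/-! ### Functions detected by vanishing moments -/

section Moments

variable {X : Type*} [MeasurableSpace X] {μ : Measure X} [IsProbabilityMeasure μ]

lemma integral_mul_comp_eq_zero {B : ℝ} {g : X → ℂ} (hg : Bdd μ B g) {ρ : X → ℝ}
    (hρ : Measurable ρ) (hρ1 : ∀ᵐ x ∂μ, |ρ x| ≤ 1)
    (hmom : ∀ m : ℕ, ∫ x, g x * (ρ x : ℂ) ^ m ∂μ = 0) {u : ℝ → ℝ} (hu : Continuous u) :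
    ∫ x, g x * (u (ρ x) : ℂ) ∂μ = 0 := by
  have hB := hg.nonneg
  have hpow : ∀ m : ℕ, Integrable (fun x => g x * (ρ x : ℂ) ^ m) μ := fun m => by
    refine (hg.mul (C := 1) ⟨?_, ?_⟩).integrable
    · exact ((Complex.measurable_ofReal.comp hρ).pow_const m).aestronglyMeasurable
    · filter_upwards [hρ1] with x hx
      rw [norm_pow, Complex.norm_real]
      exact pow_le_one₀ (norm_nonneg _) hx
  have hpoly : ∀ p : ℝ[X], Integrable (fun x => g x * ((p.eval (ρ x) : ℝ) : ℂ)) μ ∧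
      ∫ x, g x * ((p.eval (ρ x) : ℝ) : ℂ) ∂μ = 0 := by
    intro p
    have h1 : ∀ x, g x * ((p.eval (ρ x) : ℝ) : ℂ) =
        ∑ i ∈ Finset.range (p.natDegree + 1), (p.coeff i : ℂ) * (g x * (ρ x : ℂ) ^ i) := by
      intro x
      rw [eval_eq_sum_range]
      push_cast
      rw [Finset.mul_sum]
      exact Finset.sum_congr rfl fun i _ => by ring
    simp only [h1]
    refine ⟨integrable_finsetSum _ fun i _ => (hpow i).const_mul _, ?_⟩
    rw [integral_finsetSum _ fun i _ => (hpow i).const_mul _]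
    refine Finset.sum_eq_zero fun i _ => ?_
    rw [integral_const_mul, hmom, mul_zero]
  have hsmall : ∀ ε > 0, ‖∫ x, g x * (u (ρ x) : ℂ) ∂μ‖ ≤ B * ε := by
    intro ε hε
    obtain ⟨p, hp⟩ := exists_polynomial_near_of_continuousOn (-1) 1 u hu.continuousOn ε hε
    have hb : Bdd μ ε fun x => (u (ρ x) : ℂ) - ((p.eval (ρ x) : ℝ) : ℂ) := by
      refine ⟨((Complex.measurable_ofReal.comp (hu.measurable.comp hρ)).sub
        (Complex.measurable_ofReal.comp (p.continuous.measurable.comp hρ))).aestronglyMeasurable,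
        ?_⟩
      filter_upwards [hρ1] with x hx
      rw [← Complex.ofReal_sub, Complex.norm_real, Real.norm_eq_abs, abs_sub_comm]
      exact (hp _ (abs_le.1 hx)).le
    have h1 := hg.mul hb
    have h2 : ∫ x, g x * (u (ρ x) : ℂ) ∂μ =
        ∫ x, g x * ((u (ρ x) : ℂ) - ((p.eval (ρ x) : ℝ) : ℂ)) ∂μ := by
      have h3 : ∀ x, g x * (u (ρ x) : ℂ) = g x * ((u (ρ x) : ℂ) - ((p.eval (ρ x) : ℝ) : ℂ)) +
          g x * ((p.eval (ρ x) : ℝ) : ℂ) := fun x => by ring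
      simp only [h3]
      rw [integral_add h1.integrable (hpoly p).1, (hpoly p).2, add_zero]
    rw [h2]
    exact h1.norm_integral_le
  rw [← norm_eq_zero]
  have h4 : Tendsto (fun ε : ℝ => B * ε) (𝓝[>] 0) (𝓝 0) := by
    have : Tendsto (fun ε : ℝ => B * ε) (𝓝 0) (𝓝 (B * 0)) := tendsto_id.const_mul B
    rw [mul_zero] at this
    exact this.mono_left nhdsWithin_le_nhds
  exact le_antisymm (ge_of_tendsto h4 (eventually_mem_nhdsWithin.mono fun ε hε => hsmall ε hε))
    (norm_nonneg _)

/-- If `g` is orthogonal to all powers of `ρ`, then it has integral zero over the level sets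
of `ρ`. -/
lemma setIntegral_lt_eq_zero {B : ℝ} {g : X → ℂ} (hg : Bdd μ B g) {ρ : X → ℝ}
    (hρ : Measurable ρ) (hρ1 : ∀ᵐ x ∂μ, |ρ x| ≤ 1)
    (hmom : ∀ m : ℕ, ∫ x, g x * (ρ x : ℂ) ^ m ∂μ = 0) (c : ℝ) :
    ∫ x in {x | c < ρ x}, g x ∂μ = 0 := by
  set u : ℕ → ℝ → ℝ := fun n t => min 1 (max 0 (n * (t - c))) with hu
  have huc : ∀ n, Continuous (u n) := fun n => by fun_prop
  have hu1 : ∀ n t, |u n t| ≤ 1 := fun n t => by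
    rw [abs_of_nonneg (le_min zero_le_one (le_max_left _ _))]
    exact min_le_left _ _
  have hS : MeasurableSet {x | c < ρ x} := measurableSet_lt measurable_const hρ
  have hlim : Tendsto (fun n => ∫ x, g x * (u n (ρ x) : ℂ) ∂μ) atTop
      (𝓝 (∫ x, {x | c < ρ x}.indicator g x ∂μ)) := by
    refine tendsto_integral_of_dominated_convergence (fun _ => B) (fun n => ?_)
      (integrable_const B) (fun n => ?_) (Eventually.of_forall fun x => ?_)
    · exact hg.1.mul (Complex.measurable_ofReal.comp
        ((huc n).measurable.comp hρ)).aestronglyMeasurable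
    · filter_upwards [hg.2] with x hx
      rw [norm_mul, Complex.norm_real]
      exact (mul_le_of_le_one_right (norm_nonneg _) (hu1 n _)).trans hx
    · by_cases hx : c < ρ x
      · rw [Set.indicator_of_mem (show x ∈ {x | c < ρ x} from hx)]
        refine tendsto_const_nhds.congr' ?_
        have h1 : Tendsto (fun n : ℕ => (n : ℝ) * (ρ x - c)) atTop atTop :=
          tendsto_natCast_atTop_atTop.atTop_mul_const (sub_pos.2 hx)
        filter_upwards [h1.eventually_ge_atTop 1] with n hn
        rw [hu]
        simp only
        rw [min_eq_left (hn.trans (le_max_right _ _)), Complex.ofReal_one, mul_one]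
      · rw [Set.indicator_of_notMem (show x ∉ {x | c < ρ x} from hx)]
        refine tendsto_const_nhds.congr fun n => ?_
        rw [hu]
        simp only
        rw [max_eq_left (mul_nonpos_of_nonneg_of_nonpos n.cast_nonneg (by linarith)),
          min_eq_right zero_le_one, Complex.ofReal_zero, mul_zero]
  rw [integral_indicator hS] at hlim
  simp only [integral_mul_comp_eq_zero hg hρ hρ1 hmom (huc _)] at hlim
  exact (tendsto_const_nhds_iff.1 hlim).symm

end Moments

/-! ### Cube averages and the nilfactor -/

section Nilfactor

variable {X : Type*} [MeasurableSpace X] {μ : Measure X} {T : X ≃ᵐ X}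

lemma AsympInv.tendsto_sub {G : Type} [AddCommGroup G] {ν : ℕ → FinMean G} (hν : AsympInv ν)
    (e : G) {B : ℝ} (hB : 0 ≤ B) {u : G → ℂ} (hu : ∀ h, ‖u h‖ ≤ B) :
    Tendsto (fun n => (ν n).E u - (ν n).E fun h => u (e + h)) atTop (𝓝 0) := by
  obtain ⟨δ, hδ, h⟩ := hν e
  have h1 : Tendsto (fun n => (B + 1) * δ n) atTop (𝓝 0) := by
    simpa using hδ.const_mul (B + 1)
  refine squeeze_zero_norm (fun n => ?_) h1
  have hB1 : 0 < B + 1 := by positivity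
  have h2 := h n (fun h => ((B + 1 : ℝ) : ℂ)⁻¹ * u h) fun h => by
    rw [norm_mul, norm_inv, Complex.norm_real, Real.norm_of_nonneg hB1.le,
      inv_mul_le_iff₀ hB1]
    linarith [hu h]
  rw [FinMean.E_mul_left, FinMean.E_mul_left, ← mul_sub, norm_mul, norm_inv, Complex.norm_real,
    Real.norm_of_nonneg hB1.le, inv_mul_le_iff₀ hB1, norm_sub_rev] at h2
  simpa only [add_comm e] using h2

/-- The cube averages of `g · ψ` are dominated by those of `g`, for every mean over which the
latter are taken. -/
def CubeDom (μ : Measure X) (T : X ≃ᵐ X) (k : ℕ) (g ψ : X → ℂ) (C : ℝ) : Prop :=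
  (∃ B, Bdd μ B ψ) ∧ ∀ (ν : FinMean (Fin k → ℤ)) (ε : ℝ),
    (∀ G, CubeFamily μ G → ‖ν.E fun h => ∫ x, g x * cube T G h x ∂μ‖ ≤ ε) →
    ∀ G, CubeFamily μ G → ‖ν.E fun h => ∫ x, g x * ψ x * cube T G h x ∂μ‖ ≤ C * ε

/-- `φ` is a weak limit along the ultrafilter `𝒰` of averages over cubes of the family `F`. -/
def IsCubeLimit (μ : Measure X) (T : X ≃ᵐ X) {k : ℕ} (𝒰 : Ultrafilter ℕ)
    (ν : ℕ → FinMean (Fin k → ℤ)) (F : (Fin k → Bool) → X → ℂ) (φ : X → ℂ) : Prop :=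
  Bdd μ 1 φ ∧ ∀ (B : ℝ) (g : X → ℂ), Bdd μ B g →
    Tendsto (fun n => ∫ x, g x * (ν n).E (fun h => cube T F h x) ∂μ) 𝒰 (𝓝 (∫ x, g x * φ x ∂μ))

lemma IsCubeLimit.conj {k : ℕ} {𝒰 : Ultrafilter ℕ} {ν : ℕ → FinMean (Fin k → ℤ)}
    {F : (Fin k → Bool) → X → ℂ} {φ : X → ℂ} (h : IsCubeLimit μ T 𝒰 ν F φ) :
    IsCubeLimit μ T 𝒰 ν (fun ω z => (starRingEnd ℂ) (F ω z)) fun x => (starRingEnd ℂ) (φ x) := by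
  refine ⟨h.1.conj, fun B g hg => ?_⟩
  have h1 := (Complex.continuous_conj.tendsto _).comp (h.2 B _ hg.conj)
  rw [← integral_conj] at h1
  simp only [map_mul, Complex.conj_conj] at h1
  refine h1.congr fun n => ?_
  simp only [Function.comp_apply]
  rw [← integral_conj]
  simp only [FinMean.E, Complex.real_smul, map_mul, map_sum, cube_conj, Complex.conj_conj,
    Complex.conj_ofReal]

namespace CubeDom

variable {k : ℕ} {g ψ ψ' : X → ℂ} {C C' B : ℝ}

lemma one : CubeDom μ T k g (fun _ => 1) 1 :=
  ⟨⟨1, Bdd.one⟩, fun ν ε h G hG => by simpa only [mul_one, one_mul] using h G hG⟩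

lemma const_mul (hψ : CubeDom μ T k g ψ C) (c : ℂ) :
    CubeDom μ T k g (fun x => c * ψ x) (‖c‖ * C) := by
  obtain ⟨b, hb⟩ := hψ.1
  refine ⟨⟨_, hb.const_mul c⟩, fun ν ε h G hG => ?_⟩
  have h1 : ∀ (H : Fin k → ℤ) x, g x * (c * ψ x) * cube T G H x =
      c * (g x * ψ x * cube T G H x) := fun H x => by ring
  simp only [h1, integral_const_mul]
  rw [FinMean.E_mul_left, norm_mul, mul_assoc]
  exact mul_le_mul_of_nonneg_left (hψ.2 ν ε h G hG) (norm_nonneg _)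

variable [IsProbabilityMeasure μ]

lemma integrable (hT : MeasurePreserving T μ μ) (hg : Bdd μ B g) (hψ : CubeDom μ T k g ψ C)
    {G : (Fin k → Bool) → X → ℂ} (hG : CubeFamily μ G) (h : Fin k → ℤ) :
    Integrable (fun x => g x * ψ x * cube T G h x) μ := by
  obtain ⟨B', hB'⟩ := hψ.1
  exact ((hg.mul hB').mul (Bdd.cube hT hG.1 h)).integrable

lemma add (hT : MeasurePreserving T μ μ) (hg : Bdd μ B g) (hψ : CubeDom μ T k g ψ C)
    (hψ' : CubeDom μ T k g ψ' C') : CubeDom μ T k g (fun x => ψ x + ψ' x) (C + C') := by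
  obtain ⟨b, hb⟩ := hψ.1
  obtain ⟨b', hb'⟩ := hψ'.1
  refine ⟨⟨b + b', hb.1.add hb'.1, ?_⟩, fun ν ε h G hG => ?_⟩
  · filter_upwards [hb.2, hb'.2] with x h1 h2
    exact (norm_add_le _ _).trans (add_le_add h1 h2)
  · simp only [mul_add, add_mul]
    simp only [integral_add (hψ.integrable hT hg hG _) (hψ'.integrable hT hg hG _)]
    rw [FinMean.E_add]
    exact (norm_add_le _ _).trans (add_le_add (hψ.2 ν ε h G hG) (hψ'.2 ν ε h G hG))

/-- A limit of cube averages may be expanded, and translating its averages by the vertices of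
another cube turns the product into the average of a single cube. -/
lemma mul_limit (hT : MeasurePreserving T μ μ) (hg : Bdd μ B g) (hψ : CubeDom μ T k g ψ C)
    {𝒰 : Ultrafilter ℕ} (h𝒰 : ↑𝒰 ≤ (atTop : Filter ℕ)) {ν : ℕ → FinMean (Fin k → ℤ)}
    (hν : AsympInv ν) {F : (Fin k → Bool) → X → ℂ} (hF : CubeFamily μ F) {φ : X → ℂ}
    (hφ : IsCubeLimit μ T 𝒰 ν F φ) : CubeDom μ T k g (fun x => φ x * ψ x) C := by
  obtain ⟨b, hb⟩ := hψ.1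
  refine ⟨⟨_, hφ.1.mul hb⟩, fun ν' ε hε G hG => ?_⟩
  have hgψ : ∀ h', Bdd μ (B * b * 1) fun x => g x * ψ x * cube T G h' x := fun h' =>
    (hg.mul hb).mul (Bdd.cube hT hG.1 h')
  have hall : ∀ h' h, Bdd μ (B * b * 1 * 1) fun x => g x * ψ x * cube T G h' x * cube T F h x :=
    fun h' h => (hgψ h').mul (Bdd.cube hT hF.1 h)
  have e1 : ∀ (h' : Fin k → ℤ) n, ∫ x, g x * ψ x * cube T G h' x *
      (ν n).E (fun h => cube T F h x) ∂μ =
      (ν n).E fun h => ∫ x, g x * ψ x * cube T G h' x * cube T F h x ∂μ := by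
    intro h' n
    rw [FinMean.E_integral _ fun h => (hall h' h).integrable]
    simp only [FinMean.E_mul_left]
  have e2 : ∀ h', Tendsto (fun n => (ν n).E fun h => ∫ x, g x * ψ x * cube T G h' x *
      cube T F (h' + h) x ∂μ) 𝒰 (𝓝 (∫ x, g x * (φ x * ψ x) * cube T G h' x ∂μ)) := by
    intro h'
    have h1 := hφ.2 _ _ (hgψ h')
    simp only [e1] at h1
    have h2 := (hν.tendsto_sub h' (hall 0 0).nonneg
      (u := fun h => ∫ x, g x * ψ x * cube T G h' x * cube T F h x ∂μ)
      fun h => (hall h' h).norm_integral_le).mono_left h𝒰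
    have h3 := h1.sub h2
    simp only [sub_sub_cancel, sub_zero] at h3
    have h4 : ∀ x, g x * (φ x * ψ x) * cube T G h' x = g x * ψ x * cube T G h' x * φ x :=
      fun x => by ring
    simp only [h4]
    exact h3
  have e3 : Tendsto (fun n => ν'.E fun h' => (ν n).E fun h => ∫ x, g x * ψ x * cube T G h' x *
      cube T F (h' + h) x ∂μ) 𝒰 (𝓝 (ν'.E fun h' => ∫ x, g x * (φ x * ψ x) * cube T G h' x ∂μ)) :=
    (tendsto_finsetSum _ fun i _ => e2 _).const_smul _
  refine le_of_tendsto e3.norm (Eventually.of_forall fun n => ?_)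
  rw [FinMean.E_comm]
  refine FinMean.norm_E_le _ fun h => ?_
  have h5 := hψ.2 ν' ε hε _ (hG.mul (hF.comp_tp hT fun ω => dot ω h))
  simp only [cube_mul, ← cube_shift, ← mul_assoc] at h5
  exact h5

end CubeDom

variable [IsProbabilityMeasure μ]

/-- Functions with vanishing Host–Kra seminorm are orthogonal to the algebra generated by the limits
of cube averages and their conjugates. -/
lemma integral_mul_eq_zero_of_cubeDom (hT : MeasurePreserving T μ μ) {k : ℕ} {B C : ℝ}
    {g ψ : X → ℂ} (hg : Bdd μ B g) (h0 : hkSeminorm μ T k g = 0)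
    (hψ : CubeDom μ T (k + 1) g ψ C) : ∫ x, g x * ψ x ∂μ = 0 := by
  have h1 : ∀ ε > 0, ‖∫ x, g x * ψ x ∂μ‖ ≤ C * ε := by
    intro ε hε
    obtain ⟨ν, hν⟩ := exists_finMean_of_hkSeminorm_eq_zero hT hg h0 hε
    have h2 := hψ.2 ν ε hν _ CubeFamily.one
    simpa [cube, FinMean.E_const] using h2
  rw [← norm_eq_zero]
  have h4 : Tendsto (fun ε : ℝ => C * ε) (𝓝[>] 0) (𝓝 0) := by
    have : Tendsto (fun ε : ℝ => C * ε) (𝓝 0) (𝓝 (C * 0)) := tendsto_id.const_mul C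
    rw [mul_zero] at this
    exact this.mono_left nhdsWithin_le_nhds
  exact le_antisymm (ge_of_tendsto h4 (eventually_mem_nhdsWithin.mono fun ε hε => h1 ε hε))
    (norm_nonneg _)

/-- The level sets of the real part of a multiple of a limit of cube averages belong to the family
of sets generating the nilfactor. -/
lemma measurable_re_of_isCubeLimit (hT : MeasurePreserving T μ μ) {k : ℕ}
    {𝒰 : Ultrafilter ℕ} (h𝒰 : ↑𝒰 ≤ (atTop : Filter ℕ)) {ν : ℕ → FinMean (Fin (k + 1) → ℤ)}
    (hν : AsympInv ν) {F : (Fin (k + 1) → Bool) → X → ℂ} (hF : CubeFamily μ F) {φ : X → ℂ}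
    (hm : Measurable φ) (hφ : IsCubeLimit μ T 𝒰 ν F φ) {c : ℂ} (hc : ‖c‖ = 1) :
    Measurable[stepNilfactor μ T k] fun x => (c * φ x).re := by
  have hρ : Measurable fun x => (c * φ x).re :=
    Complex.measurable_re.comp (hm.const_mul c)
  have hρ1 : ∀ᵐ x ∂μ, |(c * φ x).re| ≤ 1 := by
    filter_upwards [hφ.1.2] with x hx
    refine (Complex.abs_re_le_norm _).trans ?_
    rwa [norm_mul, hc, one_mul]
  refine @measurable_of_Ioi _ _ _ _ _ (stepNilfactor μ T k) _ _ _ _ fun t => ?_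
  refine MeasurableSpace.measurableSet_generateFrom
    ⟨measurableSet_lt measurable_const hρ, fun g hg h0 => ?_⟩
  obtain ⟨B, -, hB⟩ := exists_bdd_of_memLp_top hg
  refine setIntegral_lt_eq_zero hB hρ hρ1 (fun m => ?_) t
  have hdom : ∃ C, CubeDom μ T (k + 1) g (fun x => (((c * φ x).re : ℝ) : ℂ) ^ m) C := by
    induction m with
    | zero => exact ⟨1, by simpa only [pow_zero] using CubeDom.one⟩
    | succ m ih =>
      obtain ⟨C, hC⟩ := ih
      have h1 := (hC.mul_limit hT hB h𝒰 hν hF hφ).const_mul (c / 2)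
      have h2 := (hC.mul_limit hT hB h𝒰 hν hF.conj hφ.conj).const_mul ((starRingEnd ℂ) c / 2)
      have h3 : ∀ x, (((c * φ x).re : ℝ) : ℂ) ^ (m + 1) =
          c / 2 * (φ x * (((c * φ x).re : ℝ) : ℂ) ^ m) + (starRingEnd ℂ) c / 2 *
            ((starRingEnd ℂ) (φ x) * (((c * φ x).re : ℝ) : ℂ) ^ m) := by
        intro x
        rw [pow_succ]
        nth_rewrite 2 [Complex.re_eq_add_conj]
        rw [map_mul]
        ring
      simp only [h3]
      exact ⟨_, h1.add hT hB h2⟩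
  obtain ⟨C, hC⟩ := hdom
  exact integral_mul_eq_zero_of_cubeDom hT hB h0 hC

lemma measurable_of_isCubeLimit (hT : MeasurePreserving T μ μ) {k : ℕ}
    {𝒰 : Ultrafilter ℕ} (h𝒰 : ↑𝒰 ≤ (atTop : Filter ℕ)) {ν : ℕ → FinMean (Fin (k + 1) → ℤ)}
    (hν : AsympInv ν) {F : (Fin (k + 1) → Bool) → X → ℂ} (hF : CubeFamily μ F) {φ : X → ℂ}
    (hm : Measurable φ) (hφ : IsCubeLimit μ T 𝒰 ν F φ) :
    Measurable[stepNilfactor μ T k] φ := by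
  have h1 := measurable_re_of_isCubeLimit hT h𝒰 hν hF hm hφ (c := 1) (by simp)
  have h2 := measurable_re_of_isCubeLimit hT h𝒰 hν hF hm hφ (c := -Complex.I) (by simp)
  simp only [one_mul] at h1
  have h3 : ∀ x, (-Complex.I * φ x).re = (φ x).im := fun x => by simp
  simp only [h3] at h2
  exact @measurable_of_re_im _ _ _ (stepNilfactor μ T k) _ h1 h2

/-- A function with vanishing conditional expectation on the nilfactor has vanishing averages over
cubes of dimension at least two. -/
lemma tendsto_E_cube (hT : MeasurePreserving T μ μ) {k : ℕ} {f : X → ℂ} (hf : Bdd μ 1 f)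
    (h0 : μ[f | nilfactor μ T] =ᵐ[μ] 0) {ν : ℕ → FinMean (Fin (k + 2) → ℤ)}
    (hν : AsympInv ν) {F : (Fin (k + 2) → Bool) → X → ℂ} (hF : CubeFamily μ F) :
    Tendsto (fun n => (ν n).E fun h => ∫ x, f x * cube T F h x ∂μ) atTop (𝓝 0) := by
  rw [tendsto_iff_ultrafilter]
  intro 𝒰 h𝒰
  obtain ⟨φ, hm, hφ1, hφ⟩ := exists_weak_limit (μ := μ) 𝒰
    (D := fun n x => (ν n).E fun h => cube T F h x) fun n => Bdd.E _ fun h => Bdd.cube hT hF.1 h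
  have hlim : IsCubeLimit μ T 𝒰 ν F φ := ⟨hφ1, hφ⟩
  have hmeas : Measurable[nilfactor μ T] φ :=
    (measurable_of_isCubeLimit hT h𝒰 hν hF hm hlim).mono
      (le_iSup (fun k => stepNilfactor μ T (k + 1)) k) le_rfl
  have h1 := hφ 1 f hf
  have h2 : ∫ x, f x * φ x ∂μ = 0 := by
    have h3 := condExp_bilin_of_stronglyMeasurable_right (μ := μ) (m := nilfactor μ T)
      (ContinuousLinearMap.mul ℝ ℂ) (f := f) (g := φ) hmeas.stronglyMeasurable
      (hf.mul hφ1).integrable hf.integrable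
    have h4 := integral_condExp (μ := μ) (f := fun x => f x * φ x) (nilfactor_le μ T)
    rw [← h4]
    refine (integral_congr_ae h3).trans ?_
    refine integral_eq_zero_of_ae ?_
    filter_upwards [h0] with x hx
    simp [hx]
  rw [h2] at h1
  refine h1.congr fun n => ?_
  rw [FinMean.E_integral _ fun h => (hf.mul (Bdd.cube hT hF.1 h)).integrable]
  simp only [FinMean.E_mul_left]

lemma integral_eq_zero_of_condExp_nilfactor {f : X → ℂ} (h0 : μ[f | nilfactor μ T] =ᵐ[μ] 0) :
    ∫ x, f x ∂μ = 0 := by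
  rw [← integral_condExp (nilfactor_le μ T), integral_eq_zero_of_ae h0]

/-- A function with vanishing conditional expectation on the nilfactor has vanishing box averages,
as the boxes exhaust the group. -/
lemma tendsto_boxAvg (hT : MeasurePreserving T μ μ) {s : ℕ} {f : X → ℂ} (hf : Bdd μ 1 f)
    (h0 : μ[f | nilfactor μ T] =ᵐ[μ] 0) {M : ℕ → Fin s → ℕ}
    (hM : ∀ i, Tendsto (fun n => M n i) atTop atTop) :
    Tendsto (fun n => boxAvg μ T s (M n) f) atTop (𝓝 0) := by
  cases s with
  | zero =>
    simp only [boxAvg, integral_eq_zero_of_condExp_nilfactor h0, norm_zero]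
    exact tendsto_const_nhds
  | succ s =>
    obtain ⟨G, hG, hGf⟩ := exists_cubeFamily_mulDiffs (T := T) (s + 2) hf
    have h1 := tendsto_E_cube hT hf h0 (asympInv_boxMean hM tendsto_id) hG
    have h2 : Tendsto (fun n => boxAvg μ T (s + 1) (M n) f ^ 2) atTop (𝓝 0) := by
      refine squeeze_zero (fun n => sq_nonneg _) (fun n => ?_)
        (by simpa only [norm_zero] using h1.norm)
      have h3 := boxAvg_sq_le hT (M n) n hf
      simp only [hGf] at h3
      exact h3.trans (Complex.re_le_norm _)
    have h4 := (Real.continuous_sqrt.tendsto _).comp h2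
    rw [Real.sqrt_zero] at h4
    exact h4.congr fun n => Real.sqrt_sq (boxAvg_nonneg _ _)

end Nilfactor

/-! ### Families of degree one -/

section Linear

variable {X : Type*} [MeasurableSpace X] {μ : Measure X} {T : X ≃ᵐ X}

/-- Variable polynomials of degree at most one whose slopes `a N` are bounded, and such that
`|a N| * N` tends to infinity. -/
def IsSteep (u : PolySeq) : Prop :=
  (∀ᶠ N in atTop, (u N).natDegree ≤ 1) ∧ (∃ A : ℝ, ∀ᶠ N in atTop, |(u N).coeff 1| ≤ A) ∧
    Tendsto (fun N : ℕ => |(u N).coeff 1| * N) atTop atTop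

lemma corr_equiv {ι κ : Type} [Fintype ι] [Fintype κ] (e : ι ≃ κ) (f : X → ℂ) (g : κ → X → ℂ)
    (d : κ → ℤ) : corr μ T f (fun i => g (e i)) (fun i => d (e i)) = corr μ T f g d := by
  simp only [corr]
  congr 1
  ext x
  rw [Equiv.prod_comp e fun j => g j (tp T (d j) x)]

variable [IsProbabilityMeasure μ]

/-- The linear case: a function with vanishing conditional expectation on the nilfactor controls
the families of degree one, since its box averages vanish. -/
lemma Ctl.of_isSteep (hT : MeasurePreserving T μ μ) {f : X → ℂ} (hf : Bdd μ 1 f)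
    (h0 : μ[f | nilfactor μ T] =ᵐ[μ] 0) {U : Set PolySeq} (hU : ∀ u ∈ U, IsSteep u) :
    Ctl μ T f U := by
  intro ι _ u hu g hg
  set e := Fintype.equivFin ι
  set s := Fintype.card ι
  set v : Fin s → PolySeq := fun i => u (e.symm i) with hv
  have hst : ∀ i, IsSteep (v i) := fun i => hU _ (hu _)
  choose A hA using fun i => (hst i).2.1
  obtain ⟨K, hK, hbound⟩ := avg_corr_pow_le (μ := μ) hT s (∑ i, |A i|) (by positivity)
  have hM : ∀ i, Tendsto (fun N : ℕ => ⌈|(v i N).coeff 1| * N⌉₊ + 2) atTop atTop := fun i =>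
    tendsto_atTop_mono (fun N => Nat.le_add_right _ 2)
      (tendsto_nat_ceil_atTop.comp (hst i).2.2)
  have hbox := (tendsto_boxAvg hT hf h0 (M := fun N i => ⌈|(v i N).coeff 1| * N⌉₊ + 2)
    hM).const_mul K
  rw [mul_zero] at hbox
  set y : ℕ → ℝ := fun N => (N : ℝ)⁻¹ * ∑ n ∈ Finset.Icc 1 N,
    ‖corr μ T f (g N) fun i => ⌊(u i N).eval (n : ℝ)⌋‖ with hy
  have hy0 : ∀ N, 0 ≤ y N := fun N => by positivity
  have hpow : Tendsto (fun N => y N ^ 2 ^ s) atTop (𝓝 0) := by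
    refine squeeze_zero' (Eventually.of_forall fun N => pow_nonneg (hy0 N) _) ?_ hbox
    filter_upwards [eventually_ge_atTop 1, eventually_all.2 fun i => (hst i).1,
      eventually_all.2 hA, eventually_all.2 fun i => (hst i).2.2.eventually_ge_atTop 1]
      with N h1 h2 h3 h4
    have h5 := hbound N h1 (fun i => (v i N).coeff 1) (fun i => (v i N).coeff 0) h4
      (fun i => (h3 i).trans ((le_abs_self _).trans
        (Finset.single_le_sum (f := fun i => |A i|) (fun j _ => abs_nonneg _)
          (Finset.mem_univ i)))) f hf (fun i => g N (e.symm i)) fun i => hg N _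
    refine le_trans (le_of_eq ?_) h5
    congr 1
    simp only [hy]
    congr 1
    refine Finset.sum_congr rfl fun n _ => ?_
    congr 1
    rw [← corr_equiv e.symm]
    congr 1
    ext i
    have h6 : (u (e.symm i) N).eval (n : ℝ) = (v i N).coeff 1 * n + (v i N).coeff 0 := by
      change (v i N).eval (n : ℝ) = _
      conv_lhs => rw [Polynomial.eq_X_add_C_of_natDegree_le_one (h2 i)]
      simp
    rw [h6]
  have hroot := hpow.rpow_const (p := ((2 ^ s : ℕ) : ℝ)⁻¹) (Or.inr (by positivity))
  rw [Real.zero_rpow (by positivity)] at hroot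
  exact hroot.congr fun N => Real.pow_rpow_inv_natCast (hy0 N) (by positivity)

end Linear

/-! ### Steep polynomials and the `R₁`-property -/

lemma ROne.of_rProp {l : ℕ} {a : Fin l → ℕ → ℝ} (h : RProp l a) (i : Fin l) : ROne (a i) := by
  match l, a, h, i with
  | 0, _, _, i => exact i.elim0
  | 1, a, h, i =>
    rw [Subsingleton.elim i 0]
    exact h
  | l + 2, a, h, i => exact (h i).1

lemma IsSteep.of_abs_eq {u v : PolySeq} (hu : IsSteep u) (hv : ∀ᶠ N in atTop, (v N).natDegree ≤ 1)
    (h : ∀ᶠ N in atTop, |(v N).coeff 1| = |(u N).coeff 1|) : IsSteep v := by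
  obtain ⟨A, hA⟩ := hu.2.1
  refine ⟨hv, ⟨A, ?_⟩, hu.2.2.congr' ?_⟩
  · filter_upwards [h, hA] with N h1 h2
    rwa [h1]
  · filter_upwards [h] with N h1
    rw [h1]

lemma IsSteep.neg {u : PolySeq} (hu : IsSteep u) : IsSteep (-u) :=
  hu.of_abs_eq (by simpa using hu.1) (by simp)

lemma IsLinearSeq.isSteep {u : PolySeq} (hu : IsLinearSeq u)
    (h : ROne fun N => (u N).leadingCoeff) : IsSteep u := by
  have h1 : ∀ᶠ N in atTop, (u N).leadingCoeff = (u N).coeff 1 := by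
    filter_upwards [hu] with N hN
    rw [leadingCoeff, hN]
  obtain ⟨⟨A, hA⟩, -, -, hlim⟩ := h
  refine ⟨hu.mono fun N hN => hN.le, ⟨A, ?_⟩, hlim.congr' ?_⟩
  · filter_upwards [h1, hA] with N h2 h3
    rwa [← h2]
  · filter_upwards [h1] with N h2
    rw [h2]

lemma ReducesToR.isSteep {P : List PolySeq} (h : ReducesToR P)
    (hdeg : ∀ p ∈ P, ∀ᶠ N in atTop, (p N).natDegree ≤ 1) {p : PolySeq} (hp : p ∈ P) :
    IsSteep p := by
  cases h with
  | linear _ hlin hR =>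
    obtain ⟨i, rfl⟩ := List.get_of_mem hp
    exact (hlin _ hp).isSteep (ROne.of_rProp hR i)
  | step _ _ h2 _ _ =>
    obtain ⟨q, hq, h3⟩ := h2
    obtain ⟨N, h4, h5⟩ := ((hdeg q hq).and h3).exists
    omega

/-! ### Degrees of shifted polynomials -/

lemma natDegree_taylor_sub {p : ℝ[X]} {d : ℕ} (hd : p.natDegree = d + 1) {a : ℝ} (ha : a ≠ 0) :
    (taylor a p - p).natDegree = d := by
  refine natDegree_eq_of_le_of_coeff_ne_zero ?_ ?_
  · rw [natDegree_le_iff_coeff_eq_zero]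
    intro n hn
    rw [coeff_sub]
    rcases Nat.eq_or_lt_of_le (Nat.succ_le_of_lt hn) with h | h
    · have h1 := coeff_taylor_natDegree a p
      rw [leadingCoeff, hd, show d + 1 = n from h] at h1
      rw [h1, sub_self]
    · rw [coeff_eq_zero_of_natDegree_lt (by rw [natDegree_taylor]; omega),
        coeff_eq_zero_of_natDegree_lt (by omega), sub_zero]
  · have h1 : (hasseDeriv d p).natDegree ≤ 1 := (natDegree_hasseDeriv_le p d).trans (by omega)
    rw [coeff_sub, taylor_coeff, eq_X_add_C_of_natDegree_le_one h1, hasseDeriv_coeff,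
      hasseDeriv_coeff]
    have h2 : p.coeff (1 + d) ≠ 0 := by
      rw [add_comm, ← hd, coeff_natDegree, leadingCoeff_ne_zero]
      rintro rfl
      simp at hd
    have h3 : ((1 + d).choose d : ℝ) ≠ 0 := by
      exact_mod_cast (Nat.choose_pos (Nat.le_add_left d 1)).ne'
    simp [ha, h2, h3]

lemma natDegree_shift (p : PolySeq) (h N : ℕ) : (shift p h N).natDegree = (p N).natDegree := by
  rw [shift, ← taylor_apply, natDegree_taylor]

lemma shift_sub (p q : PolySeq) (h : ℕ) : shift (p - q) h = shift p h - shift q h := by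
  ext1 N
  simp [shift]

lemma natDegree_shift_sub {p : PolySeq} {d N : ℕ} (hd : (p N).natDegree = d + 1) {h h' : ℕ}
    (hne : h ≠ h') : (shift p h N - shift p h' N).natDegree = d := by
  have h1 : shift p h N - shift p h' N =
      taylor (h' : ℝ) (taylor ((h : ℝ) - h') (p N) - p N) := by
    rw [map_sub, taylor_taylor, add_sub_cancel]
    simp only [shift, taylor_apply]
  rw [h1, natDegree_taylor, natDegree_taylor_sub hd]
  rw [sub_ne_zero]
  exact_mod_cast hne

lemma natDegree_shift_sub_self {p : PolySeq} {d N : ℕ} (hd : (p N).natDegree = d + 1) {h : ℕ}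
    (h0 : h ≠ 0) : ((shift p h - p) N).natDegree = d := by
  have h1 := natDegree_shift_sub (p := p) hd h0
  have h2 : shift p 0 N = p N := by simp [shift]
  rwa [h2] at h1

/-- A polynomial of degree at least two differs from all but one of the shifts of another one by a
non-constant polynomial. -/
lemma eventually_not_isConstSeq_sub {p : PolySeq} {d : ℕ}
    (hd : ∀ᶠ N in atTop, (p N).natDegree = d + 2) (q : PolySeq) :
    ∀ᶠ h : ℕ in atTop, ¬ IsConstSeq (shift p h - q) := by
  by_cases hq : ∃ h₀, IsConstSeq (shift p h₀ - q)
  · obtain ⟨h₀, hh₀⟩ := hq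
    filter_upwards [eventually_gt_atTop h₀] with h hlt hcon
    obtain ⟨N, h1, h2, h3⟩ := (hd.and (hh₀.and hcon)).exists
    have h4 := natDegree_shift_sub (p := p) h1 hlt.ne'
    have h5 : shift p h N - shift p h₀ N = (shift p h - q) N - (shift p h₀ - q) N := by
      simp
    rw [h5] at h4
    have h6 := natDegree_sub_le ((shift p h - q) N) ((shift p h₀ - q) N)
    rw [h2, h3, max_self] at h6
    omega
  · push Not at hq
    exact Eventually.of_forall hq

/-! ### The van der Corput operation on families -/

lemma grouped_trans {x y z : PolySeq} (h : Grouped x y) (h' : Grouped y z) : Grouped x z := by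
  refine ⟨h.1, h'.2.1, ?_⟩
  filter_upwards [h.2.2, h'.2.2] with N h1 h2
  have h3 : (x - z) N = (x - y) N + (y - z) N := by simp
  have h4 := natDegree_add_le ((x - y) N) ((y - z) N)
  rw [h1, h2, ← h3] at h4
  simpa using h4

lemma grouped_self {x : PolySeq} (h : IsLinearSeq x) : Grouped x x :=
  ⟨h, h, Eventually.of_forall fun N => by simp⟩

open Classical in
lemma exists_mem_pwFilter {l : List PolySeq} {e : PolySeq} (he : e ∈ l) :
    ∃ b ∈ l.pwFilter fun q r => ¬ Grouped q r, e = b ∨ Grouped e b := by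
  by_cases hlin : IsLinearSeq e
  · by_contra! hcon
    have h1 := (List.forall_mem_pwFilter (R := fun q r => ¬ Grouped q r) (fun {x y z} h => by
      by_contra! h'
      exact h (grouped_trans h'.1 h'.2)) e l).1 fun b hb => (hcon b hb).2
    exact h1 e he (grouped_self hlin)
  · refine ⟨e, ?_, Or.inl rfl⟩
    induction l with
    | nil => simp at he
    | cons a l ih =>
      rcases List.mem_cons.1 he with rfl | he
      · rw [List.pwFilter_cons_of_pos fun b _ hb => hlin hb.1]
        exact List.mem_cons_self
      · by_cases ha : ∀ b ∈ l.pwFilter fun q r => ¬ Grouped q r, ¬ Grouped a b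
        · rw [List.pwFilter_cons_of_pos ha]
          exact List.mem_cons_of_mem _ (ih he)
        · rw [List.pwFilter_cons_of_neg ha]
          exact ih he

lemma mem_vdC {P : List PolySeq} {p : PolySeq} {h : ℕ} {b : PolySeq} (hb : b ∈ vdC P p h) :
    ∃ q ∈ P, b = shift q h - p ∨ b = q - p := by
  classical
  have h1 := List.pwFilter_subset _ hb
  rw [List.mem_filter, List.mem_append, List.mem_map, List.mem_map] at h1
  rcases h1.1 with ⟨q, hq, rfl⟩ | ⟨q, hq, rfl⟩
  · exact ⟨q, hq, Or.inl rfl⟩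
  · exact ⟨q, hq, Or.inr rfl⟩

/-- Every non-constant member of the family produced by the van der Corput operation is kept or has
a representative in its group. -/
lemma exists_mem_vdC {P : List PolySeq} {p q : PolySeq} {h : ℕ} {e : PolySeq} (hq : q ∈ P)
    (he : e = shift q h - p ∨ e = q - p) (hc : ¬ IsConstSeq e) :
    ∃ b ∈ vdC P p h, e = b ∨ Grouped e b := by
  classical
  refine exists_mem_pwFilter (List.mem_filter.2 ⟨?_, by simpa using hc⟩)
  rw [List.mem_append, List.mem_map, List.mem_map]
  rcases he with rfl | rfl
  · exact Or.inl ⟨q, hq, rfl⟩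
  · exact Or.inr ⟨q, hq, rfl⟩

lemma EssentiallyDistinct.sub {P : List PolySeq} (hP : EssentiallyDistinct P) {p q : PolySeq}
    (hp : p ∈ P) (hq : q ∈ P) (hne : p ≠ q) : HasFixedPosDegree (p - q) := by
  have : Std.Symm fun p q : PolySeq => HasFixedPosDegree (p - q) := ⟨fun p q h => by
    obtain ⟨d, h1, h2⟩ := h
    refine ⟨d, h1, h2.mono fun N hN => ?_⟩
    rw [← hN, ← natDegree_neg]
    simp⟩
  exact hP.2.forall hp hq hne

lemma exists_hasMinDegree {P : List PolySeq} (hP : ∀ p ∈ P, HasFixedPosDegree p)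
    (hne : P ≠ []) : ∃ r ∈ P, HasMinDegree P r := by
  classical
  choose! d hd1 hd2 using hP
  obtain ⟨p, hp⟩ := List.exists_mem_of_ne_nil P hne
  obtain ⟨r, hr, hmin⟩ := P.toFinset.exists_min_image d ⟨p, List.mem_toFinset.2 hp⟩
  rw [List.mem_toFinset] at hr
  refine ⟨r, hr, fun q hq => ?_⟩
  filter_upwards [hd2 r hr, hd2 q hq] with N h1 h2
  rw [h1, h2]
  exact hmin q (List.mem_toFinset.2 hq)

/-! ### The polynomial exhaustion argument -/

section PET

variable {X : Type*} [MeasurableSpace X] {μ : Measure X} {T : X ≃ᵐ X}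

/-- One step of the induction, if the member `p` in question gives rise to a member `shift p h - r`
of maximal degree at least two of the new family. -/
lemma ctl_vdcSet_of_vdC (hT : MeasurePreserving T μ μ) {f : X → ℂ} {P : List PolySeq}
    {p r : PolySeq} {h : ℕ} (hp : p ∈ P) (hh : ∀ q ∈ P, ¬ IsConstSeq (shift p h - q))
    (hdeg : ∀ᶠ N in atTop, 2 ≤ ((shift p h - r) N).natDegree)
    (hctl : shift p h - r ∈ vdC P r h → Ctl μ T f
      (diffSet (shift p h - r) {q | q ∈ vdC P r h ∧ q ≠ shift p h - r})) :
    Ctl μ T f (vdcSet p {q | q ∈ P ∧ q ≠ p} h) := by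
  set p' := shift p h - r with hp'
  have hnlin : ∀ e, ¬ Grouped e p' := by
    intro e he
    obtain ⟨N, h1, h2⟩ := (hdeg.and he.2.1).exists
    omega
  have hmem : p' ∈ vdC P r h := by
    obtain ⟨b, hb, h1 | h1⟩ := exists_mem_vdC (h := h) hp (Or.inl hp') fun hc => by
      obtain ⟨N, h1, h2⟩ := (hdeg.and hc).exists
      omega
    · rwa [h1]
    · exact absurd ⟨h1.2.1, h1.1, (by
        refine h1.2.2.mono fun N hN => ?_
        rw [← hN, ← natDegree_neg]
        simp)⟩ (hnlin b)
  refine (hctl hmem).of_const hT fun u hu => ?_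
  -- every new polynomial is the difference of a member of the unreduced family with `p'`
  have key : ∀ e q, q ∈ P → (e = shift q h - r ∨ e = q - r) → e ≠ p' →
      ∃ v ∈ diffSet p' {q | q ∈ vdC P r h ∧ q ≠ p'}, IsConstSeq (e - p' - v) := by
    intro e q hq he hne
    by_cases hc : IsConstSeq e
    · exact ⟨-p', Or.inl rfl, hc.mono fun N hN => by simpa using hN⟩
    · obtain ⟨b, hb, h1⟩ := exists_mem_vdC hq he hc
      refine ⟨b - p', Or.inr ⟨b, ⟨hb, ?_⟩, rfl⟩, ?_⟩
      · rintro rfl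
        exact h1.elim hne (hnlin e)
      · rcases h1 with rfl | h1
        · exact Eventually.of_forall fun N => by simp
        · exact h1.2.2.mono fun N hN => by simpa using hN
  rcases hu with rfl | ⟨q, ⟨hq, hqp⟩, rfl | rfl⟩
  · have h1 : p - shift p h = (p - r) - p' := by rw [hp']; abel
    rw [h1]
    refine key _ p hp (Or.inr rfl) fun h2 => hh p hp ?_
    rw [← sub_left_injective h2]
    exact Eventually.of_forall fun N => by simp
  · have h1 : shift q h - shift p h = (shift q h - r) - p' := by rw [hp']; abel
    rw [h1]
    refine key _ q hq (Or.inl rfl) fun h2 => hqp ?_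
    have h3 := sub_left_injective h2
    ext1 N
    have h4 : taylor (h : ℝ) (q N) = taylor (h : ℝ) (p N) := by
      simpa only [shift, taylor_apply] using congrFun h3 N
    exact taylor_injective _ h4
  · have h1 : q - shift p h = (q - r) - p' := by rw [hp']; abel
    rw [h1]
    refine key _ q hq (Or.inr rfl) fun h2 => hh q hq ?_
    rw [← sub_left_injective h2]
    exact Eventually.of_forall fun N => by simp

/-- One step of the induction, if all members have degree two and the same leading coefficient, so
that all van der Corput operations lead to degree one. -/
lemma isSteep_of_mem_vdcSet {P : List PolySeq} {p : PolySeq} {h : ℕ} (hp : p ∈ P)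
    (hh : ∀ q ∈ P, ¬ IsConstSeq (shift p h - q))
    (hdeg : ∀ q ∈ P, ∀ᶠ N in atTop, (q N).natDegree = 2)
    (hdiff : ∀ q ∈ P, q ≠ p → ∀ᶠ N in atTop, ((q - p) N).natDegree = 1)
    (hred : ∀ r ∈ P, ReducesToR (vdC P r h)) {u : PolySeq}
    (hu : u ∈ vdcSet p {q | q ∈ P ∧ q ≠ p} h) : IsSteep u := by
  have hdiff' : ∀ q ∈ P, ∀ᶠ N in atTop, ((q - p) N).natDegree ≤ 1 := by
    intro q hq
    by_cases hqp : q = p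
    · subst hqp
      exact Eventually.of_forall fun N => by simp
    · exact (hdiff q hq hqp).mono fun N hN => hN.le
  have hshift : ∀ q ∈ P, ∀ᶠ N in atTop, ((shift q h - q) N).natDegree ≤ 1 := by
    intro q hq
    filter_upwards [hdeg q hq] with N hN
    by_cases h0 : h = 0
    · subst h0
      simp [shift]
    · exact (natDegree_shift_sub_self hN h0).le
  have hraw : ∀ r ∈ P, ∀ q ∈ P, ∀ e : PolySeq, (e = shift q h - r ∨ e = q - r) →
      ∀ᶠ N in atTop, (e N).natDegree ≤ 1 := by
    have h2 : ∀ r ∈ P, ∀ q ∈ P, ∀ᶠ N in atTop, ((q - r) N).natDegree ≤ 1 := by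
      intro r hr q hq
      filter_upwards [hdiff' r hr, hdiff' q hq] with N h1 h2
      have h3 : (q - r) N = (q - p) N - (r - p) N := by simp
      rw [h3]
      exact (natDegree_sub_le _ _).trans (max_le h2 h1)
    rintro r hr q hq e (rfl | rfl)
    · filter_upwards [hshift q hq, h2 r hr q hq] with N h1 h2
      have h3 : (shift q h - r) N = (shift q h - q) N + (q - r) N := by simp
      rw [h3]
      exact (natDegree_add_le _ _).trans (max_le h1 h2)
    · exact h2 r hr q hq
  have hsteep : ∀ r ∈ P, ∀ q ∈ P, ∀ e : PolySeq, (e = shift q h - r ∨ e = q - r) →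
      ¬ IsConstSeq e → IsSteep e := by
    intro r hr q hq e he hc
    obtain ⟨b, hb, h1⟩ := exists_mem_vdC hq he hc
    have hbs : IsSteep b := (hred r hr).isSteep (fun c hc => by
      obtain ⟨q', hq', h2⟩ := mem_vdC hc
      exact hraw r hr q' hq' c h2) hb
    rcases h1 with rfl | h1
    · exact hbs
    · refine hbs.of_abs_eq (h1.1.mono fun N hN => hN.le) (h1.2.2.mono fun N hN => ?_)
      have h2 : ((e - b) N).coeff 1 = 0 := coeff_eq_zero_of_natDegree_lt (by omega)
      rw [Pi.sub_apply, coeff_sub, sub_eq_zero] at h2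
      rw [h2]
  rcases hu with rfl | ⟨q, ⟨hq, hqp⟩, rfl | rfl⟩
  · rw [← neg_sub]
    exact (hsteep p hp p hp _ (Or.inl rfl) (hh p hp)).neg
  · have h1 : IsSteep (q - p) := by
      refine hsteep p hp q hq _ (Or.inr rfl) fun hc => ?_
      obtain ⟨N, h1, h2⟩ := ((hdiff q hq hqp).and hc).exists
      omega
    rw [← shift_sub]
    refine h1.of_abs_eq ?_ ?_
    · exact h1.1.mono fun N hN => by rwa [natDegree_shift]
    · filter_upwards [hdiff q hq hqp] with N hN
      have h2 := coeff_taylor_natDegree (h : ℝ) ((q - p) N)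
      rw [leadingCoeff, hN, taylor_apply] at h2
      rw [shift, h2]
  · rw [← neg_sub]
    exact (hsteep q hq p hp _ (Or.inl rfl) (hh q hq)).neg

variable [IsProbabilityMeasure μ]

/-- If a family reduces to `R`, then a function with vanishing conditional expectation on the
nilfactor controls the differences with any member of maximal degree at least two. This is proved by
PET induction: the step subtracts a member of minimum degree chosen so that the given one remains of
maximal degree. -/
lemma ReducesToR.ctl (hT : MeasurePreserving T μ μ) {f : X → ℂ} (hf : Bdd μ 1 f)
    (h0 : μ[f | nilfactor μ T] =ᵐ[μ] 0) {P : List PolySeq} (hP : ReducesToR P) :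
    ∀ p ∈ P, ∀ d : ℕ, (∀ᶠ N in atTop, (p N).natDegree = d + 2) →
      (∀ q ∈ P, ∀ᶠ N in atTop, (q N).natDegree ≤ d + 2) →
      Ctl μ T f (diffSet p {q | q ∈ P ∧ q ≠ p}) := by
  induction hP with
  | linear P hlin hR =>
    intro p hp d hd _
    obtain ⟨N, h1, h2⟩ := (hd.and (hlin p hp)).exists
    omega
  | step P hP hdeg H hstep ih =>
    intro p hp d hd hmax
    have hshiftp : ∀ h, h ≠ 0 → ∀ᶠ N in atTop, ((shift p h - p) N).natDegree = d + 1 := by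
      intro h hh
      filter_upwards [hd] with N hN
      exact natDegree_shift_sub_self hN hh
    have hshiftq : ∀ q ∈ P, ∀ h, ∀ᶠ N in atTop, ((shift q h - q) N).natDegree ≤ d + 1 := by
      intro q hq h
      obtain ⟨e, he, hqe⟩ := hP.1 q hq
      obtain ⟨e, rfl⟩ : ∃ e', e = e' + 1 := ⟨e - 1, by omega⟩
      filter_upwards [hqe, hmax q hq] with N h1 h2
      by_cases h0 : h = 0
      · subst h0
        simp [shift]
      · refine (natDegree_shift_sub_self h1 h0).le.trans ?_
        omega
    have hconst : ∀ᶠ h : ℕ in atTop, ∀ q ∈ P, ¬ IsConstSeq (shift p h - q) := by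
      have h1 : ∀ᶠ h : ℕ in atTop, ∀ q ∈ {q | q ∈ P}, ¬ IsConstSeq (shift p h - q) :=
        (eventually_all_finite (List.finite_toSet P)).2 fun q _ =>
          eventually_not_isConstSeq_sub hd q
      exact h1
    obtain ⟨r₀, hr₀, hmin₀⟩ := exists_hasMinDegree hP.1 (List.ne_nil_of_mem hp)
    by_cases hA : ∃ r ∈ P, HasMinDegree P r ∧ ∀ᶠ N in atTop, ((p - r) N).natDegree = d + 2
    · -- subtracting `r` does not lower the degree of `p`
      obtain ⟨r, hr, hmin, hpr⟩ := hA
      refine Ctl.of_vdc hT hf ?_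
      filter_upwards [hconst, eventually_ge_atTop (H r)] with h hh hH
      have hp'd : ∀ᶠ N in atTop, ((shift p h - r) N).natDegree = d + 2 := by
        filter_upwards [hshiftq p hp h, hpr] with N h1 h2
        have h3 : (shift p h - r) N = (shift p h - p) N + (p - r) N := by simp
        rw [h3, natDegree_add_eq_right_of_natDegree_lt (by omega), h2]
      refine ctl_vdcSet_of_vdC hT hp hh (hp'd.mono fun N hN => by omega) fun hmem =>
        ih r hr hmin h hH _ hmem d hp'd fun b hb => ?_
      obtain ⟨q, hq, hb⟩ := mem_vdC hb
      filter_upwards [hmax q hq, hmax r hr] with N h1 h2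
      rcases hb with rfl | rfl
      · exact (natDegree_sub_le _ _).trans (max_le (by rwa [natDegree_shift]) h2)
      · exact (natDegree_sub_le _ _).trans (max_le h1 h2)
    · -- all members have the same degree and leading coefficient
      replace hA : ∀ r ∈ P, HasMinDegree P r → ¬ ∀ᶠ N in atTop, ((p - r) N).natDegree = d + 2 :=
        fun r hr hmin h => hA ⟨r, hr, hmin, h⟩
      have hdegr₀ : ∀ᶠ N in atTop, (r₀ N).natDegree = d + 2 := by
        obtain ⟨e, he, hre⟩ := hP.1 r₀ hr₀
        by_cases hed : e = d + 2
        · exact hed ▸ hre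
        · refine absurd ?_ (hA r₀ hr₀ hmin₀)
          filter_upwards [hre, hd, hmin₀ p hp] with N h1 h2 h3
          rw [Pi.sub_apply, natDegree_sub_eq_left_of_natDegree_lt (by omega), h2]
      have hall : ∀ q ∈ P, ∀ᶠ N in atTop, (q N).natDegree = d + 2 := by
        intro q hq
        filter_upwards [hdegr₀, hmin₀ q hq, hmax q hq] with N h1 h2 h3
        omega
      have hmin : ∀ q ∈ P, HasMinDegree P q := by
        intro q hq q' hq'
        filter_upwards [hall q hq, hall q' hq'] with N h1 h2
        omega
      have hlt : ∀ q ∈ P, ∀ᶠ N in atTop, ((q - p) N).natDegree ≤ d + 1 := by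
        intro q hq
        by_cases hqp : q = p
        · subst hqp
          exact Eventually.of_forall fun N => by simp
        · obtain ⟨e, he, hqe⟩ := hP.sub hp hq (Ne.symm hqp)
          by_cases hed : e = d + 2
          · exact absurd (hed ▸ hqe) (hA q hq (hmin q hq))
          · filter_upwards [hqe, hall q hq, hd] with N h1 h2 h3
            have h4 := natDegree_sub_le (p N) (q N)
            rw [← neg_sub, Pi.neg_apply, natDegree_neg, h1]
            rw [Pi.sub_apply] at h1
            rw [h1, h2, h3, max_self] at h4
            omega
      refine Ctl.of_vdc hT hf ?_
      rcases Nat.eq_zero_or_pos d with rfl | hdpos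
      · have hH : ∀ᶠ h : ℕ in atTop, ∀ r ∈ {r | r ∈ P}, H r ≤ h :=
          (eventually_all_finite (List.finite_toSet P)).2 fun r _ => eventually_ge_atTop (H r)
        filter_upwards [hconst, hH] with h hh hH
        refine Ctl.of_isSteep hT hf h0 fun u hu => isSteep_of_mem_vdcSet hp hh hall ?_
          (fun r hr => hstep r hr (hmin r hr) h (hH r hr)) hu
        intro q hq hqp
        obtain ⟨e, he, hqe⟩ := hP.sub hq hp hqp
        filter_upwards [hqe, hlt q hq] with N h1 h2
        omega
      · obtain ⟨d, rfl⟩ : ∃ d', d = d' + 1 := ⟨d - 1, by omega⟩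
        filter_upwards [hconst, eventually_ge_atTop (H p), eventually_ne_atTop 0] with h hh hH hne
        refine ctl_vdcSet_of_vdC hT hp hh ((hshiftp h hne).mono fun N hN => by omega) fun hmem =>
          ih p hp (hmin p hp) h hH _ hmem d (hshiftp h hne) fun b hb => ?_
        obtain ⟨q, hq, hb⟩ := mem_vdC hb
        filter_upwards [hshiftq q hq h, hlt q hq] with N h1 h2
        rcases hb with rfl | rfl
        · have h3 : (shift q h - p) N = (shift q h - q) N + (q - p) N := by simp
          rw [h3]
          exact (natDegree_add_le _ _).trans (max_le h1 h2)
        · exact h2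

end PET

/-! ### Super nice tuples -/

section SuperNice

variable {X : Type*} [MeasurableSpace X] {μ : Measure X} {T : X ≃ᵐ X} [IsProbabilityMeasure μ]

lemma SuperNice.ne {l : ℕ} {p : Fin l → PolySeq} (hp : SuperNice p) {i j : Fin l} (hij : i ≠ j) :
    p i ≠ p j := by
  have h1 := List.pairwise_ofFn.1 hp.nonconst.2
  have h2 : ∀ q : PolySeq, ¬ HasFixedPosDegree (q - q) := by
    rintro q ⟨d, hd, h⟩
    obtain ⟨N, hN⟩ := h.exists
    simp at hN
    omega
  intro h
  rcases lt_or_gt_of_ne hij with hlt | hlt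
  · exact h2 (p j) (by simpa only [h] using h1 hlt)
  · exact h2 (p j) (by simpa only [h] using h1 hlt)

/-- A function with vanishing conditional expectation on the nilfactor controls the differences with
any of the polynomials. If the latter is not of maximal degree, one starts from the differences with
a polynomial `p i₀` of maximal degree, among which `p i - p i₀` is of maximal degree. -/
lemma SuperNice.ctl {l : ℕ} {p : Fin l → PolySeq} (hp : SuperNice p)
    (hT : MeasurePreserving T μ μ) {f : X → ℂ} (hf : Bdd μ 1 f)
    (h0 : μ[f | nilfactor μ T] =ᵐ[μ] 0) (i : Fin l) : Ctl μ T f (Set.range (primed p i)) := by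
  choose D hD1 hD using fun j => hp.nonconst.1 (p j) (List.mem_ofFn.2 ⟨j, rfl⟩)
  obtain ⟨i₀, -, hmax⟩ := Finset.exists_max_image Finset.univ D ⟨i, Finset.mem_univ i⟩
  replace hmax : ∀ j, D j ≤ D i₀ := fun j => hmax j (Finset.mem_univ j)
  have hle : ∀ i', D i' = D i₀ → ∀ j, ∀ᶠ N in atTop, (p j N).natDegree ≤ (p i' N).natDegree := by
    intro i' hi' j
    filter_upwards [hD j, hD i'] with N h1 h2
    rw [h1, h2, hi']
    exact hmax j
  have hle' : ∀ i' j, ∀ᶠ N in atTop, (primed p i' j N).natDegree ≤ D i₀ := by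
    intro i' j
    filter_upwards [hD j, hD i'] with N h1 h2
    simp only [primed]
    split_ifs
    · rw [Pi.neg_apply, natDegree_neg, h2]
      exact hmax _
    · refine (natDegree_sub_le _ _).trans (max_le ?_ ?_)
      · rw [h1]; exact hmax _
      · rw [h2]; exact hmax _
  by_cases h1 : D i₀ ≤ 1
  · have hi : D i = D i₀ := le_antisymm (hmax i) (h1.trans (hD1 i))
    refine Ctl.of_isSteep hT hf h0 ?_
    rintro _ ⟨j, rfl⟩
    refine (hp.reduces_primed i (hle i hi)).isSteep (fun q hq => ?_) (List.mem_ofFn.2 ⟨j, rfl⟩)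
    obtain ⟨j, rfl⟩ := List.mem_ofFn.1 hq
    exact (hle' i j).mono fun N hN => hN.trans h1
  obtain ⟨d, hd⟩ : ∃ d, D i₀ = d + 2 := ⟨D i₀ - 2, by omega⟩
  by_cases hi : D i = D i₀
  · refine (hp.reduces.ctl hT hf h0 (p i) (List.mem_ofFn.2 ⟨i, rfl⟩) d ?_ ?_).mono ?_
    · exact (hD i).mono fun N hN => by rw [hN, hi, hd]
    · intro q hq
      obtain ⟨j, rfl⟩ := List.mem_ofFn.1 hq
      filter_upwards [hD j] with N hN
      rw [hN, ← hd]
      exact hmax j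
    · rintro _ ⟨j, rfl⟩
      simp only [primed]
      split_ifs with hji
      · exact Or.inl rfl
      · exact Or.inr ⟨p j, ⟨List.mem_ofFn.2 ⟨j, rfl⟩, hp.ne hji⟩, rfl⟩
  · have hne : i ≠ i₀ := fun h => hi (h ▸ rfl)
    have hlt : D i < D i₀ := lt_of_le_of_ne (hmax i) hi
    have hprimed : ∀ j, j ≠ i₀ → primed p i₀ j = p j - p i₀ := fun j hj => if_neg hj
    have hprimed₀ : primed p i₀ i₀ = -p i₀ := if_pos rfl
    refine ((hp.reduces_primed i₀ (hle i₀ rfl)).ctl hT hf h0 (primed p i₀ i)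
      (List.mem_ofFn.2 ⟨i, rfl⟩) d ?_ ?_).mono ?_
    · filter_upwards [hD i, hD i₀] with N h2 h3
      rw [hprimed i hne, Pi.sub_apply, natDegree_sub_eq_right_of_natDegree_lt (by omega), h3, hd]
    · intro q hq
      obtain ⟨j, rfl⟩ := List.mem_ofFn.1 hq
      rw [← hd]
      exact hle' i₀ j
    · rintro _ ⟨j, rfl⟩
      rw [hprimed i hne]
      by_cases hji : j = i
      · subst hji
        refine Or.inr ⟨primed p i₀ i₀, ⟨List.mem_ofFn.2 ⟨i₀, rfl⟩, fun h => ?_⟩, ?_⟩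
        · obtain ⟨N, hN⟩ := (hD j).exists
          rw [hprimed₀] at h
          have h2 : p j = 0 := by
            have := congrArg (· + p i₀) h
            simpa using this.symm
          have h3 := hD1 j
          rw [h2] at hN
          simp at hN
          omega
        · rw [hprimed₀, primed, if_pos rfl]
          abel
      · by_cases hj₀ : j = i₀
        · subst hj₀
          refine Or.inl ?_
          rw [primed, if_neg hji]
          abel
        · refine Or.inr ⟨primed p i₀ j, ⟨List.mem_ofFn.2 ⟨j, rfl⟩, fun h => hp.ne hji ?_⟩, ?_⟩
          · rw [hprimed j hj₀] at h
            exact sub_left_injective h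
          · rw [hprimed j hj₀, primed, if_neg hji]
            abel

end SuperNice

/-! ### Multiple averages -/

section MultAvg

variable {X : Type*} [MeasurableSpace X] {μ : Measure X} {T : X ≃ᵐ X} {l : ℕ}
  {a : Fin l → ℕ → ℕ → ℤ}

lemma multAvg_eq (f : Fin l → X → ℂ) (N : ℕ) (x : X) :
    multAvg T a f N x = (N : ℂ)⁻¹ * ∑ n ∈ Finset.Icc 1 N, ∏ i, f i (tp T (a i N n) x) := rfl

lemma aestronglyMeasurable_multAvg (hT : MeasurePreserving T μ μ) {f : Fin l → X → ℂ}
    (hf : ∀ i, AEStronglyMeasurable (f i) μ) (N : ℕ) :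
    AEStronglyMeasurable (multAvg T a f N) μ := by
  refine (Finset.aestronglyMeasurable_fun_sum _ fun n _ =>
    Finset.aestronglyMeasurable_fun_prod _ fun i _ => ?_).const_mul _
  exact (hf i).comp_measurePreserving (measurePreserving_tp hT _)

lemma Bdd.multAvg (hT : MeasurePreserving T μ μ) {f : Fin l → X → ℂ} (hf : ∀ i, Bdd μ 1 (f i))
    (N : ℕ) : Bdd μ 1 (multAvg T a f N) := by
  have h1 := (Bdd.sum (s := Finset.Icc 1 N) (f := fun n x => ∏ i, f i (tp T (a i N n) x))
    (b := fun _ => 1) fun n _ => Bdd.prod fun i _ => (hf i).comp_tp hT _).const_mul (N : ℂ)⁻¹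
  refine Bdd.mono h1 ?_
  simp only [Finset.sum_const, Nat.card_Icc, Nat.add_sub_cancel, nsmul_eq_mul, _root_.mul_one, norm_inv,
    Complex.norm_natCast]
  exact inv_mul_le_one (G₀ := ℝ)

lemma multAvg_const_mul (c : Fin l → ℂ) (f : Fin l → X → ℂ) (N : ℕ) (x : X) :
    multAvg T a (fun i x => c i * f i x) N x = (∏ i, c i) * multAvg T a f N x := by
  simp only [multAvg_eq, Finset.prod_mul_distrib, ← Finset.mul_sum]
  ring

lemma multAvg_sub {u v w : Fin l → X → ℂ} (i : Fin l) (hi : ∀ x, w i x = u i x - v i x)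
    (hu : ∀ j, j ≠ i → u j = w j) (hv : ∀ j, j ≠ i → v j = w j) (N : ℕ) (x : X) :
    multAvg T a w N x = multAvg T a u N x - multAvg T a v N x := by
  simp only [multAvg_eq, ← mul_sub, ← Finset.sum_sub_distrib]
  congr 1
  refine Finset.sum_congr rfl fun n _ => ?_
  simp only [Fintype.prod_eq_mul_prod_compl i]
  have h1 : ∀ g : Fin l → X → ℂ, (∀ j, j ≠ i → g j = w j) →
      ∏ j ∈ {i}ᶜ, g j (tp T (a j N n) x) = ∏ j ∈ {i}ᶜ, w j (tp T (a j N n) x) := by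
    intro g hg
    refine Finset.prod_congr rfl fun j hj => ?_
    rw [hg j (by simpa using hj)]
  rw [h1 u hu, h1 v hv, hi, sub_mul]

variable [IsProbabilityMeasure μ]

/-- The square of the norm of the multiple average is an average of correlations of `f i`, the
function in place `i` being replaced by the conjugate of the multiple average itself. -/
lemma norm_sq_multAvg_le (hT : MeasurePreserving T μ μ) {f : Fin l → X → ℂ}
    (hf : ∀ i, Bdd μ 1 (f i)) (i : Fin l) (N : ℕ) :
    ‖((Bdd.multAvg (a := a) hT hf N).memLp 2).toLp _‖ ^ 2 ≤
      (N : ℝ)⁻¹ * ∑ n ∈ Finset.Icc 1 N, ‖corr μ T (f i)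
        (fun j => if j = i then fun x => (starRingEnd ℂ) (multAvg T a f N x) else f j)
        fun j => (if j = i then 0 else a j N n) - a i N n‖ := by
  set A := multAvg T a f N with hA
  have hAb : Bdd μ 1 A := Bdd.multAvg hT hf N
  set g : Fin l → X → ℂ :=
    fun j => if j = i then fun x => (starRingEnd ℂ) (A x) else f j with hg
  have hb : ∀ n, Bdd μ 1 fun x => (∏ j, f j (tp T (a j N n) x)) * (starRingEnd ℂ) (A x) :=
    fun n => (Bdd.prod fun j _ => (hf j).comp_tp hT _).mul_one hAb.conj
  have h1 : ∫ x, A x * (starRingEnd ℂ) (A x) ∂μ = (N : ℂ)⁻¹ * ∑ n ∈ Finset.Icc 1 N,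
      ∫ x, (∏ j, f j (tp T (a j N n) x)) * (starRingEnd ℂ) (A x) ∂μ := by
    rw [← integral_finsetSum _ fun n _ => (hb n).integrable, ← integral_const_mul]
    congr 1
    ext x
    rw [← Finset.sum_mul, ← mul_assoc]
    rfl
  have h2 : ∀ n, ∫ x, (∏ j, f j (tp T (a j N n) x)) * (starRingEnd ℂ) (A x) ∂μ =
      corr μ T (f i) g fun j => (if j = i then 0 else a j N n) - a i N n := by
    intro n
    rw [← integral_shift_eq_corr hT]
    congr 1
    ext x
    have h3 : ∏ j, g j (tp T (if j = i then 0 else a j N n) x) =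
        (starRingEnd ℂ) (A x) * ∏ j ∈ {i}ᶜ, f j (tp T (a j N n) x) := by
      rw [Fintype.prod_eq_mul_prod_compl i]
      congr 1
      · simp [hg]
      · refine Finset.prod_congr rfl fun j hj => ?_
        have hj' : j ≠ i := by simpa using hj
        simp only [hg, if_neg hj']
    rw [h3, Fintype.prod_eq_mul_prod_compl i]
    ring
  rw [norm_sq_toLp, h1]
  simp only [h2]
  refine (Complex.re_le_norm _).trans ?_
  rw [norm_mul, norm_inv, Complex.norm_natCast]
  exact mul_le_mul_of_nonneg_left (norm_sum_le _ _) (by positivity)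

end MultAvg

/-! ### Characteristic factors -/

section Characteristic

variable {X : Type*} [MeasurableSpace X] {μ : Measure X} {T : X ≃ᵐ X}

/-- A measure preserving automorphism whose inverse preserves the functions with vanishing
Host–Kra seminorm is measurable with respect to the nilfactor. -/
lemma measurable_nilfactor {S : X ≃ᵐ X} (hS : MeasurePreserving S μ μ)
    (h : ∀ k f, MemLp f ∞ μ → hkSeminorm μ T k f = 0 →
      hkSeminorm μ T k (fun x => f (S.symm x)) = 0) :
    Measurable[nilfactor μ T, nilfactor μ T] S := by
  rw [measurable_iff_comap_le, nilfactor, MeasurableSpace.comap_iSup]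
  refine iSup_mono fun k => ?_
  rw [stepNilfactor, MeasurableSpace.comap_generateFrom]
  refine MeasurableSpace.generateFrom_mono ?_
  rintro _ ⟨A, ⟨hA, hA0⟩, rfl⟩
  refine ⟨S.measurable hA, fun f hf hf0 => ?_⟩
  have h1 := hA0 (fun x => f (S.symm x)) (hf.comp_measurePreserving (hS.symm S)) (h _ f hf hf0)
  rw [← hS.setIntegral_preimage_emb S.measurableEmbedding] at h1
  simpa only [MeasurableEquiv.symm_apply_apply] using h1

variable [IsProbabilityMeasure μ]

lemma condExp_invariants_comp (hT : MeasurePreserving T μ μ) {f : X → ℂ} (hf : Integrable f μ) :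
    μ[fun x => f (T x) | MeasurableSpace.invariants T] =ᵐ[μ]
      μ[f | MeasurableSpace.invariants T] := by
  have hle := MeasurableSpace.invariants_le (T : X → X)
  have hfT : Integrable (fun x => f (T x)) μ := hT.integrable_comp_of_integrable hf
  refine ae_eq_condExp_of_forall_setIntegral_eq hle hf
    (fun s _ _ => integrable_condExp.integrableOn) (fun s hs _ => ?_)
    stronglyMeasurable_condExp.aestronglyMeasurable
  rw [setIntegral_condExp hle hfT hs]
  have h1 := (MeasurableSpace.measurableSet_invariants.1 hs).2
  have h2 := hT.setIntegral_preimage_emb T.measurableEmbedding f s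
  rwa [h1] at h2

lemma hkPow_comp (hT : MeasurePreserving T μ μ) (k : ℕ) {B : ℝ} {f : X → ℂ} (hf : Bdd μ B f) :
    hkPow μ T k (fun x => f (T x)) = hkPow μ T k f := by
  induction k generalizing B f with
  | zero =>
    refine integral_congr_ae ?_
    filter_upwards [condExp_invariants_comp hT hf.integrable] with x hx
    rw [hx]
  | succ k ih =>
    simp only [hkPow]
    congr 1
    ext N
    congr 1
    refine Finset.sum_congr rfl fun n _ => ?_
    rw [← ih (hf.deriv hT n)]
    simp only [← Function.iterate_succ_apply, ← Function.iterate_succ_apply']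

lemma hkSeminorm_comp_symm (hT : MeasurePreserving T μ μ) (k : ℕ) {B : ℝ} {f : X → ℂ}
    (hf : Bdd μ B f) : hkSeminorm μ T k (fun x => f (T.symm x)) = hkSeminorm μ T k f := by
  have h1 : Bdd μ B fun x => f (T.symm x) := by
    simpa only [tp_neg_one] using hf.comp_tp hT (-1)
  have h2 := hkPow_comp hT k h1
  simp only [MeasurableEquiv.symm_apply_apply] at h2
  rw [hkSeminorm, hkSeminorm, ← h2]

lemma hkSeminorm_comp (hT : MeasurePreserving T μ μ) (k : ℕ) {B : ℝ} {f : X → ℂ}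
    (hf : Bdd μ B f) : hkSeminorm μ T k (fun x => f (T x)) = hkSeminorm μ T k f := by
  rw [hkSeminorm, hkSeminorm, hkPow_comp hT k hf]

lemma measurableSet_nilfactor_preimage_iff (hT : MeasurePreserving T μ μ) (A : Set X) :
    MeasurableSet[nilfactor μ T] (T ⁻¹' A) ↔ MeasurableSet[nilfactor μ T] A := by
  have h1 : Measurable[nilfactor μ T, nilfactor μ T] T :=
    measurable_nilfactor hT fun k f hf h0 => by
      obtain ⟨B, -, hB⟩ := exists_bdd_of_memLp_top hf
      rw [hkSeminorm_comp_symm hT k hB, h0]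
  have h2 : Measurable[nilfactor μ T, nilfactor μ T] T.symm :=
    measurable_nilfactor (hT.symm T) fun k f hf h0 => by
      obtain ⟨B, -, hB⟩ := exists_bdd_of_memLp_top hf
      rw [MeasurableEquiv.symm_symm, hkSeminorm_comp hT k hB, h0]
  refine ⟨fun hA => ?_, fun hA => h1 hA⟩
  have h3 := h2 hA
  rwa [← Set.preimage_comp, MeasurableEquiv.self_comp_symm, Set.preimage_id] at h3

/-- The case of functions bounded by one. -/
lemma SuperNice.tendsto_multAvg_of_bdd {l : ℕ} {p : Fin l → PolySeq} (hp : SuperNice p)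
    (hT : MeasurePreserving T μ μ) {f : Fin l → X → ℂ} (hf : ∀ i, Bdd μ 1 (f i)) {i : Fin l}
    (h0 : μ[f i | nilfactor μ T] =ᵐ[μ] 0) :
    Tendsto (fun N => eLpNorm (multAvg T (fun i N n => ⌊(p i N).eval (n : ℝ)⌋) f N) 2 μ)
      atTop (𝓝 0) := by
  set a : Fin l → ℕ → ℕ → ℤ := fun i N n => ⌊(p i N).eval (n : ℝ)⌋ with ha
  have hcorr : CorrToZero μ T (f i) fun N n j => (if j = i then 0 else a j N n) - a i N n := by
    refine (hp.ctl hT (hf i) h0 i (Fin l) (primed p i) fun j => ⟨j, rfl⟩).of_close hT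
      (fun _ _ => 0) 1 (Eventually.of_forall fun N n _ j => ?_)
    by_cases hj : j = i
    · have h1 := abs_floor_sub_le 0 ((p i N).eval (n : ℝ))
      simp only [Int.floor_zero, zero_sub] at h1
      simpa only [primed, hj, if_true, zero_sub, Pi.neg_apply, eval_neg] using h1
    · have h1 := abs_floor_sub_le ((p j N).eval (n : ℝ)) ((p i N).eval (n : ℝ))
      simpa only [primed, hj, if_false, Pi.sub_apply, eval_sub] using h1
  have h1 := hcorr (fun N j =>
    if j = i then fun x => (starRingEnd ℂ) (multAvg T a f N x) else f j) fun N j => by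
      split_ifs
      · exact (Bdd.multAvg hT hf N).conj
      · exact hf j
  have h2 := squeeze_zero (fun N => sq_nonneg _)
    (fun N => norm_sq_multAvg_le (a := a) hT hf i N) h1
  have h3 := (Real.continuous_sqrt.tendsto _).comp h2
  rw [Real.sqrt_zero] at h3
  have h4 := ENNReal.tendsto_ofReal h3
  rw [ENNReal.ofReal_zero] at h4
  refine h4.congr fun N => ?_
  rw [Function.comp_apply, Real.sqrt_sq (norm_nonneg _), Lp.norm_toLp,
    ENNReal.ofReal_toReal ((Bdd.multAvg hT hf N).memLp 2).2.ne]

lemma SuperNice.tendsto_multAvg {l : ℕ} {p : Fin l → PolySeq} (hp : SuperNice p)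
    (hT : MeasurePreserving T μ μ) {f : Fin l → X → ℂ} (hf : ∀ i, MemLp (f i) ∞ μ) {i : Fin l}
    (h0 : μ[f i | nilfactor μ T] =ᵐ[μ] 0) :
    Tendsto (fun N => eLpNorm (multAvg T (fun i N n => ⌊(p i N).eval (n : ℝ)⌋) f N) 2 μ)
      atTop (𝓝 0) := by
  choose B hB1 hB using fun i => exists_bdd_of_memLp_top (hf i)
  have hB0 : ∀ i, (B i : ℂ) ≠ 0 := fun i => by
    exact_mod_cast (zero_lt_one.trans_le (hB1 i)).ne'
  set f' : Fin l → X → ℂ := fun i x => (B i : ℂ)⁻¹ * f i x with hf'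
  have hf'b : ∀ i, Bdd μ 1 (f' i) := by
    intro i
    have h1 := (hB i).const_mul (B i : ℂ)⁻¹
    have h2 : ‖(B i : ℂ)⁻¹‖ * B i = 1 := by
      have h3 := zero_lt_one.trans_le (hB1 i)
      rw [norm_inv, Complex.norm_real, Real.norm_of_nonneg h3.le, inv_mul_cancel₀ h3.ne']
    rwa [h2] at h1
  have h0' : μ[f' i | nilfactor μ T] =ᵐ[μ] 0 := by
    refine (condExp_smul (μ := μ) ((B i : ℂ)⁻¹) (f i) (nilfactor μ T)).trans ?_
    filter_upwards [h0] with x hx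
    simp [hx]
  have h1 := hp.tendsto_multAvg_of_bdd hT hf'b h0'
  have h2 := ENNReal.Tendsto.const_mul (a := ‖∏ i, (B i : ℂ)‖ₑ) h1 (Or.inr enorm_ne_top)
  rw [mul_zero] at h2
  refine h2.congr fun N => ?_
  rw [← eLpNorm_const_smul]
  congr 1
  ext x
  have h3 : f = fun i x => (B i : ℂ) * f' i x := by
    ext i x
    rw [hf', mul_inv_cancel_left₀ (hB0 i)]
  conv_rhs => rw [h3, multAvg_const_mul]
  rfl

lemma SuperNice.isCharacteristicFactor {l : ℕ} {p : Fin l → PolySeq} (hp : SuperNice p)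
    (hT : MeasurePreserving T μ μ) : IsCharacteristicFactor (nilfactor μ T) μ T
      fun i N n => ⌊(p i N).eval (n : ℝ)⌋ := by
  classical
  refine ⟨nilfactor_le μ T, measurableSet_nilfactor_preimage_iff hT, fun f hf => ?_⟩
  set a : Fin l → ℕ → ℕ → ℤ := fun i N n => ⌊(p i N).eval (n : ℝ)⌋ with ha
  have hE : ∀ i, MemLp (μ[f i | nilfactor μ T]) ∞ μ := fun i => by
    obtain ⟨B, -, hB⟩ := exists_bdd_of_memLp_top (hf i)
    exact (hB.condExp (nilfactor_le μ T)).memLp ∞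
  -- the functions are replaced by their conditional expectations one at a time
  set g : Finset (Fin l) → Fin l → X → ℂ :=
    fun s i => if i ∈ s then μ[f i | nilfactor μ T] else f i with hg
  have hgm : ∀ s i, MemLp (g s i) ∞ μ := fun s i => by
    simp only [hg]
    split_ifs
    · exact hE i
    · exact hf i
  have key : ∀ s, Tendsto (fun N => eLpNorm (fun x => multAvg T a f N x -
      multAvg T a (g s) N x) 2 μ) atTop (𝓝 0) := by
    intro s
    induction s using Finset.induction_on with
    | empty =>
      have h1 : g ∅ = f := by ext i; simp [hg]
      simp [h1]
    | insert i s hi ih =>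
      set w : Fin l → X → ℂ :=
        fun j => if j = i then f i - μ[f i | nilfactor μ T] else g s j with hw
      have hwm : ∀ j, MemLp (w j) ∞ μ := fun j => by
        simp only [hw]
        split_ifs
        · exact (hf i).sub (hE i)
        · exact hgm s j
      have hw0 : μ[w i | nilfactor μ T] =ᵐ[μ] 0 := by
        have hint : ∀ u : X → ℂ, MemLp u ∞ μ → Integrable u μ := fun u hu =>
          memLp_one_iff_integrable.1 (hu.mono_exponent le_top)
        have h1 : w i = f i - μ[f i | nilfactor μ T] := by simp [hw]
        rw [h1]
        refine (condExp_sub (hint _ (hf i)) (hint _ (hE i)) _).trans ?_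
        filter_upwards [condExp_condExp_of_le (μ := μ) (f := f i) le_rfl (nilfactor_le μ T)]
          with x hx
        simp [hx]
      have h1 := ih.add (hp.tendsto_multAvg hT hwm hw0)
      rw [add_zero] at h1
      refine tendsto_of_tendsto_of_tendsto_of_le_of_le tendsto_const_nhds h1 (fun N => zero_le)
        fun N => ?_
      have h2 : (fun x => multAvg T a f N x - multAvg T a (g (insert i s)) N x) =
          (fun x => multAvg T a f N x - multAvg T a (g s) N x) + multAvg T a w N := by
        ext x
        rw [Pi.add_apply, multAvg_sub (u := g s) (v := g (insert i s)) (w := w) i]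
        · ring
        · intro x
          simp [hw, hg, hi]
        · intro j hj
          simp [hw, hj]
        · intro j hj
          simp [hw, hg, hj]
      rw [h2]
      exact eLpNorm_add_le ((aestronglyMeasurable_multAvg hT (fun i => (hf i).1) N).sub
        (aestronglyMeasurable_multAvg hT (fun i => (hgm s i).1) N))
        (aestronglyMeasurable_multAvg hT (fun i => (hwm i).1) N) (by norm_num)
  have h1 : g Finset.univ = fun i => μ[f i | nilfactor μ T] := by ext i; simp [hg]
  simpa only [h1] using key Finset.univ

end Characteristic

end VarPoly

end

theorem proposition4p5 {l : ℕ} (p : Fin l → ℕ → Polynomial ℝ) (hp : VarPoly.SuperNice p)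
    {X : Type*} [MeasurableSpace X] [StandardBorelSpace X]
    (μ : MeasureTheory.Measure X) [MeasureTheory.IsProbabilityMeasure μ]
    (T : X ≃ᵐ X) (hT : MeasureTheory.MeasurePreserving T μ μ) :
    (∀ f : Fin l → X → ℂ, (∀ i, MeasureTheory.MemLp (f i) ∞ μ) →
      (∃ i, μ[f i | VarPoly.nilfactor μ T] =ᵐ[μ] 0) →
      Filter.Tendsto
        (fun N => MeasureTheory.eLpNorm
          (VarPoly.multAvg T (fun i N n => ⌊(p i N).eval (n : ℝ)⌋) f N) 2 μ)
        Filter.atTop (nhds 0)) ∧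
    VarPoly.IsCharacteristicFactor (VarPoly.nilfactor μ T) μ T
      (fun i N n => ⌊(p i N).eval (n : ℝ)⌋) :=
  ⟨fun _ hf ⟨_, h0⟩ => hp.tendsto_multAvg hT hf h0, hp.isCharacteristicFactor hT⟩
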